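/- **Setting.** Let $\mathcal A$ be an alphabet of $d\ge 1$ letters, $\pi=(\pi_0,\pi_1)$ a pair of bijections $\mathcal A\to\{1,\dots,d\}$ that is irreducible ($\pi_1\circ\pi_0^{-1}\{1,\dots,k\}\ne\{1,\dots,k\}$ for $1\le k<d$), $\lambda\in\mathbb R_{>0}^{\mathcal A}$, $|\lambda|=\sum_\alpha\lambda_\alpha$, $I=[0,|\lambda|)$. Put $l_\alpha=\sum_{\pi_0(\beta)<\pi_0(\alpha)}\lambda_\beta$, $r_\alpha=l_\alpha+\lambda_\alpha$, $I_\alpha=[l_\alpha,r_\alpha)$, $l'_\alpha=\sum_{\pi_1(\beta)<\pi_1(\alpha)}\lambda_\beta$. The interval exchange transformation (IET) $T=T_{(\pi,\lambda)}:I\to I$ is $Tx=x+l'_\alpha-l_\alpha$ for $x\in I_\alpha$. It satisfies Keane's condition if $T^ml_\alpha\ne l_\beta$ for all $m\ge1$ and all $\alpha,\beta$ with $\pi_0(\beta)\neq1$. Let $\Omega_\pi$ be the matrix with $\Omega_{\alpha\beta}=1$ if $\pi_1(\alpha)>\pi_1(\beta),\ \pi_0(\alpha)<\pi_0(\beta)$,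 $\Omega_{\alpha\beta}=-1$ if $\pi_1(\alpha)<\pi_1(\beta),\ \pi_0(\alpha)>\pi_0(\beta)$, and $0$ otherwise; $H(\pi)=\Omega_\pi(\mathbb R^{\mathcal A})$ and $\mathfrak g=\frac12\dim H(\pi)$. **Rauzy–Veech induction.** Put $\epsilon=0$ if $\lambda_{\pi_0^{-1}(d)}>\lambda_{\pi_1^{-1}(d)}$, $\epsilon=1$ if $<$. The winner is $w=\pi_\epsilon^{-1}(d)$ and the loser $z=\pi_{1-\epsilon}^{-1}(d)$; $A(\pi,\lambda)=\mathrm{Id}+E_{wz}$ ($E_{wz}$ the elementary matrix), and $\mathcal R(\pi,\lambda)=(\tilde\pi,\tilde\lambda)$ with $\tilde\lambda=A(\pi,\lambda)^{-1}\lambda$, $\tilde\pi_\epsilon=\pi_\epsilon$, and $\tilde\pi_{1-\epsilon}$ obtained from $\pi_{1-\epsilon}$ by moving $z$ to the position right after $w$. Let $A^{(m)}(\pi,\lambda)=A(\pi,\lambda)A(\mathcal R(\pi,\lambda))\cdots A(\mathcal R^{m-1}(\pi,\lambda))$. For an accelerating sequence (strictly increasing integers $(n_k)_{k\ge0}$ with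 $n_0=0$) let $(\pi^{(k)},\lambda^{(k)})=\mathcal R^{n_k}(\pi,\lambda)$, $I^{(k)}=[0,|\lambda^{(k)}|)$, $I^{(k)}_\alpha$ the exchanged intervals (of length $\lambda^{(k)}_\alpha$), $Q(k,l)=\big(A^{(n_l-n_k)}(\pi^{(k)},\lambda^{(k)})\big)^t$, $Q(k)=Q(0,k)$, $Z(k+1)=Q(k,k+1)$, $Q_\alpha(k)=\sum_\beta Q_{\alpha\beta}(k)$. Vectors carry the norm $\|v\|=\sum_\alpha|v_\alpha|$, matrices the norm $\|B\|=\max_\alpha\sum_\beta|B_{\alpha\beta}|$. **FDC.** $T$ satisfies the Filtration Diophantine Condition, relative to a fixed reference acceleration and with exponents $\lambda_1>\dots>\lambda_{\mathfrak g}>\lambda_{\mathfrak g+1}=0$, if it satisfies Keane's condition and: (a) there are subspaces $\{0\}=E_0\subset E_{-1}\subset\dots\subset E_{-\mathfrak g}\subset E_{cs}=E_{\mathfrak g+1}\subset E_{\mathfrak g}\subset\dots\subset E_1=\mathbb R^{\mathcal A}$ with $\dim E_{-i}-\dim E_{-i+1}=\dim E_i-\dim E_{i+1}=1$ for $1\le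 i\le \mathfrak g$ such that, for the $Q(k)$ of the reference acceleration, $\lim_k\frac1k\log\|Q(k)h\|$ equals $-\lambda_i$ for $h\in E_{-i}\setminus E_{-i+1}$, $0$ for $h\in E_{cs}\setminus E_{-\mathfrak g}$, and $\lambda_i$ for $h\in E_i\setminus E_{i+1}$ ($1\le i\le \mathfrak g$); (b) for every $\tau>0$ there are $c>0$, $C,\kappa\ge1$, an accelerating sequence (in general different from the reference one; the $Q$, $Z$, $I^{(k)}$ in the rest of (b) refer to it), integers $r_m\ge 0$ with $r_0=0$, and subspaces $\{0\}=U_1\subset\dots\subset U_{\mathfrak g+1}\subset H(\pi)$ with $E_j\oplus U_j=\mathbb R^{\mathcal A}$ for $1\le j\le \mathfrak g+1$, such that, with $r(k,l)=\sum_{k\le i<l}r_i$, $E_j^{(k)}=Q(k)E_j$, $U_j^{(k)}=Q(k)U_j$: * for some $0<\delta<1$ and every $k\ge1$ there is an integer $0<p_k\le\min_\alpha Q_\alpha(k)$ such that the sets $T^iI^{(k)}$, $0\le i<p_k$, are pairwise disjoint intervals whose union has measure at least $\delta|I|$; * $\lim_{m}r(0,m)/m$ exists and lies in $(1,1+\tau)$;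 * $\|Q(k,l)|_{E_j^{(k)}}\|\le Ce^{(\lambda_j+\tau)r(k,l)}$ for $0\le k<l$, $1\le j\le \mathfrak g+1$; * $\|(Q(k,l)|_{U_j^{(k)}})^{-1}\|\le Ce^{(-\lambda_{j-1}+\tau)r(k,l)}$ for $0\le k<l$, $2\le j\le \mathfrak g+1$; * $\|Z(k+1)\|\le Ce^{\tau k}$, $\ ce^{\lambda_1k}\le\|Q(k)\|\le Ce^{\lambda_1(1+\tau)k}$ and $\max_\alpha|I^{(k)}|/|I^{(k)}_\alpha|\le\kappa$ for $k\ge0$; * $|\sin\angle(E_j^{(k)},U_j^{(k)})|\ge c\|Q(k)\|^{-\tau}$ for $k\ge0$, $2\le j\le \mathfrak g+1$, where the left side is the infimum of $|\sin\angle(e,u)|$ (Euclidean angle) over nonzero $e\in E_j^{(k)}$, $u\in U_j^{(k)}$. **The space $P_aG$.** With $m_\alpha=(l_\alpha+r_\alpha)/2$, a function $\varphi$ belongs to $P_aG$ if it is $C^1$ on each $(l_\alpha,r_\alpha)$, the quantities $|\varphi'(x)|(x-l_\alpha)^{1+a}$ on $(l_\alpha,m_\alpha]$ and $|\varphi'(x)|(r_\alpha-x)^{1+a}$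 on $[m_\alpha,r_\alpha)$ are bounded, the limits $C^+_\alpha=-\lim_{x\searrow l_\alpha}\varphi'(x)(x-l_\alpha)^{1+a}$ and $C^-_\alpha=\lim_{x\nearrow r_\alpha}\varphi'(x)(r_\alpha-x)^{1+a}$ exist, and $C^-_{\pi_0^{-1}(d)}C^-_{\pi_1^{-1}(d)}=0=C^+_{\pi_0^{-1}(1)}C^+_{\pi_1^{-1}(1)}$. **Special flow.** For $g:I\to\mathbb R_{>0}$ with $\inf_Ig>0$ let $g^{(m)}(x)=\sum_{0\le i<m}g(T^ix)$, $I^g=\{(x,r):x\in I,\ 0\le r<g(x)\}$ with Lebesgue measure, and, for $t\ge0$, $T^g_t(x,r)=(T^mx,\,r+t-g^{(m)}(x))$, where $m$ is the unique integer with $g^{(m)}(x)\le r+t<g^{(m+1)}(x)$. **Proposition.** Suppose that the IET $T$ satisfies FDC. Let $0<a<1$, let $g\in P_aG$ with $\inf_Ig>0$, and let $f:I^g\to\mathbb R$ be a bounded measurable function for which there is $K>0$ with $f(x,r)=0$ whenever $r\ge K$. Suppose that there is $h=(h_\alpha)_{\alpha\in\mathcal A}\in H(\pi)$ with $$\varphi_f(x):=\int_0^{g(x)}f(x,r)\,dr=h_\alpha\quad\text{for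 a.e. }x\in I_\alpha,\ \alpha\in\mathcal A,$$ and that for some $\lambda>0$ (a number, not the length vector) $\lim_{k\to\infty}\frac1k\log\|Q(k)h\|=\lambda$, with $Q(k)$ taken along the reference acceleration. Then, with $\log0=-\infty$, $$\limsup_{s\to+\infty}\frac{\log\left|\int_0^sf(T^g_t(x,r))\,dt\right|}{\log s}=\frac{\lambda}{\lambda_1}\quad\text{for a.e. }(x,r)\in I^g,$$ $$\limsup_{s\to+\infty}\frac{\log\left\|\int_0^sf\circ T^g_t\,dt\right\|_{L^1(I^g)}}{\log s}=\frac{\lambda}{\lambda_1}.$$ -/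

import Mathlib

open Set Filter Topology MeasureTheory

noncomputable section

/-- The position `j` (counted from `0` to `n`) after the last position `n` has been moved
right behind the position `m`. -/
def rauzyPos (n m j : ℕ) : ℕ :=
  if j ≤ m then j else if j < n then j + 1 else m + 1

/-- `rauzyPos` as a permutation of the `n + 1` positions. -/
def rauzyShift {n : ℕ} (m : Fin (n + 1)) : Equiv.Perm (Fin (n + 1)) where
  toFun j := ⟨rauzyPos n m j, by
    have := m.isLt; have := j.isLt; unfold rauzyPos; split_ifs <;> omega⟩
  invFun j := ⟨if (j : ℕ) ≤ m then j else if (j : ℕ) = m + 1 then n else j - 1, by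
    have := m.isLt; have := j.isLt; split_ifs <;> omega⟩
  left_inv j := by
    have := m.isLt; have := j.isLt
    ext; simp only [rauzyPos]; split_ifs <;> omega
  right_inv j := by
    have := m.isLt; have := j.isLt
    ext; simp only [rauzyPos]; split_ifs <;> omega

/-- The data `(π, λ)` of an interval exchange of `d = n + 1` intervals labelled by the alphabet
`𝒜`: `top = π₀` and `bot = π₁` (positions are counted from `0` instead of `1`), `len = λ`. -/
structure IETData (𝒜 : Type*) (n : ℕ) where
  top : 𝒜 ≃ Fin (n + 1)
  bot : 𝒜 ≃ Fin (n + 1)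
  len : 𝒜 → ℝ

namespace IETData

variable {𝒜 : Type*} [Fintype 𝒜] [DecidableEq 𝒜] {n : ℕ}

/-! ### The interval exchange transformation -/

/-- `|λ|`, the length of `I`. -/
def total (D : IETData 𝒜 n) : ℝ := ∑ α, D.len α

/-- The interval `I = [0, |λ|)`. -/
def base (D : IETData 𝒜 n) : Set ℝ := Ico 0 D.total

/-- `l_α` -/
def left (D : IETData 𝒜 n) (α : 𝒜) : ℝ :=
  ∑ β ∈ Finset.univ.filter (fun β => D.top β < D.top α), D.len β

/-- `r_α` -/
def right (D : IETData 𝒜 n) (α : 𝒜) : ℝ :=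
  ∑ β ∈ Finset.univ.filter (fun β => D.top β ≤ D.top α), D.len β

/-- `l'_α`, the left end of the image of `I_α`. -/
def left' (D : IETData 𝒜 n) (α : 𝒜) : ℝ :=
  ∑ β ∈ Finset.univ.filter (fun β => D.bot β < D.bot α), D.len β

/-- The midpoint of `I_α`. -/
def mid (D : IETData 𝒜 n) (α : 𝒜) : ℝ := (D.left α + D.right α) / 2

/-- The interval exchange `T`: the translation by `l'_α - l_α` on each `I_α = [l_α, r_α)`
(and the identity outside of `I`). -/
def iet (D : IETData 𝒜 n) (x : ℝ) : ℝ :=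
  x + ∑ α, (Ico (D.left α) (D.right α)).indicator (fun _ => D.left' α - D.left α) x

/-- Irreducibility of the pair `π`. -/
def IsIrreducible (D : IETData 𝒜 n) : Prop :=
  ∀ k : ℕ, 1 ≤ k → k < n + 1 →
    (fun i => D.bot (D.top.symm i)) '' {i : Fin (n + 1) | (i : ℕ) < k} ≠
      {i : Fin (n + 1) | (i : ℕ) < k}

/-- The Keane condition. -/
def Keane (D : IETData 𝒜 n) : Prop :=
  ∀ m : ℕ, 1 ≤ m → ∀ α β : 𝒜, D.top β ≠ 0 → D.iet^[m] (D.left α) ≠ D.left β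

/-- The matrix `Ω_π`. -/
def omegaMat (D : IETData 𝒜 n) : Matrix 𝒜 𝒜 ℝ := fun α β =>
  if D.bot β < D.bot α ∧ D.top α < D.top β then 1
  else if D.bot α < D.bot β ∧ D.top β < D.top α then -1
  else 0

/-- `H(π) = Ω_π(ℝ^𝒜)`. -/
def H (D : IETData 𝒜 n) : Submodule ℝ (𝒜 → ℝ) := LinearMap.range (Matrix.toLin' D.omegaMat)

/-- The genus `g`, given by `2 g = dim H(π)`. -/
def genus (D : IETData 𝒜 n) : ℕ := Module.finrank ℝ D.H / 2

/-! ### Rauzy-Veech induction and the Kontsevich-Zorich cocycle -/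

/-- The letter that is last in the upper row. -/
def lastTop (D : IETData 𝒜 n) : 𝒜 := D.top.symm (Fin.last n)

/-- The letter that is last in the lower row. -/
def lastBot (D : IETData 𝒜 n) : 𝒜 := D.bot.symm (Fin.last n)

open Classical in
/-- The matrix `A(π, λ)`. The two lengths compared here are distinct under the Keane condition
(for at least two intervals). -/
def rauzyMat (D : IETData 𝒜 n) : Matrix 𝒜 𝒜 ℝ :=
  if D.len D.lastBot < D.len D.lastTop then 1 + Matrix.single D.lastTop D.lastBot 1
  else 1 + Matrix.single D.lastBot D.lastTop 1

open Classical in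
/-- One step `(π, λ) ↦ (π̃, λ̃)` of the (not normalized) Rauzy-Veech induction: the last letter of
the losing row is moved right behind the winning letter, and the length of the loser is subtracted
from the length of the winner, so that `λ = A(π, λ) λ̃`. -/
def rauzy (D : IETData 𝒜 n) : IETData 𝒜 n :=
  if D.len D.lastBot < D.len D.lastTop then
    { top := D.top
      bot := D.bot.trans (rauzyShift (D.bot D.lastTop))
      len := Function.update D.len D.lastTop (D.len D.lastTop - D.len D.lastBot) }
  else
    { top := D.top.trans (rauzyShift (D.top D.lastBot))
      bot := D.bot
      len := Function.update D.len D.lastBot (D.len D.lastBot - D.len D.lastTop) }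

/-- `A^{(m)} = A(T) A(R T) ⋯ A(R^{m-1} T)`. -/
def cocycle (D : IETData 𝒜 n) : ℕ → Matrix 𝒜 𝒜 ℝ
  | 0 => 1
  | m + 1 => cocycle D m * (rauzy^[m] D).rauzyMat

/-- Accelerating sequences. -/
def IsAccelerating (N : ℕ → ℕ) : Prop := N 0 = 0 ∧ StrictMono N

/-- The data `(π^{(k)}, λ^{(k)})` of the `k`-th induced interval exchange of the acceleration
`N`. -/
def step (D : IETData 𝒜 n) (N : ℕ → ℕ) (k : ℕ) : IETData 𝒜 n := rauzy^[N k] D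

/-- The matrix `Q(k, l)` of the acceleration `N`. -/
def Q (D : IETData 𝒜 n) (N : ℕ → ℕ) (k l : ℕ) : Matrix 𝒜 𝒜 ℝ :=
  ((D.step N k).cocycle (N l - N k)).transpose

end IETData

/-! ### Norms and angles in `ℝ^𝒜` -/

/-- The norm of a vector: the sum of the absolute values of the coordinates. -/
def vecNorm {𝒜 : Type*} [Fintype 𝒜] (v : 𝒜 → ℝ) : ℝ := ∑ α, |v α|

/-- The norm of a matrix: the largest absolute row sum. -/
def matNorm {𝒜 : Type*} [Fintype 𝒜] (B : Matrix 𝒜 𝒜 ℝ) : ℝ := ⨆ α, ∑ β, |B α β|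

/-- The sine of the Euclidean angle between two vectors. -/
def sinAngle {𝒜 : Type*} [Fintype 𝒜] (u v : 𝒜 → ℝ) : ℝ :=
  Real.sin (InnerProductGeometry.angle
    (WithLp.toLp 2 u : EuclideanSpace ℝ 𝒜) (WithLp.toLp 2 v : EuclideanSpace ℝ 𝒜))

namespace IETData

variable {𝒜 : Type*} [Fintype 𝒜] [DecidableEq 𝒜] {n : ℕ}

/-! ### Diophantine conditions -/

/-- The vector `h` has exponential growth rate `ρ` under the cocycle accelerated by `N`:
`lim_k log ‖Q(k) h‖ / k = ρ`. -/
def HasGrowthRate (D : IETData 𝒜 n) (N : ℕ → ℕ) (h : 𝒜 → ℝ) (ρ : ℝ) : Prop :=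
  Tendsto (fun k : ℕ => Real.log (vecNorm ((D.Q N 0 k).mulVec h)) / (k : ℝ)) atTop (𝓝 ρ)

/-- `E` is the Oseledets filtration
`{0} = E₀ ⊆ E₋₁ ⊆ ⋯ ⊆ E_{-g} ⊆ E_cs = E_{g+1} ⊆ E_g ⊆ ⋯ ⊆ E₁ = ℝ^𝒜`
of the cocycle accelerated by `N`, with Lyapunov exponents `Λ 1 > ⋯ > Λ g > Λ (g + 1) = 0`. -/
structure IsOseledetsFiltration (D : IETData 𝒜 n) (N : ℕ → ℕ) (Λ : ℕ → ℝ)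
    (E : ℤ → Submodule ℝ (𝒜 → ℝ)) : Prop where
  exponent_lt : ∀ i : ℕ, 1 ≤ i → i ≤ D.genus → Λ (i + 1) < Λ i
  exponent_last : Λ (D.genus + 1) = 0
  bot_eq : E 0 = ⊥
  neg_le : ∀ i : ℕ, 1 ≤ i → i ≤ D.genus → E (-(i : ℤ) + 1) ≤ E (-(i : ℤ))
  cs_le : E (-(D.genus : ℤ)) ≤ E ((D.genus : ℤ) + 1)
  pos_le : ∀ i : ℕ, 1 ≤ i → i ≤ D.genus → E ((i : ℤ) + 1) ≤ E (i : ℤ)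
  top_eq : E 1 = ⊤
  neg_growth : ∀ i : ℕ, 1 ≤ i → i ≤ D.genus →
    ∀ h ∈ E (-(i : ℤ)), h ∉ E (-(i : ℤ) + 1) → D.HasGrowthRate N h (-Λ i)
  cs_growth : ∀ h ∈ E ((D.genus : ℤ) + 1), h ∉ E (-(D.genus : ℤ)) → D.HasGrowthRate N h 0
  pos_growth : ∀ i : ℕ, 1 ≤ i → i ≤ D.genus →
    ∀ h ∈ E (i : ℤ), h ∉ E ((i : ℤ) + 1) → D.HasGrowthRate N h (Λ i)
  neg_dim : ∀ i : ℕ, 1 ≤ i → i ≤ D.genus →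
    Module.finrank ℝ (E (-(i : ℤ))) = Module.finrank ℝ (E (-(i : ℤ) + 1)) + 1
  pos_dim : ∀ i : ℕ, 1 ≤ i → i ≤ D.genus →
    Module.finrank ℝ (E (i : ℤ)) = Module.finrank ℝ (E ((i : ℤ) + 1)) + 1

/-- A filtration `{0} = U₁ ⊆ ⋯ ⊆ U_{g+1} ⊆ H(π)` with `E_j ⊕ U_j = ℝ^𝒜` for
`1 ≤ j ≤ g + 1`. -/
structure IsComplementaryFiltration (D : IETData 𝒜 n) (E : ℤ → Submodule ℝ (𝒜 → ℝ))
    (U : ℕ → Submodule ℝ (𝒜 → ℝ)) : Prop where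
  bot_eq : U 1 = ⊥
  le_succ : ∀ j : ℕ, 1 ≤ j → j ≤ D.genus → U j ≤ U (j + 1)
  le_H : U (D.genus + 1) ≤ D.H
  isCompl : ∀ j : ℕ, 1 ≤ j → j ≤ D.genus + 1 → IsCompl (E (j : ℤ)) (U j)

/-- The Rokhlin towers condition along the acceleration `N`. The `Q_α(k)` are the row sums of
`Q(k)`. -/
def RokhlinTowers (D : IETData 𝒜 n) (N : ℕ → ℕ) : Prop :=
  ∃ δ : ℝ, 0 < δ ∧ δ < 1 ∧ ∀ k : ℕ, 1 ≤ k → ∃ p : ℕ, 0 < p ∧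
    (∀ α, (p : ℝ) ≤ ∑ β, D.Q N 0 k α β) ∧
    (∀ i < p, OrdConnected (D.iet^[i] '' (D.step N k).base)) ∧
    (∀ i < p, ∀ j < p, i ≠ j →
      Disjoint (D.iet^[i] '' (D.step N k).base) (D.iet^[j] '' (D.step N k).base)) ∧
    ENNReal.ofReal (δ * D.total) ≤ volume (⋃ i ∈ Finset.range p, D.iet^[i] '' (D.step N k).base)

/-- The estimates of the Filtration Diophantine Condition for one value of `τ`: `M` is the
accelerating sequence belonging to `τ`, `r` the sequence of natural numbers and `U` the
complementary filtration. Operator norms of restrictions of `Q(k, l)` to the subspaces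
`E_j^{(k)} = Q(k) E_j`, `U_j^{(k)} = Q(k) U_j` are written out through vectors, and
`|sin ∠(E_j^{(k)}, U_j^{(k)})|` is the infimum over the pairs of nonzero vectors. -/
structure FDCEstimates (D : IETData 𝒜 n) (Λ : ℕ → ℝ) (E : ℤ → Submodule ℝ (𝒜 → ℝ))
    (τ c C κ : ℝ) (M r : ℕ → ℕ) (U : ℕ → Submodule ℝ (𝒜 → ℝ)) : Prop where
  towers : D.RokhlinTowers M
  r_growth : ∃ ρ : ℝ, 1 < ρ ∧ ρ < 1 + τ ∧
    Tendsto (fun m : ℕ => (∑ j ∈ Finset.range m, (r j : ℝ)) / (m : ℝ)) atTop (𝓝 ρ)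
  norm_E : ∀ k l : ℕ, k < l → ∀ j : ℕ, 1 ≤ j → j ≤ D.genus + 1 →
    ∀ v ∈ (E (j : ℤ)).map (Matrix.toLin' (D.Q M 0 k)),
      vecNorm ((D.Q M k l).mulVec v) ≤
        C * Real.exp ((Λ j + τ) * ∑ i ∈ Finset.Ico k l, (r i : ℝ)) * vecNorm v
  norm_U : ∀ k l : ℕ, k < l → ∀ j : ℕ, 2 ≤ j → j ≤ D.genus + 1 →
    ∀ v ∈ (U j).map (Matrix.toLin' (D.Q M 0 k)),
      vecNorm v ≤ C * Real.exp ((-Λ (j - 1) + τ) * ∑ i ∈ Finset.Ico k l, (r i : ℝ)) *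
        vecNorm ((D.Q M k l).mulVec v)
  norm_Z : ∀ k : ℕ, matNorm (D.Q M k (k + 1)) ≤ C * Real.exp (τ * k)
  norm_Q_lower : ∀ k : ℕ, c * Real.exp (Λ 1 * k) ≤ matNorm (D.Q M 0 k)
  norm_Q_upper : ∀ k : ℕ, matNorm (D.Q M 0 k) ≤ C * Real.exp (Λ 1 * (1 + τ) * k)
  balanced : ∀ k : ℕ, ∀ α, (D.step M k).total / (D.step M k).len α ≤ κ
  angle : ∀ k : ℕ, ∀ j : ℕ, 2 ≤ j → j ≤ D.genus + 1 →
    ∀ e ∈ (E (j : ℤ)).map (Matrix.toLin' (D.Q M 0 k)),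
    ∀ u ∈ (U j).map (Matrix.toLin' (D.Q M 0 k)), e ≠ 0 → u ≠ 0 →
      c * matNorm (D.Q M 0 k) ^ (-τ) ≤ |sinAngle e u|

/-- The Filtration Diophantine Condition. The Lyapunov exponents `Λ` and the Oseledets filtration
`E` are those of the cocycle `Q(k)` of the acceleration `N`, which does not depend on `τ`; the
estimates then hold, for every `τ > 0`, along an acceleration `M` chosen for `τ`. -/
def FDC (D : IETData 𝒜 n) (N : ℕ → ℕ) (Λ : ℕ → ℝ) : Prop :=
  D.Keane ∧ IsAccelerating N ∧
  ∃ E : ℤ → Submodule ℝ (𝒜 → ℝ), D.IsOseledetsFiltration N Λ E ∧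
    ∀ τ : ℝ, 0 < τ → ∃ (c C κ : ℝ) (M r : ℕ → ℕ) (U : ℕ → Submodule ℝ (𝒜 → ℝ)),
      0 < c ∧ 1 ≤ C ∧ 1 ≤ κ ∧ IsAccelerating M ∧ r 0 = 0 ∧
      D.IsComplementaryFiltration E U ∧ D.FDCEstimates Λ E τ c C κ M r U

/-! ### Functions with polynomial singularities of geometric type -/

/-- The space `P_aG(⊔ I_α)`; `Cp α = C_α^+(φ)` and `Cm α = C_α^-(φ)`. The values of `φ` outside of
the open intervals `(l_α, r_α)` play no role. -/
def PaG (D : IETData 𝒜 n) (a : ℝ) (φ : ℝ → ℝ) : Prop :=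
  (∀ α, ContDiffOn ℝ 1 φ (Ioo (D.left α) (D.right α))) ∧
  (∃ B : ℝ, ∀ α,
    (∀ x ∈ Ioc (D.left α) (D.mid α), |deriv φ x * (x - D.left α) ^ (1 + a)| ≤ B) ∧
    (∀ x ∈ Ico (D.mid α) (D.right α), |deriv φ x * (D.right α - x) ^ (1 + a)| ≤ B)) ∧
  ∃ Cp Cm : 𝒜 → ℝ,
    (∀ α, Tendsto (fun x => -(deriv φ x * (x - D.left α) ^ (1 + a)))
      (𝓝[>] (D.left α)) (𝓝 (Cp α))) ∧
    (∀ α, Tendsto (fun x => deriv φ x * (D.right α - x) ^ (1 + a))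
      (𝓝[<] (D.right α)) (𝓝 (Cm α))) ∧
    Cm (D.top.symm (Fin.last n)) * Cm (D.bot.symm (Fin.last n)) = 0 ∧
    Cp (D.top.symm 0) * Cp (D.bot.symm 0) = 0

/-! ### Special flows -/

/-- The phase space `I^g` of the special flow under the roof `g`. -/
def flowSpace (D : IETData 𝒜 n) (g : ℝ → ℝ) : Set (ℝ × ℝ) :=
  {p | p.1 ∈ D.base ∧ 0 ≤ p.2 ∧ p.2 < g p.1}

/-- The number `m` with `g^{(m)}(x) ≤ r + t < g^{(m+1)}(x)`, where `p = (x, r)`. It is the largest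
`m` with `g^{(m)}(x) ≤ r + t` as `g` is positive. -/
def crossings (D : IETData 𝒜 n) (g : ℝ → ℝ) (t : ℝ) (p : ℝ × ℝ) : ℕ :=
  sSup {m : ℕ | birkhoffSum D.iet g m p.1 ≤ p.2 + t}

/-- The special flow `T^g_t(x, r) = (T^m x, r + t - g^{(m)}(x))` in forward time `t ≥ 0`. -/
def flow (D : IETData 𝒜 n) (g : ℝ → ℝ) (t : ℝ) (p : ℝ × ℝ) : ℝ × ℝ :=
  (D.iet^[D.crossings g t p] p.1, p.2 + t - birkhoffSum D.iet g (D.crossings g t p) p.1)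

/-- The Birkhoff integral `∫₀ˢ f(T^g_t(p)) dt`. -/
def birkhoffIntegral (D : IETData 𝒜 n) (g : ℝ → ℝ) (f : ℝ × ℝ → ℝ) (s : ℝ) (p : ℝ × ℝ) : ℝ :=
  ∫ t in (0 : ℝ)..s, f (D.flow g t p)

end IETData

end

set_option linter.unusedSectionVars false

noncomputable section

namespace IETData

variable {𝒜 : Type*} [Fintype 𝒜] [DecidableEq 𝒜] {n : ℕ}

/-! The map induced by T on I^(k) is again an interval exchange. Its return times are the row sums
of Q(k), and the Birkhoff sums of the step function h up to the return are the entries of Q(k)h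
(`IsTower`, `Keane.cocycle_isTower`). Up to factors e^{O(τ)k}, tower heights grow like e^{λ₁k} and
tower sums like e^{λk}; eliminating k produces the exponent λ/λ₁.

Upper bound (`FDC.exists_birkhoffSum_le`): a partial sum inside a tower of level k+1 consists of at
most ‖Z(k+1)‖ complete towers of level k and one partial one, so partial sums at level k are also
O(e^{(λ+O(τ))k}). A stretch of length m is compared with a level whose towers are all higher than m.
The bound is uniform over the base.

Lower bound (`FDC.volume_smallSums_eq_zero`): in h = e + u, with e in the slower space of the
filtration and u in its complement, u dominates, so some entry of Q(k)h is large. The points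
entering the corresponding interval of I^(k) within the first p steps fill a fixed proportion of I.
At each of them one of two sums, whose difference is that entry, is large. The set of points with
sums of smaller order is invariant, and T is ergodic by the narrow Rokhlin towers
(`volume_eq_zero_of_invariant`), so this set is null.

Passing to the flow: a Birkhoff integral differs by a bounded amount from the sum of h over the
completed crossings (`abs_birkhoffIntegral_sub_le`), because f vanishes high up. The roof is bounded
below, so crossings are at most linear in time. It is integrable, since a < 1, so its Birkhoff sums
are almost everywhere O(m^b) for every b > 1, and crossings are almost linear from below. This
settles almost every point.

In L¹ the upper bound is integrated over a space of finite volume. For the lower one, too small L¹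
norms would give, by Markov's inequality and Borel-Cantelli, small sums at the times j^κ for almost
every point. The uniform upper bound controls the oscillation between those times and contradicts
the pointwise growth (`frequently_rpow_le_lintegral`). -/

/-! ### The partition of the base -/

/-- The exchanged interval `I_α`. -/
def interval (D : IETData 𝒜 n) (α : 𝒜) : Set ℝ := Ico (D.left α) (D.right α)

/-- The function with the constant value `h α` on `I_α`. -/
def stepFun (D : IETData 𝒜 n) (h : 𝒜 → ℝ) (x : ℝ) : ℝ :=
  ∑ α, (D.interval α).indicator (fun _ => h α) x

lemma right_eq (D : IETData 𝒜 n) (α : 𝒜) : D.right α = D.left α + D.len α := by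
  have : Finset.univ.filter (fun β => D.top β ≤ D.top α) =
      insert α (Finset.univ.filter (fun β => D.top β < D.top α)) := by
    ext β
    simp only [Finset.mem_filter, Finset.mem_univ, true_and, Finset.mem_insert, le_iff_lt_or_eq,
      D.top.injective.eq_iff]
    tauto
  rw [right, this, Finset.sum_insert (by simp), left, add_comm]

lemma right_le_left (D : IETData 𝒜 n) (hlen : ∀ α, 0 < D.len α) {α β : 𝒜}
    (h : D.top α < D.top β) : D.right α ≤ D.left β :=
  Finset.sum_le_sum_of_subset_of_nonneg
    (fun γ hγ => by
      simp only [Finset.mem_filter, Finset.mem_univ, true_and] at hγ ⊢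
      exact hγ.trans_lt h)
    (fun γ _ _ => (hlen γ).le)

lemma left_nonneg (D : IETData 𝒜 n) (hlen : ∀ α, 0 < D.len α) (α : 𝒜) : 0 ≤ D.left α :=
  Finset.sum_nonneg fun γ _ => (hlen γ).le

lemma right_le_total (D : IETData 𝒜 n) (hlen : ∀ α, 0 < D.len α) (α : 𝒜) :
    D.right α ≤ D.total :=
  Finset.sum_le_sum_of_subset_of_nonneg (Finset.filter_subset _ _) (fun γ _ _ => (hlen γ).le)

lemma right_lastTop (D : IETData 𝒜 n) : D.right D.lastTop = D.total := by
  simp [right, total, lastTop, Fin.le_last]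

lemma total_pos (D : IETData 𝒜 n) (hlen : ∀ α, 0 < D.len α) : 0 < D.total :=
  Finset.sum_pos (fun α _ => hlen α) ⟨D.lastTop, Finset.mem_univ _⟩

lemma interval_subset_base (D : IETData 𝒜 n) (hlen : ∀ α, 0 < D.len α) (α : 𝒜) :
    D.interval α ⊆ D.base :=
  Ico_subset_Ico (D.left_nonneg hlen α) (D.right_le_total hlen α)

lemma eq_of_mem_interval (D : IETData 𝒜 n) (hlen : ∀ α, 0 < D.len α) {α β : 𝒜} {x : ℝ}
    (hα : x ∈ D.interval α) (hβ : x ∈ D.interval β) : α = β := by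
  rcases lt_trichotomy (D.top α) (D.top β) with h | h | h
  · exact absurd (hα.2.trans_le (D.right_le_left hlen h)) (not_lt.2 hβ.1)
  · exact D.top.injective h
  · exact absurd (hβ.2.trans_le (D.right_le_left hlen h)) (not_lt.2 hα.1)

lemma left_mem_interval (D : IETData 𝒜 n) (hlen : ∀ α, 0 < D.len α) (α : 𝒜) :
    D.left α ∈ D.interval α :=
  ⟨le_rfl, by rw [right_eq]; linarith [hlen α]⟩

lemma exists_mem_interval (D : IETData 𝒜 n) {x : ℝ} (hx : x ∈ D.base) :
    ∃ α, x ∈ D.interval α := by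
  have h0 : D.left (D.top.symm 0) = 0 := by simp [left]
  -- The letter furthest to the right with left end at most x; if x lay beyond its right end, the
  -- next letter would also qualify.
  obtain ⟨α, hα, hmax⟩ := Finset.exists_max_image
    (Finset.univ.filter (fun α => D.left α ≤ x)) D.top
    ⟨D.top.symm 0, by simpa [h0] using hx.1⟩
  simp only [Finset.mem_filter, Finset.mem_univ, true_and] at hα hmax
  refine ⟨α, hα, ?_⟩
  by_contra! hcon
  by_cases hlast : D.top α = Fin.last n
  · have : α = D.lastTop := by rw [lastTop, ← hlast]; simp
    rw [this, right_lastTop] at hcon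
    exact absurd hx.2 (not_lt.2 hcon)
  · have hlt : (D.top α : ℕ) < n := by
      have := (D.top α).isLt
      have h2 : (D.top α : ℕ) ≠ n := fun h => hlast (Fin.ext h)
      omega
    set β := D.top.symm ⟨D.top α + 1, by omega⟩ with hβ
    have htβ : (D.top β : ℕ) = D.top α + 1 := by simp [hβ]
    have : D.left β = D.right α := by
      unfold left right
      congr 1
      ext γ
      simp only [Finset.mem_filter, Finset.mem_univ, true_and, Fin.lt_def, Fin.le_def, htβ]
      omega
    have := hmax β (by rw [this]; exact hcon)
    rw [Fin.le_def, htβ] at this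
    omega

lemma measurableSet_interval (D : IETData 𝒜 n) (α : 𝒜) : MeasurableSet (D.interval α) :=
  measurableSet_Ico

lemma measurableSet_base (D : IETData 𝒜 n) : MeasurableSet D.base := measurableSet_Ico

lemma base_eq_iUnion (D : IETData 𝒜 n) (hlen : ∀ α, 0 < D.len α) :
    D.base = ⋃ α, D.interval α := by
  ext x
  simp only [mem_iUnion]
  exact ⟨fun hx => D.exists_mem_interval hx, fun ⟨α, hα⟩ => D.interval_subset_base hlen α hα⟩

lemma stepFun_of_mem (D : IETData 𝒜 n) (hlen : ∀ α, 0 < D.len α) (h : 𝒜 → ℝ) {α : 𝒜} {x : ℝ}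
    (hx : x ∈ D.interval α) : D.stepFun h x = h α := by
  rw [stepFun, Finset.sum_eq_single α]
  · simp [hx]
  · intro β _ hβ
    exact indicator_of_notMem (fun h' => hβ (D.eq_of_mem_interval hlen h' hx)) _
  · simp

lemma stepFun_of_notMem (D : IETData 𝒜 n) (hlen : ∀ α, 0 < D.len α) (h : 𝒜 → ℝ) {x : ℝ}
    (hx : x ∉ D.base) : D.stepFun h x = 0 :=
  Finset.sum_eq_zero fun α _ =>
    indicator_of_notMem (fun h' => hx (D.interval_subset_base hlen α h')) _

lemma measurable_stepFun (D : IETData 𝒜 n) (h : 𝒜 → ℝ) : Measurable (D.stepFun h) :=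
  Finset.measurable_sum _ fun α _ => measurable_const.indicator (D.measurableSet_interval α)

lemma abs_stepFun_le (D : IETData 𝒜 n) (h : 𝒜 → ℝ) (x : ℝ) : |D.stepFun h x| ≤ vecNorm h := by
  refine (Finset.abs_sum_le_sum_abs _ _).trans (Finset.sum_le_sum fun α _ => ?_)
  by_cases hx : x ∈ D.interval α <;> simp [hx]

/-! ### The interval exchange as a measure preserving bijection -/

/-- The data with the two rows exchanged. -/
def swap (D : IETData 𝒜 n) : IETData 𝒜 n := ⟨D.bot, D.top, D.len⟩

lemma iet_eq (D : IETData 𝒜 n) (x : ℝ) :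
    D.iet x = x + D.stepFun (fun α => D.left' α - D.left α) x := rfl

lemma iet_of_mem (D : IETData 𝒜 n) (hlen : ∀ α, 0 < D.len α) {α : 𝒜} {x : ℝ}
    (hx : x ∈ D.interval α) : D.iet x = x + (D.left' α - D.left α) := by
  rw [iet_eq, D.stepFun_of_mem hlen _ hx]

lemma iet_of_notMem (D : IETData 𝒜 n) (hlen : ∀ α, 0 < D.len α) {x : ℝ}
    (hx : x ∉ D.base) : D.iet x = x := by
  rw [iet_eq, D.stepFun_of_notMem hlen _ hx, add_zero]

lemma swap_interval (D : IETData 𝒜 n) (α : 𝒜) :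
    D.swap.interval α = Ico (D.left' α) (D.left' α + D.len α) := by
  rw [interval, right_eq]; rfl

lemma iet_mem_swap_interval (D : IETData 𝒜 n) (hlen : ∀ α, 0 < D.len α) {α : 𝒜} {x : ℝ}
    (hx : x ∈ D.interval α) : D.iet x ∈ D.swap.interval α := by
  rw [D.iet_of_mem hlen hx, swap_interval]
  rw [interval, right_eq] at hx
  constructor <;> linarith [hx.1, hx.2]

lemma iet_mem_base (D : IETData 𝒜 n) (hlen : ∀ α, 0 < D.len α) {x : ℝ} (hx : x ∈ D.base) :
    D.iet x ∈ D.base := by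
  obtain ⟨α, hα⟩ := D.exists_mem_interval hx
  exact D.swap.interval_subset_base hlen α (D.iet_mem_swap_interval hlen hα)

/-- Exchanging the rows exchanges l and l', so the swapped exchange undoes each translation. Since
both maps are the identity off the base, T becomes a bijection of the whole line. -/
lemma swap_iet_iet (D : IETData 𝒜 n) (hlen : ∀ α, 0 < D.len α) (x : ℝ) :
    D.swap.iet (D.iet x) = x := by
  by_cases hx : x ∈ D.base
  · obtain ⟨α, hα⟩ := D.exists_mem_interval hx
    rw [D.swap.iet_of_mem hlen (D.iet_mem_swap_interval hlen hα), D.iet_of_mem hlen hα]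
    change x + (D.left' α - D.left α) + (D.left α - D.left' α) = x
    ring
  · rw [D.iet_of_notMem hlen hx, D.swap.iet_of_notMem hlen hx]

lemma measurable_iet (D : IETData 𝒜 n) : Measurable D.iet :=
  measurable_id.add (D.measurable_stepFun _)

/-- The interval exchange as a measurable equivalence of the line. -/
def ietEquiv (D : IETData 𝒜 n) (hlen : ∀ α, 0 < D.len α) : ℝ ≃ᵐ ℝ where
  toFun := D.iet
  invFun := D.swap.iet
  left_inv := D.swap_iet_iet hlen
  right_inv := D.swap.swap_iet_iet hlen
  measurable_toFun := D.measurable_iet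
  measurable_invFun := D.swap.measurable_iet

lemma iet_injective (D : IETData 𝒜 n) (hlen : ∀ α, 0 < D.len α) : Function.Injective D.iet :=
  (D.ietEquiv hlen).injective

lemma volume_eq_sum (D : IETData 𝒜 n) (hlen : ∀ α, 0 < D.len α) {A : Set ℝ}
    (hA : MeasurableSet A) :
    volume A = volume (A \ D.base) + ∑ α, volume (A ∩ D.interval α) := by
  rw [← measure_inter_add_sdiff A D.measurableSet_base, add_comm, D.base_eq_iUnion hlen,
    inter_iUnion, measure_iUnion, tsum_fintype]
  · intro α β hαβ
    exact disjoint_left.2 fun x hx hy => hαβ (D.eq_of_mem_interval hlen hx.2 hy.2)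
  · exact fun α => hA.inter (D.measurableSet_interval α)

/-- The intervals of the two rows both tile the base, and T translates one onto the other. Because T
is the identity elsewhere, Lebesgue measure on the line is preserved without restricting it. -/
lemma measurePreserving_iet (D : IETData 𝒜 n) (hlen : ∀ α, 0 < D.len α) :
    MeasurePreserving D.iet := by
  refine ⟨D.measurable_iet, ?_⟩
  ext A hA
  rw [Measure.map_apply D.measurable_iet hA, D.volume_eq_sum hlen (D.measurable_iet hA),
    D.swap.volume_eq_sum hlen hA]
  congr 1
  · congr 1
    ext x
    simp only [Set.mem_sdiff, mem_preimage]
    refine and_congr_left fun hx => ?_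
    rw [D.iet_of_notMem hlen hx]
  · refine Finset.sum_congr rfl fun α _ => ?_
    have : D.iet ⁻¹' A ∩ D.interval α =
        (fun x => x + (D.left' α - D.left α)) ⁻¹' (A ∩ D.swap.interval α) := by
      ext x
      simp only [mem_inter_iff, mem_preimage]
      constructor
      · rintro ⟨h1, h2⟩
        have h3 := D.iet_mem_swap_interval hlen h2
        rw [D.iet_of_mem hlen h2] at h1 h3
        exact ⟨h1, h3⟩
      · rintro ⟨h1, h2⟩
        have h3 : x ∈ D.interval α := by
          rw [swap_interval] at h2
          rw [interval, right_eq]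
          constructor <;> linarith [h2.1, h2.2]
        exact ⟨by rwa [D.iet_of_mem hlen h3], h3⟩
    rw [this, measure_preimage_add_right]

lemma iterate_iet_mem_base (D : IETData 𝒜 n) (hlen : ∀ α, 0 < D.len α) {x : ℝ}
    (hx : x ∈ D.base) (i : ℕ) : D.iet^[i] x ∈ D.base := by
  induction i with
  | zero => exact hx
  | succ i ih => rw [Function.iterate_succ_apply']; exact D.iet_mem_base hlen ih

lemma iet_mem_base_iff (D : IETData 𝒜 n) (hlen : ∀ α, 0 < D.len α) {x : ℝ} :
    D.iet x ∈ D.base ↔ x ∈ D.base := by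
  refine ⟨fun h => ?_, D.iet_mem_base hlen⟩
  by_contra hx
  exact hx (by rwa [D.iet_of_notMem hlen hx] at h)

lemma volume_image_iterate (D : IETData 𝒜 n) (hlen : ∀ α, 0 < D.len α) (i : ℕ) {A : Set ℝ}
    (hA : MeasurableSet A) :
    MeasurableSet (D.iet^[i] '' A) ∧ volume (D.iet^[i] '' A) = volume A := by
  induction i with
  | zero => simpa using hA
  | succ i ih =>
    rw [Function.iterate_succ', image_comp]
    have h1 : MeasurableSet (D.iet '' (D.iet^[i] '' A)) :=
      (D.ietEquiv hlen).measurableEmbedding.measurableSet_image.2 ih.1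
    refine ⟨h1, ?_⟩
    rw [← ih.2, ← (D.measurePreserving_iet hlen).measure_preimage h1.nullMeasurableSet,
      preimage_image_eq _ (D.iet_injective hlen)]

lemma measurable_birkhoffSum (D : IETData 𝒜 n) {φ : ℝ → ℝ} (hφ : Measurable φ) (m : ℕ) :
    Measurable (birkhoffSum D.iet φ m) :=
  Finset.measurable_sum _ fun i _ => hφ.comp (D.measurable_iet.iterate i)

lemma abs_birkhoffSum_stepFun_le (D : IETData 𝒜 n) (h : 𝒜 → ℝ) (m : ℕ) (x : ℝ) :
    |birkhoffSum D.iet (D.stepFun h) m x| ≤ m * vecNorm h := by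
  refine (Finset.abs_sum_le_sum_abs _ _).trans
    ((Finset.sum_le_sum fun i _ => D.abs_stepFun_le h _).trans ?_)
  simp

lemma volume_base (D : IETData 𝒜 n) : volume D.base = ENNReal.ofReal D.total := by
  simp [base]

lemma volume_interval (D : IETData 𝒜 n) (α : 𝒜) :
    volume (D.interval α) = ENNReal.ofReal (D.len α) := by
  simp [interval, right_eq]

/-! ### Induced interval exchanges and their towers -/

/-- `D'` is the interval exchange induced by `D` on `D'.base`: the return time to `D'.base` is
`q α` on the interval of `α`, and the Birkhoff sums of the step function `h` up to the return are
given by the matrix `B`. -/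
structure IsTower (D D' : IETData 𝒜 n) (B : Matrix 𝒜 𝒜 ℝ) (q : 𝒜 → ℕ) : Prop where
  base_subset : D'.base ⊆ D.base
  height_pos : ∀ α, 0 < q α
  return_eq : ∀ α, ∀ x ∈ D'.interval α, D.iet^[q α] x = D'.iet x
  notMem_base : ∀ α, ∀ x ∈ D'.interval α, ∀ i, 0 < i → i < q α → D.iet^[i] x ∉ D'.base
  sum_eq : ∀ α, ∀ x ∈ D'.interval α, ∀ h : 𝒜 → ℝ,
    birkhoffSum D.iet (D.stepFun h) (q α) x = B.mulVec h α
  exists_floor : ∀ x ∈ D.base, ∃ α, ∃ y ∈ D'.interval α, ∃ i < q α, D.iet^[i] y = x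

open Classical in
/-- The letter of the interval that contains `x`. -/
def letter (D : IETData 𝒜 n) (x : ℝ) : 𝒜 :=
  if h : ∃ α, x ∈ D.interval α then h.choose else D.lastTop

lemma mem_interval_letter (D : IETData 𝒜 n) {x : ℝ} (hx : x ∈ D.base) :
    x ∈ D.interval (D.letter x) := by
  have h := D.exists_mem_interval hx
  rw [letter, dif_pos h]
  exact h.choose_spec

lemma letter_eq (D : IETData 𝒜 n) (hlen : ∀ α, 0 < D.len α) {α : 𝒜} {x : ℝ}
    (hx : x ∈ D.interval α) : D.letter x = α :=
  D.eq_of_mem_interval hlen (D.mem_interval_letter (D.interval_subset_base hlen α hx)) hx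

/-- The time of the `j`-th return to `D.base` when the return times are given by `q`. -/
def returnTime (D : IETData 𝒜 n) (q : 𝒜 → ℕ) (j : ℕ) (x : ℝ) : ℕ :=
  birkhoffSum D.iet (fun y => q (D.letter y)) j x

lemma returnTime_zero (D : IETData 𝒜 n) (q : 𝒜 → ℕ) (x : ℝ) : D.returnTime q 0 x = 0 :=
  birkhoffSum_zero _ _ _

lemma returnTime_succ (D : IETData 𝒜 n) (q : 𝒜 → ℕ) (j : ℕ) (x : ℝ) :
    D.returnTime q (j + 1) x = D.returnTime q j x + q (D.letter (D.iet^[j] x)) :=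
  birkhoffSum_succ _ _ _ _

lemma exists_returnTime_le (D : IETData 𝒜 n) (q : 𝒜 → ℕ) (x : ℝ) {J i : ℕ}
    (hi : i < D.returnTime q J x) :
    ∃ j < J, D.returnTime q j x ≤ i ∧ i < D.returnTime q (j + 1) x := by
  induction J with
  | zero => simp [returnTime_zero] at hi
  | succ J ih =>
    by_cases h : i < D.returnTime q J x
    · obtain ⟨j, hj, h'⟩ := ih h
      exact ⟨j, hj.trans (Nat.lt_succ_self J), h'⟩
    · exact ⟨J, Nat.lt_succ_self J, not_lt.1 h, hi⟩

lemma returnTime_mono (D : IETData 𝒜 n) (q : 𝒜 → ℕ) (x : ℝ) :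
    Monotone fun j => D.returnTime q j x :=
  monotone_nat_of_le_succ fun j => by simp only [returnTime_succ]; omega

lemma cast_returnTime (D : IETData 𝒜 n) (hlen : ∀ α, 0 < D.len α) (q : 𝒜 → ℕ) (j : ℕ) {x : ℝ}
    (hx : x ∈ D.base) :
    (D.returnTime q j x : ℝ) = birkhoffSum D.iet (D.stepFun fun α => (q α : ℝ)) j x := by
  simp only [returnTime, birkhoffSum, Nat.cast_sum]
  refine Finset.sum_congr rfl fun i _ => ?_
  rw [D.stepFun_of_mem hlen _ (D.mem_interval_letter (D.iterate_iet_mem_base hlen hx i))]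

lemma mulVec_one_apply (B : Matrix 𝒜 𝒜 ℝ) (α : 𝒜) :
    B.mulVec (fun _ => 1) α = ∑ β, B α β := by
  simp [Matrix.mulVec, dotProduct]

namespace IsTower

variable {D D' D'' : IETData 𝒜 n} {B B' : Matrix 𝒜 𝒜 ℝ} {q q' q'' : 𝒜 → ℕ}

lemma refl (D : IETData 𝒜 n) (hlen : ∀ α, 0 < D.len α) : IsTower D D 1 fun _ => 1 where
  base_subset := subset_rfl
  height_pos _ := one_pos
  return_eq _ _ _ := rfl
  notMem_base _ _ _ i h0 h1 := by omega
  sum_eq α x hx h := by simp [D.stepFun_of_mem hlen h hx]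
  exists_floor x hx := by
    obtain ⟨α, hα⟩ := D.exists_mem_interval hx
    exact ⟨α, x, hα, 0, one_pos, rfl⟩

/-- For the constant vector 1 the Birkhoff sum in `sum_eq` counts the steps until the return. -/
lemma height_eq (H : IsTower D D' B q) (hlen : ∀ α, 0 < D.len α) (hlen' : ∀ α, 0 < D'.len α)
    (α : 𝒜) : (q α : ℝ) = ∑ β, B α β := by
  have hx := D'.left_mem_interval hlen' α
  have hb := H.base_subset (D'.interval_subset_base hlen' α hx)
  have := H.sum_eq α _ hx fun _ => 1
  rw [mulVec_one_apply] at this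
  rw [← this, birkhoffSum, Finset.sum_congr rfl fun i _ => ?_, Finset.sum_const,
    Finset.card_range, nsmul_one]
  rw [D.stepFun_of_mem hlen _ (D.mem_interval_letter (D.iterate_iet_mem_base hlen hb i))]

lemma iterate_returnTime (H : IsTower D D' B q) (hlen' : ∀ α, 0 < D'.len α) {x : ℝ}
    (hx : x ∈ D'.base) (j : ℕ) : D.iet^[D'.returnTime q j x] x = D'.iet^[j] x := by
  induction j with
  | zero => simp [returnTime_zero]
  | succ j ih =>
    rw [returnTime_succ, add_comm, Function.iterate_add_apply, ih, Function.iterate_succ_apply']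
    exact H.return_eq _ _ (D'.mem_interval_letter (D'.iterate_iet_mem_base hlen' hx j))

lemma birkhoffSum_returnTime (H : IsTower D D' B q) (hlen' : ∀ α, 0 < D'.len α) (h : 𝒜 → ℝ)
    {x : ℝ} (hx : x ∈ D'.base) (j : ℕ) :
    birkhoffSum D.iet (D.stepFun h) (D'.returnTime q j x) x =
      birkhoffSum D'.iet (D'.stepFun (B.mulVec h)) j x := by
  induction j with
  | zero => simp [returnTime_zero]
  | succ j ih =>
    have hm := D'.mem_interval_letter (D'.iterate_iet_mem_base hlen' hx j)
    rw [returnTime_succ, birkhoffSum_add, ih, birkhoffSum_succ, H.iterate_returnTime hlen' hx,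
      H.sum_eq _ _ hm, D'.stepFun_of_mem hlen' _ hm]

/-- The time of several returns is the Birkhoff sum of the step function with values q, so `sum_eq`
of the upper tower evaluates it. In particular it does not depend on the point of the interval. -/
lemma cast_returnTime_height (H' : IsTower D' D'' B' q') (hlen' : ∀ α, 0 < D'.len α)
    (hlen'' : ∀ α, 0 < D''.len α) {α : 𝒜} {x : ℝ} (hx : x ∈ D''.interval α) :
    (D'.returnTime q (q' α) x : ℝ) = B'.mulVec (fun α => (q α : ℝ)) α := by
  rw [D'.cast_returnTime hlen' q _ (H'.base_subset (D''.interval_subset_base hlen'' α hx)),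
    H'.sum_eq α x hx]

/-- A return to the small base is a chain of returns to the intermediate one, along which the sums
compose as B' applied to B h. -/
lemma trans (H : IsTower D D' B q) (H' : IsTower D' D'' B' q') (hlen' : ∀ α, 0 < D'.len α)
    (hlen'' : ∀ α, 0 < D''.len α) :
    ∃ q'' : 𝒜 → ℕ, IsTower D D'' (B' * B) q'' := by
  set q'' : 𝒜 → ℕ := fun α => D'.returnTime q (q' α) (D''.left α) with hq''
  have key : ∀ α, ∀ x ∈ D''.interval α, D'.returnTime q (q' α) x = q'' α := by
    intro α x hx
    have h1 := H'.cast_returnTime_height (q := q) hlen' hlen'' hx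
    have h2 := H'.cast_returnTime_height (q := q) hlen' hlen'' (D''.left_mem_interval hlen'' α)
    exact_mod_cast h1.trans h2.symm
  have hsub : ∀ α, ∀ x ∈ D''.interval α, x ∈ D'.base := fun α x hx =>
    H'.base_subset (D''.interval_subset_base hlen'' α hx)
  refine ⟨q'', H'.base_subset.trans H.base_subset, fun α => ?_, fun α x hx => ?_, ?_, ?_, ?_⟩
  · calc 0 < D'.returnTime q 1 (D''.left α) := by
          rw [returnTime_succ, returnTime_zero, zero_add]; exact H.height_pos _
      _ ≤ _ := D'.returnTime_mono q _ (H'.height_pos α)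
  · rw [← key α x hx, H.iterate_returnTime hlen' (hsub α x hx), H'.return_eq α x hx]
  · intro α x hx i h0 hi
    rw [← key α x hx] at hi
    obtain ⟨j, hj, hj1, hj2⟩ := D'.exists_returnTime_le q x hi
    have hxj := D'.iterate_iet_mem_base hlen' (hsub α x hx) j
    obtain ⟨i', rfl⟩ := Nat.exists_eq_add_of_le' hj1
    rw [returnTime_succ] at hj2
    rw [Function.iterate_add_apply, H.iterate_returnTime hlen' (hsub α x hx)]
    -- Either time i is exactly the j-th return to `D'.base`, with 0 < j < q' α, or it falls
    -- strictly between two returns, when the orbit is outside `D'.base` altogether.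
    rcases Nat.eq_zero_or_pos i' with rfl | hi'
    · have : 0 < j := by
        rcases Nat.eq_zero_or_pos j with rfl | hj'
        · simp [returnTime_zero] at h0
        · exact hj'
      exact H'.notMem_base α x hx j this hj
    · exact fun hmem => H.notMem_base _ _ (D'.mem_interval_letter hxj) i' hi' (by omega)
        (H'.base_subset hmem)
  · intro α x hx h
    rw [← key α x hx, H.birkhoffSum_returnTime hlen' h (hsub α x hx), H'.sum_eq α x hx,
      Matrix.mulVec_mulVec]
  · intro x hx
    obtain ⟨β, y, hy, i, hi, rfl⟩ := H.exists_floor x hx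
    obtain ⟨α, z, hz, j, hj, rfl⟩ := H'.exists_floor y (D'.interval_subset_base hlen' β hy)
    refine ⟨α, z, hz, i + D'.returnTime q j z, ?_, ?_⟩
    · rw [← key α z hz]
      refine lt_of_lt_of_le ?_ (D'.returnTime_mono q z (Nat.succ_le_of_lt hj))
      simp only [Nat.succ_eq_add_one, returnTime_succ, D'.letter_eq hlen' hy]
      omega
    · rw [Function.iterate_add_apply, H.iterate_returnTime hlen' (hsub α z hz)]

/-- A bound for the partial Birkhoff sums along the towers. -/
def PartialBound (D D' : IETData 𝒜 n) (q : 𝒜 → ℕ) (h : 𝒜 → ℝ) (W : ℝ) : Prop :=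
  ∀ α, ∀ x ∈ D'.interval α, ∀ i ≤ q α, |birkhoffSum D.iet (D.stepFun h) i x| ≤ W

/-- By time i the orbit has made at most Z complete returns to `D'.base`, each adding one entry of B
h, and then climbs part of one tower, which adds at most W. -/
lemma partialBound_trans {h : 𝒜 → ℝ} {W : ℝ} (H : IsTower D D' B q) (H' : IsTower D' D'' B' q')
    (H'' : IsTower D D'' (B' * B) q'') (hlen : ∀ α, 0 < D.len α) (hlen' : ∀ α, 0 < D'.len α)
    (hlen'' : ∀ α, 0 < D''.len α) (hW : PartialBound D D' q h W) {Z : ℝ}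
    (hZ : ∀ α, (q' α : ℝ) ≤ Z) :
    PartialBound D D'' q'' h (W + Z * vecNorm (B.mulVec h)) := by
  intro α x hx i hi
  have hxb := H'.base_subset (D''.interval_subset_base hlen'' α hx)
  have hv : 0 ≤ vecNorm (B.mulVec h) := Finset.sum_nonneg fun _ _ => abs_nonneg _
  -- The heights q'' come from an arbitrary tower with matrix B' B; they are determined by its row
  -- sums and hence agree with the composed return times.
  have hq : D'.returnTime q (q' α) x = q'' α := by
    have h1 := H'.cast_returnTime_height (q := q) hlen' hlen'' hx
    have h2 : B'.mulVec (fun α => (q α : ℝ)) α = q'' α := by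
      rw [H''.height_eq hlen hlen'', ← mulVec_one_apply,
        ← Matrix.mulVec_mulVec]
      congr 1
      ext β
      rw [H.height_eq hlen hlen', mulVec_one_apply]
    exact_mod_cast h1.trans h2
  have hb : ∀ j ≤ q' α, |birkhoffSum D'.iet (D'.stepFun (B.mulVec h)) j x| ≤
      Z * vecNorm (B.mulVec h) := fun j hj =>
    (D'.abs_birkhoffSum_stepFun_le _ j x).trans
      (mul_le_mul_of_nonneg_right ((Nat.cast_le.2 hj).trans (hZ α)) hv)
  rcases hi.lt_or_eq with hi | hi
  · rw [← hq] at hi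
    obtain ⟨j, hj, hj1, hj2⟩ := D'.exists_returnTime_le q x hi
    have hxj := D'.iterate_iet_mem_base hlen' hxb j
    obtain ⟨i', rfl⟩ := Nat.exists_eq_add_of_le hj1
    rw [returnTime_succ] at hj2
    rw [birkhoffSum_add, H.birkhoffSum_returnTime hlen' h hxb, H.iterate_returnTime hlen' hxb]
    have h1 := hW _ _ (D'.mem_interval_letter hxj) i' (by omega)
    exact (abs_add_le _ _).trans (by linarith [hb j hj.le])
  · rw [hi, ← hq, H.birkhoffSum_returnTime hlen' h hxb]
    have h0 : 0 ≤ W := (abs_nonneg _).trans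
      (hW _ _ (D'.left_mem_interval hlen' α) 0 (Nat.zero_le _))
    linarith [hb _ le_rfl]

/-- A stretch starting on floor i over y is the sum from y to time i + m minus the sum to time i. As
m is at most every height, the longer stretch leaves its tower at most once: two partial sums, plus
the one subtracted. -/
lemma abs_birkhoffSum_le {h : 𝒜 → ℝ} {W : ℝ} (H : IsTower D D' B q)
    (hlen' : ∀ α, 0 < D'.len α) (hW : PartialBound D D' q h W) {m : ℕ} (hm : ∀ α, m ≤ q α)
    {x : ℝ} (hx : x ∈ D.base) : |birkhoffSum D.iet (D.stepFun h) m x| ≤ 3 * W := by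
  obtain ⟨α, y, hy, i, hi, rfl⟩ := H.exists_floor x hx
  have h1 := hW α y hy i hi.le
  have h2 : birkhoffSum D.iet (D.stepFun h) m (D.iet^[i] y) =
      birkhoffSum D.iet (D.stepFun h) (i + m) y - birkhoffSum D.iet (D.stepFun h) i y := by
    rw [birkhoffSum_add]; ring
  have h0 : 0 ≤ W := (abs_nonneg _).trans h1
  have h3 : |birkhoffSum D.iet (D.stepFun h) (i + m) y| ≤ 2 * W := by
    rcases le_total (i + m) (q α) with hle | hle
    · linarith [hW α y hy _ hle]
    · obtain ⟨e, he⟩ := Nat.exists_eq_add_of_le hle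
      rw [he, birkhoffSum_add, H.return_eq α y hy]
      have hb := D'.iet_mem_base hlen' (D'.interval_subset_base hlen' α hy)
      have h4 := hW _ _ (D'.mem_interval_letter hb) e (le_trans (by omega) (hm _))
      exact (abs_add_le _ _).trans (by linarith [hW α y hy _ le_rfl])
  rw [h2]
  exact (abs_sub _ _).trans (by linarith)

end IsTower
/-! ### The Rauzy-Veech step -/

/-! ### Left ends after the loser is moved behind the winner -/

section Shift

variable (e : 𝒜 ≃ Fin (n + 1)) (l : 𝒜 → ℝ) (w : 𝒜)

lemma val_lt_last {e : 𝒜 ≃ Fin (n + 1)} {α : 𝒜} (h : α ≠ e.symm (Fin.last n)) :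
    (e α : ℕ) < n := by
  have := (e α).isLt
  have h2 : (e α : ℕ) ≠ n := fun h' => h (by
    rw [Equiv.eq_symm_apply]; exact Fin.ext h')
  omega

/-- Letters to the right of the winner w see w shortened by the length of z, but z itself inserted
before them; the two changes cancel. Letters to the left of w see neither. -/
lemma sum_shift_of_ne (hw : w ≠ e.symm (Fin.last n)) {α : 𝒜} (hα : α ≠ e.symm (Fin.last n)) :
    ∑ β ∈ Finset.univ.filter (fun β => (e.trans (rauzyShift (e w))) β <
        (e.trans (rauzyShift (e w))) α),
      Function.update l w (l w - l (e.symm (Fin.last n))) β =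
    ∑ β ∈ Finset.univ.filter (fun β => e β < e α), l β := by
  set z := e.symm (Fin.last n) with hz
  have hez : (e z : ℕ) = n := by simp [hz]
  have hαn := val_lt_last hα
  have hwn := val_lt_last hw
  rw [Finset.sum_filter, Finset.sum_filter]
  have : ∀ β, (if (e.trans (rauzyShift (e w))) β < (e.trans (rauzyShift (e w))) α then
        Function.update l w (l w - l z) β else 0) =
      (if e β < e α then l β else 0) + (if β = w then (if e w < e α then - l z else 0) else 0) +
        (if β = z then (if e w < e α then l z else 0) else 0) := by
    intro β
    have hval : ∀ γ, ((e.trans (rauzyShift (e w))) γ : ℕ) = rauzyPos n (e w) (e γ) :=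
      fun γ => rfl
    simp only [Fin.lt_def, hval]
    by_cases hβw : β = w
    · subst hβw
      rw [if_neg hw]
      have : rauzyPos n (e β) (e β) < rauzyPos n (e β) (e α) ↔ (e β : ℕ) < e α := by
        simp only [rauzyPos]; split_ifs <;> omega
      simp only [this, Function.update_self, if_true]
      split_ifs <;> ring
    · rw [Function.update_of_ne hβw, if_neg hβw]
      by_cases hβz : β = z
      · subst hβz
        have : rauzyPos n (e w) (e z) < rauzyPos n (e w) (e α) ↔ (e w : ℕ) < e α := by
          simp only [rauzyPos]; split_ifs <;> omega
        simp only [this, if_true]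
        rw [if_neg (by omega : ¬ (e z : ℕ) < e α)]
        ring
      · rw [if_neg hβz]
        have hβn := val_lt_last hβz
        have : rauzyPos n (e w) (e β) < rauzyPos n (e w) (e α) ↔ (e β : ℕ) < e α := by
          simp only [rauzyPos]; split_ifs <;> omega
        simp only [this]
        ring
  rw [Finset.sum_congr rfl fun β _ => this β, Finset.sum_add_distrib, Finset.sum_add_distrib,
    Finset.sum_ite_eq' , Finset.sum_ite_eq']
  simp only [Finset.mem_univ, if_true]
  split_ifs <;> ring

/-- The moved letter starts where the shortened winner ends. -/
lemma sum_shift_last (hw : w ≠ e.symm (Fin.last n)) :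
    ∑ β ∈ Finset.univ.filter (fun β => (e.trans (rauzyShift (e w))) β <
        (e.trans (rauzyShift (e w))) (e.symm (Fin.last n))),
      Function.update l w (l w - l (e.symm (Fin.last n))) β =
    ∑ β ∈ Finset.univ.filter (fun β => e β < e w), l β + l w - l (e.symm (Fin.last n)) := by
  set z := e.symm (Fin.last n) with hz
  have hez : (e z : ℕ) = n := by simp [hz]
  have hwn := val_lt_last hw
  rw [Finset.sum_filter, Finset.sum_filter]
  have : ∀ β, (if (e.trans (rauzyShift (e w))) β < (e.trans (rauzyShift (e w))) z then
        Function.update l w (l w - l z) β else 0) =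
      (if e β < e w then l β else 0) + (if β = w then l w - l z else 0) := by
    intro β
    have hval : ∀ γ, ((e.trans (rauzyShift (e w))) γ : ℕ) = rauzyPos n (e w) (e γ) :=
      fun γ => rfl
    simp only [Fin.lt_def, hval]
    by_cases hβw : β = w
    · subst hβw
      have : rauzyPos n (e β) (e β) < rauzyPos n (e β) (e z) := by
        simp only [rauzyPos]; split_ifs <;> omega
      simp [this]
    · rw [Function.update_of_ne hβw, if_neg hβw, add_zero]
      have hne : (e β : ℕ) ≠ e w := fun h => hβw (e.injective (Fin.ext h))
      have hβ := (e β).isLt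
      have : rauzyPos n (e w) (e β) < rauzyPos n (e w) (e z) ↔ (e β : ℕ) < e w := by
        simp only [rauzyPos]; split_ifs <;> omega
      simp only [this]
  rw [Finset.sum_congr rfl fun β _ => this β, Finset.sum_add_distrib, Finset.sum_ite_eq']
  simp only [Finset.mem_univ, if_true]
  ring

/-- The winner is last in its own row, so its length enters no left end of that row. -/
lemma sum_update_last (hw : e w = Fin.last n) (c : ℝ) (α : 𝒜) :
    ∑ β ∈ Finset.univ.filter (fun β => e β < e α), Function.update l w c β =
    ∑ β ∈ Finset.univ.filter (fun β => e β < e α), l β := by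
  refine Finset.sum_congr rfl fun β hβ => ?_
  rw [Function.update_of_ne]
  rintro rfl
  simp only [Finset.mem_filter, Finset.mem_univ, true_and, hw] at hβ
  exact absurd (Fin.le_last (e α)) (not_le.2 hβ)

lemma sum_update_univ (c : ℝ) :
    ∑ β, Function.update l w (l w - c) β = ∑ β, l β - c := by
  have : ∀ β, Function.update l w (l w - c) β = l β - (if β = w then c else 0) := by
    intro β
    by_cases h : β = w
    · subst h; simp
    · simp [h]
  simp [Finset.sum_congr rfl fun β _ => this β]

end Shift

lemma left'_lastBot (D : IETData 𝒜 n) : D.left' D.lastBot = D.total - D.len D.lastBot := by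
  have := D.swap.right_lastTop
  rw [right_eq] at this
  change D.left' D.lastBot + D.len D.lastBot = D.total at this
  linarith

lemma left_lastTop (D : IETData 𝒜 n) : D.left D.lastTop = D.total - D.len D.lastTop := by
  have := D.right_lastTop
  rw [right_eq] at this
  linarith

lemma top_lastTop (D : IETData 𝒜 n) : D.top D.lastTop = Fin.last n := by simp [lastTop]

lemma bot_lastBot (D : IETData 𝒜 n) : D.bot D.lastBot = Fin.last n := by simp [lastBot]

lemma Keane.lastTop_ne_lastBot {D : IETData 𝒜 n} (hK : D.Keane) (hlen : ∀ α, 0 < D.len α)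
    (hn : n ≠ 0) : D.lastTop ≠ D.lastBot := by
  intro h
  refine hK 1 le_rfl D.lastTop D.lastTop ?_ ?_
  · rw [top_lastTop]; exact fun h0 => hn (by simpa [Fin.ext_iff] using h0)
  · rw [Function.iterate_one, D.iet_of_mem hlen (D.left_mem_interval hlen _)]
    have := D.left'_lastBot
    rw [← h] at this
    rw [this, left_lastTop]
    ring

/-- With equal last lengths T would send the left end of `D.lastBot` to that of `D.lastTop` in one
step. For n ≠ 0 the latter letter is not the first one, so this is a forbidden connection. -/
lemma Keane.len_ne {D : IETData 𝒜 n} (hK : D.Keane) (hlen : ∀ α, 0 < D.len α)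
    (hn : n ≠ 0) : D.len D.lastTop ≠ D.len D.lastBot := by
  intro h
  refine hK 1 le_rfl D.lastBot D.lastTop ?_ ?_
  · rw [top_lastTop]; exact fun h0 => hn (by simpa [Fin.ext_iff] using h0)
  · rw [Function.iterate_one, D.iet_of_mem hlen (D.left_mem_interval hlen _), left'_lastBot,
      left_lastTop, h]
    ring

/-! ### The induction step when the upper row wins -/

section Top

variable {D : IETData 𝒜 n} (hlt : D.len D.lastBot < D.len D.lastTop)
include hlt

lemma rauzy_top_eq : D.rauzy =
    { top := D.top
      bot := D.bot.trans (rauzyShift (D.bot D.lastTop))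
      len := Function.update D.len D.lastTop (D.len D.lastTop - D.len D.lastBot) } := by
  rw [rauzy, if_pos hlt]

lemma rauzy_top_total : D.rauzy.total = D.total - D.len D.lastBot := by
  rw [rauzy_top_eq hlt, total, sum_update_univ, total]

lemma rauzy_top_left (α : 𝒜) : D.rauzy.left α = D.left α := by
  rw [rauzy_top_eq hlt]
  exact sum_update_last D.top D.len _ D.top_lastTop _ α

lemma rauzy_top_left'_of_ne {α : 𝒜} (hα : α ≠ D.lastBot) : D.rauzy.left' α = D.left' α := by
  rw [rauzy_top_eq hlt]
  exact sum_shift_of_ne D.bot D.len _ (fun h => hlt.ne (by rw [h]; rfl)) hα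

lemma rauzy_top_left'_lastBot :
    D.rauzy.left' D.lastBot = D.left' D.lastTop + D.len D.lastTop - D.len D.lastBot := by
  rw [rauzy_top_eq hlt]
  exact sum_shift_last D.bot D.len _ (fun h => hlt.ne (by rw [h]; rfl))

lemma rauzy_top_len_lastTop :
    D.rauzy.len D.lastTop = D.len D.lastTop - D.len D.lastBot := by
  rw [rauzy_top_eq hlt]; simp

lemma rauzy_top_len_of_ne {α : 𝒜} (hα : α ≠ D.lastTop) : D.rauzy.len α = D.len α := by
  rw [rauzy_top_eq hlt]; simp [hα]

lemma rauzy_top_len_pos (hlen : ∀ α, 0 < D.len α) (α : 𝒜) : 0 < D.rauzy.len α := by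
  by_cases h : α = D.lastTop
  · subst h; rw [rauzy_top_len_lastTop hlt]; linarith
  · rw [rauzy_top_len_of_ne hlt h]; exact hlen α

lemma rauzy_top_interval_subset (hlen : ∀ α, 0 < D.len α) (α : 𝒜) :
    D.rauzy.interval α ⊆ D.interval α := by
  rw [interval, interval, right_eq, right_eq, rauzy_top_left hlt]
  refine Ico_subset_Ico_right ?_
  by_cases h : α = D.lastTop
  · subst h; rw [rauzy_top_len_lastTop hlt]; linarith [hlen D.lastBot]
  · rw [rauzy_top_len_of_ne hlt h]

/-- T carries the interval of the loser `D.lastBot` onto the segment cut off from the base, which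
lies in the interval of the winner. This letter alone needs a second step, collecting the winner's
value of h; all others return at once. -/
lemma rauzy_top_isTower (hlen : ∀ α, 0 < D.len α) :
    IsTower D D.rauzy D.rauzyMat.transpose fun α => if α = D.lastBot then 2 else 1 := by
  have hne : D.lastBot ≠ D.lastTop := fun h => hlt.ne (by rw [h])
  have hB : ∀ h : 𝒜 → ℝ, ∀ α, D.rauzyMat.transpose.mulVec h α =
      h α + if α = D.lastBot then h D.lastTop else 0 := by
    intro h α
    rw [rauzyMat, if_pos hlt, Matrix.transpose_add, Matrix.add_mulVec, Matrix.transpose_one,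
      Matrix.one_mulVec, Matrix.transpose_single, Pi.add_apply, Matrix.single_mulVec]
    by_cases hα : α = D.lastBot
    · subst hα; simp
    · simp [hα]
  have hlenz := hlen D.lastBot
  have hTz : ∀ x ∈ D.rauzy.interval D.lastBot,
      D.iet x = x + (D.total - D.len D.lastBot - D.left D.lastBot) ∧
      D.total - D.len D.lastBot ≤ D.iet x ∧ D.iet x ∈ D.interval D.lastTop := by
    intro x hx
    have hx' := rauzy_top_interval_subset hlt hlen _ hx
    have h1 := D.iet_of_mem hlen hx'
    rw [left'_lastBot] at h1
    rw [interval, right_eq] at hx'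
    have h2 := hx'.1
    have h3 := hx'.2
    refine ⟨h1, by linarith, ?_⟩
    rw [interval, right_lastTop, left_lastTop]
    constructor <;> linarith
  refine ⟨?_, fun α => by split_ifs <;> norm_num, ?_, ?_, ?_, ?_⟩
  · rw [base, base, rauzy_top_total hlt]
    exact Ico_subset_Ico_right (by linarith)
  · intro α x hx
    rw [D.rauzy.iet_of_mem (rauzy_top_len_pos hlt hlen) hx, rauzy_top_left hlt]
    by_cases hα : α = D.lastBot
    · subst hα
      obtain ⟨h1, -, h3⟩ := hTz x hx
      rw [if_pos rfl, Function.iterate_succ_apply, Function.iterate_one, D.iet_of_mem hlen h3, h1,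
        rauzy_top_left'_lastBot hlt, left_lastTop]
      ring
    · rw [if_neg hα, Function.iterate_one,
        D.iet_of_mem hlen (rauzy_top_interval_subset hlt hlen _ hx), rauzy_top_left'_of_ne hlt hα]
  · intro α x hx i h0 hi
    by_cases hα : α = D.lastBot
    · subst hα
      rw [if_pos rfl] at hi
      obtain rfl : i = 1 := by omega
      rw [Function.iterate_one, base, rauzy_top_total hlt]
      exact fun h => absurd h.2 (not_lt.2 (hTz x hx).2.1)
    · rw [if_neg hα] at hi; omega
  · intro α x hx h
    have hx' := D.stepFun_of_mem hlen h (rauzy_top_interval_subset hlt hlen _ hx)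
    rw [hB]
    by_cases hα : α = D.lastBot
    · subst hα
      rw [if_pos rfl, if_pos rfl, birkhoffSum_succ, birkhoffSum_one, Function.iterate_one, hx',
        D.stepFun_of_mem hlen h (hTz x hx).2.2]
    · rw [if_neg hα, if_neg hα, birkhoffSum_one, hx', add_zero]
  · intro x hx
    by_cases hxb : x < D.total - D.len D.lastBot
    · obtain ⟨α, hα⟩ := D.rauzy.exists_mem_interval (x := x)
        (by rw [base, rauzy_top_total hlt]; exact ⟨hx.1, hxb⟩)
      exact ⟨α, x, hα, 0, by split_ifs <;> norm_num, rfl⟩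
    · have hy : x - (D.total - D.len D.lastBot - D.left D.lastBot) ∈
          D.rauzy.interval D.lastBot := by
        rw [interval, right_eq, rauzy_top_left hlt, rauzy_top_len_of_ne hlt hne]
        have := hx.2
        constructor <;> linarith
      refine ⟨D.lastBot, _, hy, 1, by rw [if_pos rfl]; norm_num, ?_⟩
      rw [Function.iterate_one, (hTz _ hy).1]
      ring

end Top

/-! ### The induction step when the lower row wins -/

section Bot

variable {D : IETData 𝒜 n} (hlt : D.len D.lastTop < D.len D.lastBot)
include hlt

lemma rauzy_bot_eq : D.rauzy =
    { top := D.top.trans (rauzyShift (D.top D.lastBot))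
      bot := D.bot
      len := Function.update D.len D.lastBot (D.len D.lastBot - D.len D.lastTop) } := by
  rw [rauzy, if_neg hlt.not_gt]

lemma rauzy_bot_total : D.rauzy.total = D.total - D.len D.lastTop := by
  rw [rauzy_bot_eq hlt, total, sum_update_univ, total]

lemma rauzy_bot_left' (α : 𝒜) : D.rauzy.left' α = D.left' α := by
  rw [rauzy_bot_eq hlt]
  exact sum_update_last D.bot D.len _ D.bot_lastBot _ α

lemma rauzy_bot_left_of_ne {α : 𝒜} (hα : α ≠ D.lastTop) : D.rauzy.left α = D.left α := by
  rw [rauzy_bot_eq hlt]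
  exact sum_shift_of_ne D.top D.len _ (fun h => hlt.ne (by rw [h]; rfl)) hα

lemma rauzy_bot_left_lastTop :
    D.rauzy.left D.lastTop = D.left D.lastBot + D.len D.lastBot - D.len D.lastTop := by
  rw [rauzy_bot_eq hlt]
  exact sum_shift_last D.top D.len _ (fun h => hlt.ne (by rw [h]; rfl))

lemma rauzy_bot_len_lastBot :
    D.rauzy.len D.lastBot = D.len D.lastBot - D.len D.lastTop := by
  rw [rauzy_bot_eq hlt]; simp

lemma rauzy_bot_len_of_ne {α : 𝒜} (hα : α ≠ D.lastBot) : D.rauzy.len α = D.len α := by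
  rw [rauzy_bot_eq hlt]; simp [hα]

lemma rauzy_bot_len_pos (hlen : ∀ α, 0 < D.len α) (α : 𝒜) : 0 < D.rauzy.len α := by
  by_cases h : α = D.lastBot
  · subst h; rw [rauzy_bot_len_lastBot hlt]; linarith
  · rw [rauzy_bot_len_of_ne hlt h]; exact hlen α

lemma rauzy_bot_interval_subset (hlen : ∀ α, 0 < D.len α) {α : 𝒜} (hα : α ≠ D.lastTop) :
    D.rauzy.interval α ⊆ D.interval α := by
  rw [interval, interval, right_eq, right_eq, rauzy_bot_left_of_ne hlt hα]
  refine Ico_subset_Ico_right ?_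
  by_cases h : α = D.lastBot
  · subst h; rw [rauzy_bot_len_lastBot hlt]; linarith [hlen D.lastTop]
  · rw [rauzy_bot_len_of_ne hlt h]

/-- The loser's label is now attached to the right end of the winner's old interval. T maps this
piece onto the old interval of the loser, which is the segment cut off. -/
lemma rauzy_bot_mem_lastTop (hlen : ∀ α, 0 < D.len α) {x : ℝ}
    (hx : x ∈ D.rauzy.interval D.lastTop) :
    x ∈ D.interval D.lastBot ∧
      D.iet x = x + (D.total - D.len D.lastBot - D.left D.lastBot) ∧
      D.iet x ∈ D.interval D.lastTop := by
  have hne : D.lastTop ≠ D.lastBot := fun h => hlt.ne (by rw [h])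
  rw [interval, right_eq, rauzy_bot_left_lastTop hlt, rauzy_bot_len_of_ne hlt hne] at hx
  have h2 := hx.1
  have h3 := hx.2
  have h0 : x ∈ D.interval D.lastBot := by
    rw [interval, right_eq]; constructor <;> linarith
  have h1 := D.iet_of_mem hlen h0
  rw [left'_lastBot] at h1
  refine ⟨h0, h1, ?_⟩
  rw [interval, right_lastTop, left_lastTop]
  constructor <;> linarith

lemma rauzy_bot_isTower (hlen : ∀ α, 0 < D.len α) :
    IsTower D D.rauzy D.rauzyMat.transpose fun α => if α = D.lastTop then 2 else 1 := by
  have hne : D.lastTop ≠ D.lastBot := fun h => hlt.ne (by rw [h])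
  have hB : ∀ h : 𝒜 → ℝ, ∀ α, D.rauzyMat.transpose.mulVec h α =
      h α + if α = D.lastTop then h D.lastBot else 0 := by
    intro h α
    rw [rauzyMat, if_neg hlt.not_gt, Matrix.transpose_add, Matrix.add_mulVec,
      Matrix.transpose_one, Matrix.one_mulVec, Matrix.transpose_single, Pi.add_apply,
      Matrix.single_mulVec]
    by_cases hα : α = D.lastTop
    · subst hα; simp
    · simp [hα]
  have hlenz := hlen D.lastTop
  have hTz := fun x => rauzy_bot_mem_lastTop hlt hlen (x := x)
  refine ⟨?_, fun α => by split_ifs <;> norm_num, ?_, ?_, ?_, ?_⟩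
  · rw [base, base, rauzy_bot_total hlt]
    exact Ico_subset_Ico_right (by linarith)
  · intro α x hx
    rw [D.rauzy.iet_of_mem (rauzy_bot_len_pos hlt hlen) hx, rauzy_bot_left' hlt]
    by_cases hα : α = D.lastTop
    · subst hα
      obtain ⟨-, h1, h3⟩ := hTz x hx
      rw [if_pos rfl, Function.iterate_succ_apply, Function.iterate_one, D.iet_of_mem hlen h3, h1,
        rauzy_bot_left_lastTop hlt, left_lastTop]
      ring
    · rw [if_neg hα, Function.iterate_one,
        D.iet_of_mem hlen (rauzy_bot_interval_subset hlt hlen hα hx),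
        rauzy_bot_left_of_ne hlt hα]
  · intro α x hx i h0 hi
    by_cases hα : α = D.lastTop
    · subst hα
      rw [if_pos rfl] at hi
      obtain rfl : i = 1 := by omega
      rw [Function.iterate_one, base, rauzy_bot_total hlt, ← left_lastTop]
      exact fun h => absurd h.2 (not_lt.2 (hTz x hx).2.2.1)
    · rw [if_neg hα] at hi; omega
  · intro α x hx h
    rw [hB]
    by_cases hα : α = D.lastTop
    · subst hα
      rw [if_pos rfl, if_pos rfl, birkhoffSum_succ, birkhoffSum_one, Function.iterate_one,
        D.stepFun_of_mem hlen h (hTz x hx).1, D.stepFun_of_mem hlen h (hTz x hx).2.2, add_comm]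
    · rw [if_neg hα, if_neg hα, birkhoffSum_one, add_zero,
        D.stepFun_of_mem hlen h (rauzy_bot_interval_subset hlt hlen hα hx)]
  · intro x hx
    by_cases hxb : x < D.total - D.len D.lastTop
    · obtain ⟨α, hα⟩ := D.rauzy.exists_mem_interval (x := x)
        (by rw [base, rauzy_bot_total hlt]; exact ⟨hx.1, hxb⟩)
      exact ⟨α, x, hα, 0, by split_ifs <;> norm_num, rfl⟩
    · have hy : x - (D.total - D.len D.lastBot - D.left D.lastBot) ∈
          D.rauzy.interval D.lastTop := by
        rw [interval, right_eq, rauzy_bot_left_lastTop hlt, rauzy_bot_len_of_ne hlt hne]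
        have := hx.2
        constructor <;> linarith
      refine ⟨D.lastTop, _, hy, 1, by rw [if_pos rfl]; norm_num, ?_⟩
      rw [Function.iterate_one, (hTz _ hy).2.1]
      ring

end Bot

/-! ### Keane's condition under induction -/

/-- Iterates of the induced map are iterates of the original one, with at least as many steps. -/
lemma IsTower.exists_iterate {D D' : IETData 𝒜 n} {B : Matrix 𝒜 𝒜 ℝ} {q : 𝒜 → ℕ}
    (H : IsTower D D' B q) (hlen' : ∀ α, 0 < D'.len α) {x : ℝ} (hx : x ∈ D'.base) (m : ℕ) :
    ∃ m' ≥ m, D'.iet^[m] x = D.iet^[m'] x := by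
  refine ⟨D'.returnTime q m x, ?_, (H.iterate_returnTime hlen' hx m).symm⟩
  induction m with
  | zero => exact Nat.zero_le _
  | succ m ih =>
    rw [returnTime_succ]
    have := H.height_pos (D'.letter (D'.iet^[m] x))
    omega

lemma Keane.rauzy_len_pos {D : IETData 𝒜 n} (hK : D.Keane) (hlen : ∀ α, 0 < D.len α)
    (hn : n ≠ 0) (α : 𝒜) : 0 < D.rauzy.len α := by
  rcases (hK.len_ne hlen hn).lt_or_gt with hlt | hlt
  · exact rauzy_bot_len_pos hlt hlen α
  · exact rauzy_top_len_pos hlt hlen α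

lemma Keane.rauzy_isTower {D : IETData 𝒜 n} (hK : D.Keane) (hlen : ∀ α, 0 < D.len α)
    (hn : n ≠ 0) : ∃ q, IsTower D D.rauzy D.rauzyMat.transpose q := by
  rcases (hK.len_ne hlen hn).lt_or_gt with hlt | hlt
  · exact ⟨_, rauzy_bot_isTower hlt hlen⟩
  · exact ⟨_, rauzy_top_isTower hlt hlen⟩

/-- Left ends of the induced exchange are left ends for T, so a connection would be inherited from
T. The one exception is `D.lastTop` when the lower row wins: its new left end is sent by T to the
old one, and is traded for it at the price of one step. -/
lemma Keane.rauzy {D : IETData 𝒜 n} (hK : D.Keane) (hlen : ∀ α, 0 < D.len α)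
    (hn : n ≠ 0) : D.rauzy.Keane := by
  have hlen' := hK.rauzy_len_pos hlen hn
  obtain ⟨q, H⟩ := hK.rauzy_isTower hlen hn
  have hmem : ∀ α, D.rauzy.left α ∈ D.rauzy.base := fun α =>
    D.rauzy.interval_subset_base hlen' α (D.rauzy.left_mem_interval hlen' α)
  intro m hm α β hβ heq
  obtain ⟨m', hm', h'⟩ := H.exists_iterate hlen' (hmem α) m
  rw [h'] at heq
  rcases (hK.len_ne hlen hn).lt_or_gt with hlt | hlt
  · have hz0 : D.top D.lastTop ≠ 0 := by
      rw [top_lastTop]; exact fun h0 => hn (by simpa [Fin.ext_iff] using h0)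
    have hz : D.iet (D.rauzy.left D.lastTop) = D.left D.lastTop := by
      rw [(rauzy_bot_mem_lastTop hlt hlen (D.rauzy.left_mem_interval hlen' _)).2.1,
        rauzy_bot_left_lastTop hlt, left_lastTop]
      ring
    -- a positive iterate of `D.left α` equals `D.rauzy.left β`
    have h1 : ∃ i, D.iet^[i] (D.left α) = D.rauzy.left β ∧ (α ≠ D.lastTop → 1 ≤ i) ∧
        (α = D.lastTop → β ≠ D.lastTop → 1 ≤ i) := by
      by_cases hα : α = D.lastTop
      · subst hα
        obtain ⟨i, rfl⟩ : ∃ i, m' = i + 1 := ⟨m' - 1, by omega⟩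
        rw [Function.iterate_succ_apply, hz] at heq
        refine ⟨i, heq, fun h => absurd rfl h, fun _ hβ' => ?_⟩
        rcases Nat.eq_zero_or_pos i with rfl | hi
        -- If the trade used up the only step, two different letters would share a left end.
        · rw [Function.iterate_zero, id, rauzy_bot_left_of_ne hlt hβ'] at heq
          exact absurd (D.eq_of_mem_interval hlen (D.left_mem_interval hlen _)
            (heq ▸ D.left_mem_interval hlen β)) (Ne.symm hβ')
        · exact hi
      · rw [rauzy_bot_left_of_ne hlt hα] at heq
        exact ⟨m', heq, fun _ => hm.trans hm', fun h => absurd h hα⟩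
    obtain ⟨i, hi, hi1, hi2⟩ := h1
    by_cases hβ' : β = D.lastTop
    · subst hβ'
      -- With the exceptional letter as target, one further step reaches the old left end, so the
      -- iterate is positive even for i = 0.
      refine hK (i + 1) (by omega) α D.lastTop hz0 ?_
      rw [Function.iterate_succ_apply', hi, hz]
    · have hi0 : 1 ≤ i := by
        by_cases hα : α = D.lastTop
        · exact hi2 hα hβ'
        · exact hi1 hα
      refine hK i hi0 α β ?_ (by rw [hi, rauzy_bot_left_of_ne hlt hβ'])
      -- The reordering never moves position 0.
      intro h0
      apply hβ
      rw [rauzy_bot_eq hlt]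
      change rauzyShift (D.top D.lastBot) (D.top β) = 0
      rw [h0]
      ext
      simp [rauzyShift, rauzyPos]
  · rw [rauzy_top_left hlt, rauzy_top_left hlt] at heq
    refine hK m' (hm.trans hm') α β ?_ heq
    rwa [rauzy_top_eq hlt] at hβ

/-! ### Iterated induction -/

lemma Keane.iterate {D : IETData 𝒜 n} (hK : D.Keane) (hlen : ∀ α, 0 < D.len α)
    (hn : n ≠ 0) (m : ℕ) :
    (IETData.rauzy^[m] D).Keane ∧ ∀ α, 0 < (IETData.rauzy^[m] D).len α := by
  induction m with
  | zero => exact ⟨hK, hlen⟩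
  | succ m ih =>
    rw [Function.iterate_succ_apply']
    exact ⟨ih.1.rauzy ih.2 hn, ih.1.rauzy_len_pos ih.2 hn⟩

lemma Keane.cocycle_isTower {D : IETData 𝒜 n} (hK : D.Keane) (hlen : ∀ α, 0 < D.len α)
    (hn : n ≠ 0) (m : ℕ) :
    ∃ q, IsTower D (IETData.rauzy^[m] D) (D.cocycle m).transpose q := by
  induction m with
  | zero => exact ⟨_, by simpa [cocycle] using IsTower.refl D hlen⟩
  | succ m ih =>
    obtain ⟨q, H⟩ := ih
    obtain ⟨hK', hlen'⟩ := hK.iterate hlen hn m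
    obtain ⟨q', H'⟩ := hK'.rauzy_isTower hlen' hn
    rw [Function.iterate_succ_apply', cocycle, Matrix.transpose_mul]
    exact H.trans H' hlen' (hK'.rauzy_len_pos hlen' hn)

lemma cocycle_add (D : IETData 𝒜 n) (i j : ℕ) :
    D.cocycle (i + j) = D.cocycle i * (IETData.rauzy^[i] D).cocycle j := by
  induction j with
  | zero => simp [cocycle]
  | succ j ih =>
    rw [← add_assoc, cocycle, cocycle, ih, Matrix.mul_assoc, ← Function.iterate_add_apply,
      add_comm j i]

lemma rauzyMat_nonneg (D : IETData 𝒜 n) (α β : 𝒜) : 0 ≤ D.rauzyMat α β := by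
  have h1 : (0 : ℝ) ≤ (1 : Matrix 𝒜 𝒜 ℝ) α β := by
    rw [Matrix.one_apply]; split_ifs <;> norm_num
  rw [rauzyMat]
  split_ifs
  all_goals
    rw [Matrix.add_apply, Matrix.single_apply]
    split_ifs <;> linarith

lemma cocycle_nonneg (D : IETData 𝒜 n) (m : ℕ) (α β : 𝒜) : 0 ≤ D.cocycle m α β := by
  induction m generalizing α β with
  | zero => rw [cocycle, Matrix.one_apply]; split_ifs <;> norm_num
  | succ m ih =>
    rw [cocycle, Matrix.mul_apply]
    exact Finset.sum_nonneg fun γ _ => mul_nonneg (ih _ _) (rauzyMat_nonneg _ _ _)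

/-- `λ = A(π, λ) λ̃`. -/
lemma Keane.rauzyMat_mulVec {D : IETData 𝒜 n} (hK : D.Keane) (hlen : ∀ α, 0 < D.len α)
    (hn : n ≠ 0) : D.rauzyMat.mulVec D.rauzy.len = D.len := by
  have hne := hK.lastTop_ne_lastBot hlen hn
  ext α
  rcases (hK.len_ne hlen hn).lt_or_gt with hlt | hlt
  · rw [rauzyMat, if_neg hlt.not_gt, Matrix.add_mulVec, Matrix.one_mulVec, Pi.add_apply,
      Matrix.single_mulVec, rauzy_bot_len_of_ne hlt hne]
    by_cases hα : α = D.lastBot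
    · subst hα; simp [rauzy_bot_len_lastBot hlt]
    · simp [hα, rauzy_bot_len_of_ne hlt hα]
  · rw [rauzyMat, if_pos hlt, Matrix.add_mulVec, Matrix.one_mulVec, Pi.add_apply,
      Matrix.single_mulVec, rauzy_top_len_of_ne hlt hne.symm]
    by_cases hα : α = D.lastTop
    · subst hα; simp [rauzy_top_len_lastTop hlt]
    · simp [hα, rauzy_top_len_of_ne hlt hα]

lemma Keane.cocycle_mulVec {D : IETData 𝒜 n} (hK : D.Keane) (hlen : ∀ α, 0 < D.len α)
    (hn : n ≠ 0) (m : ℕ) : (D.cocycle m).mulVec (IETData.rauzy^[m] D).len = D.len := by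
  induction m with
  | zero => simp [cocycle]
  | succ m ih =>
    obtain ⟨hK', hlen'⟩ := hK.iterate hlen hn m
    rw [cocycle, Function.iterate_succ_apply', ← Matrix.mulVec_mulVec,
      hK'.rauzyMat_mulVec hlen' hn, ih]

/-! ### Balanced towers and ergodicity -/

/-- Towers whose base consists of comparable intervals and whose heights are comparable to
`|I| / |I'|`; the first `p` floors over the whole base are intervals. -/
structure IsBalancedTower (D D' : IETData 𝒜 n) (B : Matrix 𝒜 𝒜 ℝ) (q : 𝒜 → ℕ) (δ κ : ℝ) : Prop
    extends IsTower D D' B q where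
  len_pos : ∀ α, 0 < D'.len α
  total_le : ∀ α, D'.total ≤ κ * D'.len α
  height_mul_le : ∀ α, q α * D'.total ≤ κ * D.total
  exists_height : ∃ p : ℕ, (∀ α, p ≤ q α) ∧
    (∀ i < p, OrdConnected (D.iet^[i] '' D'.base)) ∧ δ * D.total ≤ p * D'.total

namespace IsBalancedTower

variable {D D' : IETData 𝒜 n} {B : Matrix 𝒜 𝒜 ℝ} {q : 𝒜 → ℕ} {δ κ : ℝ}

/-- The floors cover the base, and by invariance every floor over an interval contains as much of X
as the interval itself; there are at most κ |I| / |I'| floors over each. -/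
lemma volume_le_of_invariant (H : IsBalancedTower D D' B q δ κ) (hlen : ∀ α, 0 < D.len α)
    {X : Set ℝ} (hX : MeasurableSet X) (hXb : X ⊆ D.base)
    (hinv : ∀ x ∈ D.base, D.iet x ∈ X ↔ x ∈ X) :
    volume X ≤ ENNReal.ofReal (κ * D.total / D'.total) * volume (X ∩ D'.base) := by
  have hl := D'.total_pos H.len_pos
  have hit : ∀ i, ∀ x ∈ D.base, D.iet^[i] x ∈ X ↔ x ∈ X := by
    intro i x hx
    induction i with
    | zero => rfl
    | succ i ih =>
      rw [Function.iterate_succ_apply', hinv _ (D.iterate_iet_mem_base hlen hx i), ih]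
  have hcov : X ⊆ ⋃ α ∈ (Finset.univ : Finset 𝒜), ⋃ i ∈ Finset.range (q α),
      D.iet^[i] '' (X ∩ D'.interval α) := by
    intro x hx
    obtain ⟨α, y, hy, i, hi, rfl⟩ := H.exists_floor x (hXb hx)
    have hyb := H.base_subset (D'.interval_subset_base H.len_pos α hy)
    simp only [mem_iUnion, Finset.mem_range, Finset.mem_univ]
    exact ⟨α, trivial, i, hi, y, ⟨(hit i y hyb).1 hx, hy⟩, rfl⟩
  calc volume X ≤ ∑ α, ∑ i ∈ Finset.range (q α), volume (D.iet^[i] '' (X ∩ D'.interval α)) :=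
        (measure_mono hcov).trans ((measure_biUnion_finset_le _ _).trans
          (Finset.sum_le_sum fun α _ => measure_biUnion_finset_le _ _))
    _ = ∑ α, (q α : ENNReal) * volume (X ∩ D'.interval α) := by
        refine Finset.sum_congr rfl fun α _ => ?_
        rw [Finset.sum_congr rfl fun i _ => (D.volume_image_iterate hlen i
          (hX.inter (D'.measurableSet_interval α))).2]
        simp
    _ ≤ ∑ α, ENNReal.ofReal (κ * D.total / D'.total) * volume (X ∩ D'.interval α) := by
        refine Finset.sum_le_sum fun α _ => mul_le_mul_left ?_ _
        rw [← ENNReal.ofReal_natCast]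
        refine ENNReal.ofReal_le_ofReal ?_
        rw [le_div_iff₀ hl]
        exact H.height_mul_le α
    _ = _ := by
        rw [← Finset.mul_sum, D'.volume_eq_sum H.len_pos (hX.inter D'.measurableSet_base)]
        congr 1
        have : (X ∩ D'.base) \ D'.base = ∅ := by
          ext x; simp +contextual
        rw [this, measure_empty, zero_add]
        refine Finset.sum_congr rfl fun α _ => ?_
        rw [inter_assoc, inter_eq_right.2 (D'.interval_subset_base H.len_pos α)]

lemma disjoint_floors (H : IsBalancedTower D D' B q δ κ) (hlen : ∀ α, 0 < D.len α) {p : ℕ}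
    (hp : ∀ α, p ≤ q α) {i j : ℕ} (hi : i < p) (hj : j < p) (hij : i ≠ j) :
    Disjoint (D.iet^[i] '' D'.base) (D.iet^[j] '' D'.base) := by
  wlog hlt : i < j generalizing i j
  · exact (this hj hi hij.symm (by omega)).symm
  rw [disjoint_left]
  rintro _ ⟨x, hx, rfl⟩ ⟨y, hy, hxy⟩
  obtain ⟨e, rfl⟩ := Nat.exists_eq_add_of_lt hlt
  rw [add_assoc, Function.iterate_add_apply] at hxy
  have := (D.iet_injective hlen).iterate i hxy
  have hm := D'.mem_interval_letter hy
  exact H.notMem_base _ y hm (e + 1) (Nat.succ_pos e)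
    (lt_of_lt_of_le (by omega) (hp (D'.letter y))) (this ▸ hx)

end IsBalancedTower

/-- An invariant set has measure zero or full measure if there are arbitrarily narrow balanced
towers. -/
lemma volume_eq_zero_of_invariant (D : IETData 𝒜 n) (hlen : ∀ α, 0 < D.len α) {δ κ : ℝ}
    (hδ : 0 < δ) (hκ : 0 < κ)
    (hseq : ∀ η > 0, ∃ (D' : IETData 𝒜 n) (B : Matrix 𝒜 𝒜 ℝ) (q : 𝒜 → ℕ),
      IsBalancedTower D D' B q δ κ ∧ D'.total < η)
    {X : Set ℝ} (hX : MeasurableSet X) (hXb : X ⊆ D.base)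
    (hinv : ∀ x ∈ D.base, D.iet x ∈ X ↔ x ∈ X) :
    volume X = 0 ∨ volume (D.base \ X) = 0 := by
  by_contra! hcon
  set Y := D.base \ X with hY
  have hYm : MeasurableSet Y := D.measurableSet_base.diff hX
  have hinvY : ∀ x ∈ D.base, D.iet x ∈ Y ↔ x ∈ Y := fun x hx => by
    simp only [hY, Set.mem_sdiff, hinv x hx, D.iet_mem_base_iff hlen]
  have hfin : volume D.base ≠ ⊤ := by rw [volume_base]; exact ENNReal.ofReal_ne_top
  have hXfin : volume X ≠ ⊤ := measure_ne_top_of_subset hXb hfin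
  have hYfin : volume Y ≠ ⊤ := measure_ne_top_of_subset sdiff_subset hfin
  -- The towers will force mass at least a outside the two compact sets, while inner regularity with
  -- error a/4 each leaves at most a/2 there.
  set a := ENNReal.ofReal (δ / κ) * min (volume X) (volume Y) with ha
  have ha0 : a ≠ 0 := by
    refine mul_ne_zero ?_ ?_
    · simpa using div_pos hδ hκ
    · exact (lt_min (pos_iff_ne_zero.2 hcon.1) (pos_iff_ne_zero.2 hcon.2)).ne'
  have hatop : a ≠ ⊤ :=
    ENNReal.mul_ne_top ENNReal.ofReal_ne_top ((min_le_left _ _).trans_lt hXfin.lt_top).ne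
  have hε : a / 4 ≠ 0 := by simp [ha0]
  obtain ⟨K₁, hK₁X, hK₁, hK₁v⟩ := hX.exists_isCompact_sdiff_lt hXfin hε
  obtain ⟨K₂, hK₂Y, hK₂, hK₂v⟩ := hYm.exists_isCompact_sdiff_lt hYfin hε
  have hdisj : Disjoint K₁ K₂ := disjoint_left.2 fun x h1 h2 => (hK₂Y h2).2 (hK₁X h1)
  obtain ⟨η, hη, hthick⟩ := hdisj.exists_thickenings hK₁ hK₂.isClosed
  obtain ⟨D', B, q, H, hsmall⟩ := hseq η hη
  obtain ⟨p, hpq, hord, hp⟩ := H.exists_height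
  have hl := D'.total_pos H.len_pos
  set R := (X \ K₁) ∪ (Y \ K₂) with hR
  have hRm : MeasurableSet R :=
    (hX.diff hK₁.measurableSet).union (hYm.diff hK₂.measurableSet)
  set m := min (volume (X ∩ D'.base)) (volume (Y ∩ D'.base)) with hm
  -- every floor misses one of the two compact sets
  have hfloor : ∀ i < p, m ≤ volume (R ∩ D.iet^[i] '' D'.base) := by
    intro i hi
    have himg : ∀ Z : Set ℝ, MeasurableSet Z → (∀ x ∈ D.base, D.iet x ∈ Z ↔ x ∈ Z) →
        volume (Z ∩ D'.base) = volume (Z ∩ D.iet^[i] '' D'.base) := by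
      intro Z hZ hZi
      rw [← (D.volume_image_iterate hlen i (hZ.inter D'.measurableSet_base)).2]
      congr 1
      have hit : ∀ x ∈ D.base, D.iet^[i] x ∈ Z ↔ x ∈ Z := by
        intro x hx
        clear hi
        induction i with
        | zero => rfl
        | succ i ih =>
          rw [Function.iterate_succ_apply', hZi _ (D.iterate_iet_mem_base hlen hx i), ih]
      ext x
      constructor
      · rintro ⟨y, ⟨hy1, hy2⟩, rfl⟩
        exact ⟨(hit y (H.base_subset hy2)).2 hy1, y, hy2, rfl⟩
      · rintro ⟨hx, y, hy, rfl⟩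
        exact ⟨y, ⟨(hit y (H.base_subset hy)).1 hx, hy⟩, rfl⟩
    by_cases h1 : ∃ x ∈ K₁, x ∈ D.iet^[i] '' D'.base
    · obtain ⟨x, hx1, hx2⟩ := h1
      have h2 : ∀ y ∈ K₂, y ∉ D.iet^[i] '' D'.base := by
        intro y hy hy2
        -- The floor is an interval, so it contains the segment from x to y, whose length cannot
        -- exceed |I'|.
        have hdist : |x - y| ≤ D'.total := by
          have hsub : uIcc x y ⊆ D.iet^[i] '' D'.base := (hord i hi).uIcc_subset hx2 hy2
          have := measure_mono (μ := volume) hsub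
          rw [(D.volume_image_iterate hlen i D'.measurableSet_base).2, volume_base,
            Real.volume_interval] at this
          rw [abs_sub_comm]
          exact (ENNReal.ofReal_le_ofReal_iff hl.le).1 this
        refine disjoint_left.1 hthick (Metric.self_subset_thickening hη _ hx1) ?_
        rw [Metric.mem_thickening_iff]
        exact ⟨y, hy, by rw [Real.dist_eq]; linarith⟩
      calc m ≤ volume (Y ∩ D'.base) := min_le_right _ _
        _ = volume (Y ∩ D.iet^[i] '' D'.base) := himg Y hYm hinvY
        _ ≤ volume (R ∩ D.iet^[i] '' D'.base) :=
            measure_mono fun y hy => ⟨Or.inr ⟨hy.1, fun h => h2 y h hy.2⟩, hy.2⟩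
    · calc m ≤ volume (X ∩ D'.base) := min_le_left _ _
        _ = volume (X ∩ D.iet^[i] '' D'.base) := himg X hX hinv
        _ ≤ volume (R ∩ D.iet^[i] '' D'.base) :=
            measure_mono fun y hy => ⟨Or.inl ⟨hy.1, fun h => h1 ⟨y, h, hy.2⟩⟩, hy.2⟩
  have hsum : (p : ENNReal) * m ≤ volume R := by
    calc (p : ENNReal) * m = ∑ i ∈ Finset.range p, m := by simp
      _ ≤ ∑ i ∈ Finset.range p, volume (R ∩ D.iet^[i] '' D'.base) :=
          Finset.sum_le_sum fun i hi => hfloor i (Finset.mem_range.1 hi)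
      _ = volume (⋃ i ∈ Finset.range p, R ∩ D.iet^[i] '' D'.base) := by
          rw [measure_biUnion_finset]
          · intro i hi j hj hij
            exact (H.disjoint_floors hlen hpq (Finset.mem_range.1 hi) (Finset.mem_range.1 hj)
              hij).mono inter_subset_right inter_subset_right
          · exact fun i _ => hRm.inter
              (D.volume_image_iterate hlen i D'.measurableSet_base).1
      _ ≤ volume R := measure_mono (iUnion₂_subset fun _ _ => inter_subset_left)
  have hRv : volume R ≤ a / 4 + a / 4 :=
    (measure_union_le _ _).trans (add_le_add hK₁v.le hK₂v.le)
  have hmin : min (volume X) (volume Y) ≤ ENNReal.ofReal (κ * D.total / D'.total) * m := by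
    rcases min_cases (volume (X ∩ D'.base)) (volume (Y ∩ D'.base)) with h | h
    · rw [hm, h.1]
      exact (min_le_left _ _).trans (H.volume_le_of_invariant hlen hX hXb hinv)
    · rw [hm, h.1]
      exact (min_le_right _ _).trans (H.volume_le_of_invariant hlen hYm sdiff_subset hinvY)
  -- There are at least δ |I| / |I'| disjoint floors, and m is at least |I'| / (κ |I|) times the
  -- smaller of the two volumes; the widths cancel.
  have hfinal : a ≤ a / 4 + a / 4 := by
    calc a ≤ ENNReal.ofReal (δ / κ) * (ENNReal.ofReal (κ * D.total / D'.total) * m) :=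
          mul_le_mul_right hmin _
      _ = ENNReal.ofReal (δ * D.total / D'.total) * m := by
          rw [← mul_assoc, ← ENNReal.ofReal_mul (div_pos hδ hκ).le]
          congr 2
          field_simp
      _ ≤ (p : ENNReal) * m := by
          refine mul_le_mul_left ?_ _
          rw [← ENNReal.ofReal_natCast]
          exact ENNReal.ofReal_le_ofReal (by rwa [div_le_iff₀ hl])
      _ ≤ _ := hsum.trans hRv
  have hlt : a / 4 + a / 4 < a := by
    clear_value a
    lift a to NNReal using hatop
    have : (0 : NNReal) < a := pos_iff_ne_zero.2 (by exact_mod_cast ha0)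
    have h4 : (a : ENNReal) / 4 = ((a / 4 : NNReal) : ENNReal) := by
      rw [ENNReal.coe_div (by norm_num)]; norm_num
    rw [h4]
    norm_cast
    rw [← NNReal.coe_lt_coe]
    have h5 : (0 : ℝ) < a := this
    push_cast
    linarith
  exact absurd hfinal (not_le.2 hlt)

/-! ### Points with small Birkhoff sums -/

/-- The points of the base at which the Birkhoff sums of the step function `h` are
`≤ C (m + 1) ^ θ`. -/
def smallSums (D : IETData 𝒜 n) (h : 𝒜 → ℝ) (θ : ℝ) (C : ℕ) : Set ℝ :=
  {x ∈ D.base | ∀ m : ℕ, |birkhoffSum D.iet (D.stepFun h) m x| ≤ C * ((m : ℝ) + 1) ^ θ}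

lemma measurableSet_smallSums (D : IETData 𝒜 n) (h : 𝒜 → ℝ) (θ : ℝ) (C : ℕ) :
    MeasurableSet (D.smallSums h θ C) := by
  have : D.smallSums h θ C = D.base ∩
      ⋂ m : ℕ, {x | |birkhoffSum D.iet (D.stepFun h) m x| ≤ C * ((m : ℝ) + 1) ^ θ} := by
    ext x; simp [smallSums]
  rw [this]
  refine D.measurableSet_base.inter (MeasurableSet.iInter fun m => ?_)
  exact measurableSet_le
    (continuous_abs.measurable.comp (D.measurable_birkhoffSum (D.measurable_stepFun h) m))
    measurable_const

/-- Moving the starting point by one step changes a sum by one value of h and its length by one.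
Both are absorbed by enlarging C, since m + 2 ≤ 2 (m + 1) costs at most the factor 2^θ. -/
lemma smallSums_invariant (D : IETData 𝒜 n) (hlen : ∀ α, 0 < D.len α) (h : 𝒜 → ℝ) {θ : ℝ}
    (hθ : 0 ≤ θ) {x : ℝ} (hx : x ∈ D.base) :
    D.iet x ∈ ⋃ C, D.smallSums h θ C ↔ x ∈ ⋃ C, D.smallSums h θ C := by
  have hv : 0 ≤ vecNorm h := Finset.sum_nonneg fun _ _ => abs_nonneg _
  have hf := D.abs_stepFun_le h x
  simp only [mem_iUnion, smallSums, mem_ofPred_eq]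
  constructor
  · rintro ⟨C, -, hC⟩
    refine ⟨C + ⌈vecNorm h⌉₊, hx, fun m => ?_⟩
    have hm1 : (1 : ℝ) ≤ ((m : ℝ) + 1) ^ θ :=
      Real.one_le_rpow (by linarith [Nat.cast_nonneg (α := ℝ) m]) hθ
    rcases m with _ | m
    · simp only [birkhoffSum_zero, abs_zero]; positivity
    · rw [birkhoffSum_succ']
      have h1 : (C : ℝ) * ((m : ℝ) + 1) ^ θ ≤ C * (((m + 1 : ℕ) : ℝ) + 1) ^ θ := by
        gcongr; linarith
      have h2 : vecNorm h ≤ (⌈vecNorm h⌉₊ : ℝ) * (((m + 1 : ℕ) : ℝ) + 1) ^ θ :=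
        (Nat.le_ceil _).trans (le_mul_of_one_le_right (Nat.cast_nonneg _) hm1)
      rw [Nat.cast_add, add_mul]
      exact (abs_add_le _ _).trans (by linarith [hC m])
  · rintro ⟨C, -, hC⟩
    refine ⟨C * ⌈(2 : ℝ) ^ θ⌉₊ + ⌈vecNorm h⌉₊, D.iet_mem_base hlen hx, fun m => ?_⟩
    have hm0 : (0 : ℝ) ≤ m := Nat.cast_nonneg m
    have hm1 : (1 : ℝ) ≤ ((m : ℝ) + 1) ^ θ := Real.one_le_rpow (by linarith) hθ
    have h1 : birkhoffSum D.iet (D.stepFun h) m (D.iet x) =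
        birkhoffSum D.iet (D.stepFun h) (m + 1) x - D.stepFun h x := by
      rw [birkhoffSum_succ']; ring
    have h2 : vecNorm h ≤ (⌈vecNorm h⌉₊ : ℝ) * ((m : ℝ) + 1) ^ θ :=
      (Nat.le_ceil _).trans (le_mul_of_one_le_right (Nat.cast_nonneg _) hm1)
    have h3 : (((m + 1 : ℕ) : ℝ) + 1) ^ θ ≤ ⌈(2 : ℝ) ^ θ⌉₊ * ((m : ℝ) + 1) ^ θ := by
      calc (((m + 1 : ℕ) : ℝ) + 1) ^ θ ≤ (2 * ((m : ℝ) + 1)) ^ θ := by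
            gcongr; push_cast; linarith
        _ = 2 ^ θ * ((m : ℝ) + 1) ^ θ := Real.mul_rpow (by norm_num) (by linarith)
        _ ≤ _ := by gcongr; exact Nat.le_ceil _
    have h4 : (C : ℝ) * (((m + 1 : ℕ) : ℝ) + 1) ^ θ ≤
        C * (⌈(2 : ℝ) ^ θ⌉₊ * ((m : ℝ) + 1) ^ θ) := by gcongr
    rw [h1]
    push_cast at h4 ⊢
    refine (abs_sub _ _).trans ?_
    have := hC (m + 1)
    push_cast at this
    linarith

/-- Almost no point has Birkhoff sums of order `m ^ θ` if there are balanced towers over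
which the sums of `h` are larger than that. -/
lemma volume_smallSums_eq_zero (D : IETData 𝒜 n) (hlen : ∀ α, 0 < D.len α) {δ κ : ℝ}
    (hδ : 0 < δ) (hκ : 0 < κ)
    (hseq : ∀ η > 0, ∃ (D' : IETData 𝒜 n) (B : Matrix 𝒜 𝒜 ℝ) (q : 𝒜 → ℕ),
      IsBalancedTower D D' B q δ κ ∧ D'.total < η)
    (h : 𝒜 → ℝ) {θ : ℝ} (hθ : 0 ≤ θ)
    (hbig : ∀ C : ℕ, ∃ (D' : IETData 𝒜 n) (B : Matrix 𝒜 𝒜 ℝ) (q : 𝒜 → ℕ),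
      IsBalancedTower D D' B q δ κ ∧ ∃ α, 2 * C * (2 * (q α : ℝ) + 1) ^ θ < |B.mulVec h α|) :
    volume (⋃ C, D.smallSums h θ C) = 0 := by
  have hXm : MeasurableSet (⋃ C, D.smallSums h θ C) :=
    MeasurableSet.iUnion fun C => D.measurableSet_smallSums h θ C
  have hXb : (⋃ C, D.smallSums h θ C) ⊆ D.base := iUnion_subset fun C x hx => hx.1
  rcases D.volume_eq_zero_of_invariant hlen hδ hκ hseq hXm hXb
    (fun x hx => D.smallSums_invariant hlen h hθ hx) with h0 | h0
  · exact h0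
  exfalso
  have hbfin : volume D.base ≠ ⊤ := by rw [volume_base]; exact ENNReal.ofReal_ne_top
  have hfull : volume (⋃ C, D.smallSums h θ C) = volume D.base := by
    rw [← measure_inter_add_sdiff D.base hXm, h0, add_zero, inter_eq_right.2 hXb]
  have hmono : Monotone fun C => D.smallSums h θ C := by
    intro C C' hCC' x hx
    refine ⟨hx.1, fun m => (hx.2 m).trans ?_⟩
    have : (C : ℝ) ≤ C' := by exact_mod_cast hCC'
    gcongr
  have htend := tendsto_measure_iUnion_atTop (μ := volume) hmono
  rw [hfull, volume_base] at htend
  have htot := D.total_pos hlen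
  have hη : 0 < δ / κ * D.total := mul_pos (div_pos hδ hκ) htot
  have hlt : ENNReal.ofReal (D.total - δ / κ * D.total) < ENNReal.ofReal D.total := by
    rw [ENNReal.ofReal_lt_ofReal_iff htot]; linarith
  -- If the union had full measure, one of the increasing sets would miss less than the proportion
  -- δ/κ of the base.
  obtain ⟨C, hC⟩ := (htend.eventually (lt_mem_nhds hlt)).exists
  obtain ⟨D', B, q, H, α, hα⟩ := hbig C
  obtain ⟨p, hpq, -, hp⟩ := H.exists_height
  -- The points that enter I'_α within the first p steps. No return to I' occurs before time p, so
  -- the preimages are disjoint, and their total measure p |I'_α| is at least δ |I| / κ.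
  set G := ⋃ i ∈ Finset.range p, D.iet^[i] ⁻¹' D'.interval α with hG
  have hGm : MeasurableSet G :=
    MeasurableSet.biUnion (Finset.range p).countable_toSet fun i _ =>
      (D.measurable_iet.iterate i) (D'.measurableSet_interval α)
  have hintb : D'.interval α ⊆ D.base :=
    (D'.interval_subset_base H.len_pos α).trans H.base_subset
  have hGv : ENNReal.ofReal (δ / κ * D.total) ≤ volume G := by
    rw [hG, measure_biUnion_finset]
    · rw [Finset.sum_congr rfl fun i _ => ((D.measurePreserving_iet hlen).iterate i).measure_preimage
        (D'.measurableSet_interval α).nullMeasurableSet, volume_interval]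
      rw [Finset.sum_const, Finset.card_range, nsmul_eq_mul, ← ENNReal.ofReal_natCast,
        ← ENNReal.ofReal_mul (Nat.cast_nonneg _)]
      refine ENNReal.ofReal_le_ofReal ?_
      have h1 := H.total_le α
      have h2 : (p : ℝ) * D'.total ≤ p * (κ * D'.len α) := by gcongr
      rw [div_mul_eq_mul_div, div_le_iff₀ hκ]
      linarith
    · have key : ∀ i j : ℕ, i < j → j < p →
          Disjoint (D.iet^[i] ⁻¹' D'.interval α) (D.iet^[j] ⁻¹' D'.interval α) := by
        intro i j hij hj
        rw [disjoint_left]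
        intro x hx hx'
        obtain ⟨e, rfl⟩ := Nat.exists_eq_add_of_lt hij
        have : D.iet^[e + 1] (D.iet^[i] x) ∈ D'.interval α := by
          rw [← Function.iterate_add_apply]
          have h' : e + 1 + i = i + e + 1 := by omega
          rw [h']
          exact hx'
        exact H.notMem_base α _ hx (e + 1) (Nat.succ_pos e)
          (lt_of_lt_of_le (by omega) (hpq α)) (D'.interval_subset_base H.len_pos α this)
      intro i hi j hj hij
      rcases hij.lt_or_gt with hlt | hlt
      · exact key i j hlt (Finset.mem_range.1 hj)
      · exact (key j i hlt (Finset.mem_range.1 hi)).symm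
    · exact fun i _ => (D.measurable_iet.iterate i) (D'.measurableSet_interval α)
  -- The sums to times i and i + q_α differ by the entry of B h at α. Both times are at most 2 q_α,
  -- so they cannot both be small.
  have hGdisj : Disjoint G (D.smallSums h θ C) := by
    rw [disjoint_left]
    intro x hx hx'
    simp only [hG, mem_iUnion, Finset.mem_range] at hx
    obtain ⟨i, hi, hxi⟩ := hx
    have hiq : (i : ℝ) ≤ q α := by exact_mod_cast (hi.le.trans (hpq α))
    have h1 := hx'.2 i
    have h2 := hx'.2 (i + q α)
    rw [birkhoffSum_add, H.sum_eq α _ hxi] at h2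
    have h3 : ((i : ℝ) + 1) ^ θ ≤ (2 * (q α : ℝ) + 1) ^ θ := by
      gcongr; linarith [Nat.cast_nonneg (α := ℝ) (q α)]
    have h4 : (((i + q α : ℕ) : ℝ) + 1) ^ θ ≤ (2 * (q α : ℝ) + 1) ^ θ := by
      gcongr; push_cast; linarith
    have h5 : |B.mulVec h α| ≤ C * (2 * (q α : ℝ) + 1) ^ θ + C * (2 * (q α : ℝ) + 1) ^ θ := by
      calc |B.mulVec h α| = |(birkhoffSum D.iet (D.stepFun h) i x + B.mulVec h α) -
            birkhoffSum D.iet (D.stepFun h) i x| := by ring_nf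
        _ ≤ _ := (abs_sub _ _).trans (add_le_add (h2.trans (by gcongr)) (h1.trans (by gcongr)))
    linarith
  have hGb : G ⊆ D.base := by
    intro x hx
    simp only [hG, mem_iUnion, Finset.mem_range] at hx
    obtain ⟨i, -, hxi⟩ := hx
    have : ∀ i, D.iet^[i] x ∈ D.base → x ∈ D.base := by
      intro i
      induction i with
      | zero => exact id
      | succ i ih =>
        rw [Function.iterate_succ_apply', D.iet_mem_base_iff hlen]
        exact ih
    exact this i (hintb hxi)
  have hunion : volume G + volume (D.smallSums h θ C) ≤ ENNReal.ofReal D.total := by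
    rw [← measure_union hGdisj (D.measurableSet_smallSums h θ C), ← volume_base]
    exact measure_mono (union_subset hGb fun x hx => hx.1)
  have : ENNReal.ofReal D.total < ENNReal.ofReal D.total := by
    calc ENNReal.ofReal D.total = ENNReal.ofReal (δ / κ * D.total + (D.total - δ / κ * D.total)) := by
          congr 1; ring
      _ ≤ ENNReal.ofReal (δ / κ * D.total) + ENNReal.ofReal (D.total - δ / κ * D.total) :=
          ENNReal.ofReal_add_le
      _ < ENNReal.ofReal (δ / κ * D.total) + volume (D.smallSums h θ C) :=
          ENNReal.add_lt_add_left ENNReal.ofReal_ne_top hC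
      _ ≤ volume G + volume (D.smallSums h θ C) := by gcongr
      _ ≤ _ := hunion
  exact lt_irrefl _ this

end IETData

/-! ### Norms -/

section Norms

variable {𝒜 : Type*} [Fintype 𝒜]

lemma vecNorm_nonneg (v : 𝒜 → ℝ) : 0 ≤ vecNorm v := Finset.sum_nonneg fun _ _ => abs_nonneg _

lemma vecNorm_add_le (u v : 𝒜 → ℝ) : vecNorm (u + v) ≤ vecNorm u + vecNorm v := by
  rw [vecNorm, vecNorm, vecNorm, ← Finset.sum_add_distrib]
  exact Finset.sum_le_sum fun α _ => abs_add_le _ _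

lemma vecNorm_neg (v : 𝒜 → ℝ) : vecNorm (-v) = vecNorm v := by simp [vecNorm]

lemma vecNorm_le_add (u v : 𝒜 → ℝ) : vecNorm u ≤ vecNorm (v + u) + vecNorm v := by
  have := vecNorm_add_le (v + u) (-v)
  rwa [vecNorm_neg, add_neg_cancel_comm] at this

lemma vecNorm_pos {v : 𝒜 → ℝ} (hv : v ≠ 0) : 0 < vecNorm v := by
  obtain ⟨α, hα⟩ := Function.ne_iff.1 hv
  exact Finset.sum_pos' (fun _ _ => abs_nonneg _) ⟨α, Finset.mem_univ _, abs_pos.2 hα⟩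

lemma exists_vecNorm_le [Nonempty 𝒜] (v : 𝒜 → ℝ) :
    ∃ α, vecNorm v ≤ Fintype.card 𝒜 * |v α| := by
  obtain ⟨α, -, hα⟩ := Finset.exists_max_image Finset.univ (fun α => |v α|)
    Finset.univ_nonempty
  refine ⟨α, ?_⟩
  calc vecNorm v ≤ ∑ _β : 𝒜, |v α| := Finset.sum_le_sum fun β hβ => hα β hβ
    _ = _ := by simp

lemma rowSum_le_matNorm {B : Matrix 𝒜 𝒜 ℝ} (α : 𝒜) : ∑ β, |B α β| ≤ matNorm B :=
  le_ciSup (f := fun α => ∑ β, |B α β|) (Set.finite_range _).bddAbove α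

end Norms

namespace IETData

variable {𝒜 : Type*} [Fintype 𝒜] [DecidableEq 𝒜] {n : ℕ}

/-! ### The towers of an accelerating sequence -/

lemma step_zero (D : IETData 𝒜 n) {M : ℕ → ℕ} (hM : IsAccelerating M) : D.step M 0 = D := by
  rw [step, hM.1]; rfl

lemma Q_zero_eq (D : IETData 𝒜 n) {M : ℕ → ℕ} (hM : IsAccelerating M) (k : ℕ) :
    D.Q M 0 k = (D.cocycle (M k)).transpose := by
  rw [Q, step_zero D hM, hM.1, Nat.sub_zero]

lemma Q_zero_zero (D : IETData 𝒜 n) {M : ℕ → ℕ} (hM : IsAccelerating M) :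
    D.Q M 0 0 = 1 := by
  rw [Q_zero_eq D hM, hM.1, cocycle, Matrix.transpose_one]

lemma iterate_rauzy_step (D : IETData 𝒜 n) {M : ℕ → ℕ} (hM : IsAccelerating M) (k : ℕ) :
    IETData.rauzy^[M (k + 1) - M k] (D.step M k) = D.step M (k + 1) := by
  rw [step, step, ← Function.iterate_add_apply,
    Nat.sub_add_cancel (hM.2.monotone (Nat.le_succ k))]

lemma Q_zero_succ (D : IETData 𝒜 n) {M : ℕ → ℕ} (hM : IsAccelerating M) (k : ℕ) :
    D.Q M 0 (k + 1) = D.Q M k (k + 1) * D.Q M 0 k := by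
  rw [Q_zero_eq D hM, Q_zero_eq D hM, Q, ← Matrix.transpose_mul, step, ← cocycle_add,
    Nat.add_sub_cancel' (hM.2.monotone (Nat.le_succ k))]

lemma Keane.step_len_pos {D : IETData 𝒜 n} (hK : D.Keane) (hlen : ∀ α, 0 < D.len α)
    (hn : n ≠ 0) (M : ℕ → ℕ) (k : ℕ) : ∀ α, 0 < (D.step M k).len α :=
  (hK.iterate hlen hn (M k)).2

lemma Keane.exists_isTower_Q {D : IETData 𝒜 n} (hK : D.Keane) (hlen : ∀ α, 0 < D.len α)
    (hn : n ≠ 0) {M : ℕ → ℕ} (hM : IsAccelerating M) (k : ℕ) :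
    ∃ q, IsTower D (D.step M k) (D.Q M 0 k) q := by
  rw [Q_zero_eq D hM]
  exact hK.cocycle_isTower hlen hn (M k)

lemma Keane.exists_isTower_Z {D : IETData 𝒜 n} (hK : D.Keane) (hlen : ∀ α, 0 < D.len α)
    (hn : n ≠ 0) {M : ℕ → ℕ} (hM : IsAccelerating M) (k : ℕ) :
    ∃ q, IsTower (D.step M k) (D.step M (k + 1)) (D.Q M k (k + 1)) q := by
  obtain ⟨hK', hlen'⟩ := hK.iterate hlen hn (M k)
  rw [← iterate_rauzy_step D hM]
  exact hK'.cocycle_isTower hlen' hn _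

lemma Q_nonneg (D : IETData 𝒜 n) (M : ℕ → ℕ) (k l : ℕ) (α β : 𝒜) : 0 ≤ D.Q M k l α β :=
  cocycle_nonneg _ _ _ _

lemma IsTower.height_le_matNorm {D D' : IETData 𝒜 n} {B : Matrix 𝒜 𝒜 ℝ} {q : 𝒜 → ℕ}
    (H : IsTower D D' B q) (hlen : ∀ α, 0 < D.len α) (hlen' : ∀ α, 0 < D'.len α) (α : 𝒜) :
    (q α : ℝ) ≤ matNorm B := by
  rw [H.height_eq hlen hlen']
  exact (Finset.sum_le_sum fun β _ => le_abs_self _).trans (rowSum_le_matNorm α)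

/-- Summing the coordinates of λ = A λ^(k) gives |I| as the sum over all letters of height times
width; one tower is at most the whole. -/
lemma Keane.height_mul_len_le {D : IETData 𝒜 n} (hK : D.Keane) (hlen : ∀ α, 0 < D.len α)
    (hn : n ≠ 0) {M : ℕ → ℕ} (hM : IsAccelerating M) {k : ℕ} {q : 𝒜 → ℕ}
    (H : IsTower D (D.step M k) (D.Q M 0 k) q) (α : 𝒜) :
    q α * (D.step M k).len α ≤ D.total := by
  have hlen' := hK.step_len_pos hlen hn M k
  have hsum : D.total = ∑ β, q β * (D.step M k).len β := by
    rw [total, ← hK.cocycle_mulVec hlen hn (M k)]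
    simp only [Matrix.mulVec, dotProduct]
    rw [Finset.sum_comm]
    refine Finset.sum_congr rfl fun β _ => ?_
    rw [H.height_eq hlen hlen', Q_zero_eq D hM, ← Finset.sum_mul]
    rfl
  rw [hsum]
  exact Finset.single_le_sum (f := fun β => (q β : ℝ) * (D.step M k).len β)
    (fun β _ => mul_nonneg (Nat.cast_nonneg _) (hlen' β).le) (Finset.mem_univ α)

/-- The towers of the acceleration in the Filtration Diophantine Condition. -/
lemma FDCEstimates.exists_towers {D : IETData 𝒜 n} {Λ : ℕ → ℝ} {E : ℤ → Submodule ℝ (𝒜 → ℝ)}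
    {τ c C κ : ℝ} {M r : ℕ → ℕ} {U : ℕ → Submodule ℝ (𝒜 → ℝ)}
    (hE : D.FDCEstimates Λ E τ c C κ M r U) (hκ : 1 ≤ κ) (hK : D.Keane)
    (hlen : ∀ α, 0 < D.len α) (hn : n ≠ 0) (hM : IsAccelerating M) :
    ∃ δ > 0, ∃ q : ℕ → 𝒜 → ℕ, (∀ k, IsTower D (D.step M k) (D.Q M 0 k) (q k)) ∧
      (∀ k, 1 ≤ k → IsBalancedTower D (D.step M k) (D.Q M 0 k) (q k) δ κ) ∧
      ∀ k, 1 ≤ k → ∀ α, δ / κ * matNorm (D.Q M 0 k) ≤ q k α := by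
  obtain ⟨δ, hδ, -, hp⟩ := hE.towers
  choose q hq using fun k => hK.exists_isTower_Q hlen hn hM k
  have hlen' := fun k => hK.step_len_pos hlen hn M k
  have hκ0 : 0 < κ := by linarith
  have hpos : ∀ k, 0 < (D.step M k).total := fun k => (D.step M k).total_pos (hlen' k)
  have hbal : ∀ k α, (D.step M k).total ≤ κ * (D.step M k).len α := fun k α =>
    (div_le_iff₀ (hlen' k α)).1 (hE.balanced k α)
  -- A tower fits into the base, and by balance its width is at least |I^(k)| / κ.
  have hmul : ∀ k α, q k α * (D.step M k).total ≤ κ * D.total := by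
    intro k α
    have h1 := hK.height_mul_len_le hlen hn hM (hq k) α
    have h2 : (q k α : ℝ) * (D.step M k).total ≤ q k α * (κ * (D.step M k).len α) := by
      gcongr; exact hbal k α
    have h3 : κ * (q k α * (D.step M k).len α) ≤ κ * D.total := by gcongr
    linarith
  have hheight : ∀ k, 1 ≤ k → ∃ p : ℕ, (∀ α, p ≤ q k α) ∧
      (∀ i < p, OrdConnected (D.iet^[i] '' (D.step M k).base)) ∧
      δ * D.total ≤ p * (D.step M k).total := by
    intro k hk
    obtain ⟨p, -, h1, h2, -, h4⟩ := hp k hk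
    refine ⟨p, fun α => ?_, h2, ?_⟩
    · have := h1 α
      rw [← (hq k).height_eq hlen (hlen' k)] at this
      exact_mod_cast this
    · have h5 := h4.trans (measure_biUnion_finset_le _ _)
      rw [Finset.sum_congr rfl fun i _ =>
        (D.volume_image_iterate hlen i (D.step M k).measurableSet_base).2, volume_base,
        Finset.sum_const, Finset.card_range, nsmul_eq_mul, ← ENNReal.ofReal_natCast,
        ← ENNReal.ofReal_mul (Nat.cast_nonneg _)] at h5
      exact (ENNReal.ofReal_le_ofReal_iff
        (mul_nonneg (Nat.cast_nonneg _) (hpos k).le)).1 h5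
  refine ⟨δ, hδ, q, hq, fun k hk => ⟨hq k, hlen' k, hbal k, hmul k, hheight k hk⟩, ?_⟩
  intro k hk α
  -- All heights are comparable: each is at least p ≥ δ |I| / |I^(k)| and at most κ |I| / |I^(k)|,
  -- and ‖Q(k)‖ is the largest of them.
  obtain ⟨p, h1, -, h2⟩ := hheight k hk
  have : Nonempty 𝒜 := ⟨D.lastTop⟩
  rw [div_mul_eq_mul_div, div_le_iff₀ hκ0, mul_comm, ← le_div_iff₀ hδ]
  refine ciSup_le fun β => ?_
  have h3 : ∑ γ, |D.Q M 0 k β γ| = q k β := by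
    rw [(hq k).height_eq hlen (hlen' k)]
    exact Finset.sum_congr rfl fun γ _ => abs_of_nonneg (D.Q_nonneg _ _ _ _ _)
  rw [h3, le_div_iff₀ hδ]
  have h4 := hmul k β
  have h5 : (p : ℝ) ≤ q k α := by exact_mod_cast h1 α
  have h6 : (p : ℝ) * (D.step M k).total ≤ q k α * (D.step M k).total := by
    have := (hpos k).le; gcongr
  have h7 : δ * (q k β * (D.step M k).total) ≤ δ * (κ * D.total) := by gcongr
  have h8 : κ * (δ * D.total) ≤ κ * (q k α * (D.step M k).total) :=
    mul_le_mul_of_nonneg_left (h2.trans h6) hκ0.le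
  have h9 : (q k β : ℝ) * δ * (D.step M k).total ≤ q k α * κ * (D.step M k).total := by linarith
  exact le_of_mul_le_mul_right h9 (hpos k)

/-! ### Growth of a vector along the acceleration -/

section Growth

variable {D : IETData 𝒜 n} {Λ : ℕ → ℝ} {E : ℤ → Submodule ℝ (𝒜 → ℝ)}
  {τ c C κ : ℝ} {M r : ℕ → ℕ} {U : ℕ → Submodule ℝ (𝒜 → ℝ)}

/-- The limit of r(0,k)/k is below 1 + τ, so only finitely many k can violate the linear bound; the
constant R pays for those. -/
lemma FDCEstimates.exists_sum_r_le (hE : D.FDCEstimates Λ E τ c C κ M r U) :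
    ∃ R : ℝ, 0 ≤ R ∧ ∀ k : ℕ, ∑ i ∈ Finset.Ico 0 k, (r i : ℝ) ≤ (1 + τ) * k + R := by
  obtain ⟨ρ, hρ1, hρ, ht⟩ := hE.r_growth
  obtain ⟨K, hK⟩ := eventually_atTop.1 (ht.eventually (gt_mem_nhds hρ))
  refine ⟨∑ i ∈ Finset.range (K + 1), (r i : ℝ), Finset.sum_nonneg fun _ _ => Nat.cast_nonneg _,
    fun k => ?_⟩
  rw [← Finset.range_eq_Ico]
  have h0 : (0 : ℝ) ≤ ∑ i ∈ Finset.range (K + 1), (r i : ℝ) :=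
    Finset.sum_nonneg fun _ _ => Nat.cast_nonneg _
  rcases le_total k (K + 1) with hk | hk
  · have : ∑ i ∈ Finset.range k, (r i : ℝ) ≤ ∑ i ∈ Finset.range (K + 1), (r i : ℝ) :=
      Finset.sum_le_sum_of_subset_of_nonneg (Finset.range_mono hk)
        fun _ _ _ => Nat.cast_nonneg _
    have h2 : 0 ≤ (1 + τ) * (k : ℝ) := mul_nonneg (by linarith) (Nat.cast_nonneg _)
    linarith
  · have h1 := hK k (by omega)
    have hk0 : (0 : ℝ) < k := by exact_mod_cast (by omega : 0 < k)
    rw [div_lt_iff₀ hk0] at h1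
    linarith

lemma FDCEstimates.eventually_le_sum_r (hE : D.FDCEstimates Λ E τ c C κ M r U) :
    ∀ᶠ k : ℕ in atTop, (k : ℝ) ≤ ∑ i ∈ Finset.Ico 0 k, (r i : ℝ) := by
  obtain ⟨ρ, hρ1, hρ, ht⟩ := hE.r_growth
  filter_upwards [ht.eventually (lt_mem_nhds hρ1), eventually_gt_atTop 0] with k hk hk0
  rw [lt_div_iff₀ (by exact_mod_cast hk0)] at hk
  rw [← Finset.range_eq_Ico]
  linarith

lemma mem_map_Q_zero (hM : IsAccelerating M) {V : Submodule ℝ (𝒜 → ℝ)} {v : 𝒜 → ℝ}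
    (hv : v ∈ V) : v ∈ V.map (Matrix.toLin' (D.Q M 0 0)) := by
  rw [Q_zero_zero D hM, Matrix.toLin'_one, Submodule.map_id]
  exact hv

/-- The growth on E_j is measured on the clock r(0,k), which is at most (1 + τ) k up to a constant.
Time k = 0 is separate because `norm_E` requires k < l. -/
lemma FDCEstimates.exists_growth_le (hE : D.FDCEstimates Λ E τ c C κ M r U) (hτ : 0 < τ)
    (hC : 1 ≤ C) (hM : IsAccelerating M) {j : ℕ} (hj1 : 1 ≤ j) (hj : j ≤ D.genus + 1)
    (hΛ : 0 ≤ Λ j) {h : 𝒜 → ℝ} (hh : h ∈ E (j : ℤ)) :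
    ∃ A > 0, ∀ k : ℕ, vecNorm ((D.Q M 0 k).mulVec h) ≤
      A * Real.exp ((Λ j + τ) * (1 + τ) * k) := by
  obtain ⟨R, hR0, hR⟩ := hE.exists_sum_r_le
  have hv := vecNorm_nonneg h
  have hCe : 1 ≤ C * Real.exp ((Λ j + τ) * R) :=
    one_le_mul_of_one_le_of_one_le hC (Real.one_le_exp (by positivity))
  refine ⟨C * Real.exp ((Λ j + τ) * R) * (vecNorm h + 1), by positivity, fun k => ?_⟩
  rcases Nat.eq_zero_or_pos k with rfl | hk
  · rw [Q_zero_zero D hM, Matrix.one_mulVec]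
    simp only [Nat.cast_zero, mul_zero, Real.exp_zero, mul_one]
    nlinarith
  · refine (hE.norm_E 0 k hk j hj1 hj h (mem_map_Q_zero hM hh)).trans ?_
    have h1 : Real.exp ((Λ j + τ) * ∑ i ∈ Finset.Ico 0 k, (r i : ℝ)) ≤
        Real.exp ((Λ j + τ) * R) * Real.exp ((Λ j + τ) * (1 + τ) * k) := by
      rw [← Real.exp_add]
      refine Real.exp_le_exp.2 ?_
      have := mul_le_mul_of_nonneg_left (hR k) (by linarith : 0 ≤ Λ j + τ)
      linarith
    calc C * Real.exp ((Λ j + τ) * ∑ i ∈ Finset.Ico 0 k, (r i : ℝ)) * vecNorm h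
        ≤ C * (Real.exp ((Λ j + τ) * R) * Real.exp ((Λ j + τ) * (1 + τ) * k)) *
          (vecNorm h + 1) := by
          gcongr; linarith
      _ = _ := by ring

/-- In the splitting h = e + u along E_{j+1} and U_{j+1} the part u is nonzero. It grows at rate at
least λ_j - τ, while e has rate at most λ_{j+1} + τ, so the gap makes u dominate. -/
lemma FDCEstimates.exists_growth_ge (hE : D.FDCEstimates Λ E τ c C κ M r U)
    (hC : 1 ≤ C) (hM : IsAccelerating M) (hU : D.IsComplementaryFiltration E U) {j : ℕ}
    (hj1 : 1 ≤ j) (hj : j ≤ D.genus) (hgap : Λ (j + 1) + τ < Λ j - τ) (hpos : 0 ≤ Λ j - τ)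
    {h : 𝒜 → ℝ} (hh : h ∉ E ((j : ℤ) + 1)) :
    ∃ A > 0, ∀ᶠ k : ℕ in atTop, A * Real.exp ((Λ j - τ) * k) ≤
      vecNorm ((D.Q M 0 k).mulVec h) := by
  have hcompl := hU.isCompl (j + 1) (by omega) (by omega)
  push_cast at hcompl
  have htop : h ∈ E ((j : ℤ) + 1) ⊔ U (j + 1) := by
    rw [hcompl.sup_eq_top]; exact Submodule.mem_top
  obtain ⟨e, he, u, hu, rfl⟩ := Submodule.mem_sup.1 htop
  have hu0 : u ≠ 0 := fun h0 => hh (by rw [h0, add_zero]; exact he)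
  have hup := vecNorm_pos hu0
  have hC0 : 0 < C := by linarith
  set s : ℕ → ℝ := fun k => ∑ i ∈ Finset.Ico 0 k, (r i : ℝ) with hs
  have hstend : Tendsto s atTop atTop :=
    tendsto_atTop_mono' _ hE.eventually_le_sum_r tendsto_natCast_atTop_atTop
  have hsmall : Tendsto (fun k => C * vecNorm e *
      Real.exp (-((Λ j - τ) - (Λ (j + 1) + τ)) * s k)) atTop (𝓝 (C * vecNorm e * 0)) := by
    refine Tendsto.const_mul _ (Real.tendsto_exp_atBot.comp ?_)
    exact hstend.const_mul_atTop_of_neg (by linarith)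
  rw [mul_zero] at hsmall
  refine ⟨C⁻¹ * vecNorm u / 2, by positivity, ?_⟩
  filter_upwards [hE.eventually_le_sum_r, eventually_gt_atTop 0,
    hsmall.eventually (gt_mem_nhds (by positivity : 0 < C⁻¹ * vecNorm u / 2))] with k hk hk0 hsm
  have h1 := hE.norm_E 0 k hk0 (j + 1) (by omega) (by omega) e
    (mem_map_Q_zero hM (by exact_mod_cast he))
  have h2 := hE.norm_U 0 k hk0 (j + 1) (by omega) (by omega) u (mem_map_Q_zero hM hu)
  rw [Nat.add_sub_cancel] at h2
  change _ ≤ C * Real.exp ((Λ (j + 1) + τ) * s k) * _ at h1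
  change _ ≤ C * Real.exp ((-Λ j + τ) * s k) * _ at h2
  have h3 : C⁻¹ * vecNorm u * Real.exp ((Λ j - τ) * s k) ≤ vecNorm ((D.Q M 0 k).mulVec u) := by
    calc C⁻¹ * vecNorm u * Real.exp ((Λ j - τ) * s k)
        ≤ C⁻¹ * (C * Real.exp ((-Λ j + τ) * s k) * vecNorm ((D.Q M 0 k).mulVec u)) *
          Real.exp ((Λ j - τ) * s k) := by gcongr
      _ = (C⁻¹ * C) * (Real.exp ((-Λ j + τ) * s k) * Real.exp ((Λ j - τ) * s k)) *
          vecNorm ((D.Q M 0 k).mulVec u) := by ring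
      _ = _ := by
          rw [← Real.exp_add, inv_mul_cancel₀ hC0.ne']
          ring_nf
          simp
  -- Eventually the slow part takes away at most half of the lower bound for the fast part.
  have h4 : vecNorm ((D.Q M 0 k).mulVec e) ≤
      C⁻¹ * vecNorm u / 2 * Real.exp ((Λ j - τ) * s k) := by
    calc vecNorm ((D.Q M 0 k).mulVec e) ≤ C * Real.exp ((Λ (j + 1) + τ) * s k) * vecNorm e := h1
      _ = C * vecNorm e * Real.exp (-((Λ j - τ) - (Λ (j + 1) + τ)) * s k) *
          Real.exp ((Λ j - τ) * s k) := by
          rw [mul_assoc (C * vecNorm e), ← Real.exp_add]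
          ring_nf
      _ ≤ _ := by gcongr
  have h5 := vecNorm_le_add ((D.Q M 0 k).mulVec u) ((D.Q M 0 k).mulVec e)
  rw [← Matrix.mulVec_add] at h5
  -- Eventually r(0,k) ≥ k, and the exponent λ_j - τ is nonnegative.
  have h6 : C⁻¹ * vecNorm u / 2 * Real.exp ((Λ j - τ) * k) ≤
      C⁻¹ * vecNorm u / 2 * Real.exp ((Λ j - τ) * s k) := by
    gcongr
  linarith

end Growth

/-! ### Positive growth and the Oseledets filtration -/

/-- The place of a vector with positive growth rate in the Oseledets filtration. -/
lemma IsOseledetsFiltration.exists_mem {D : IETData 𝒜 n} {N : ℕ → ℕ} {Λ : ℕ → ℝ}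
    {E : ℤ → Submodule ℝ (𝒜 → ℝ)} (hE : D.IsOseledetsFiltration N Λ E) {h : 𝒜 → ℝ} {lam : ℝ}
    (hlam : 0 < lam) (hgrowth : D.HasGrowthRate N h lam) :
    ∃ j : ℕ, 1 ≤ j ∧ j ≤ D.genus ∧ h ∈ E (j : ℤ) ∧ h ∉ E ((j : ℤ) + 1) ∧ Λ j = lam := by
  have huniq : ∀ ρ, D.HasGrowthRate N h ρ → ρ = lam := fun ρ hρ => tendsto_nhds_unique hρ hgrowth
  have hneg : ∀ i : ℕ, i ≤ D.genus → h ∉ E (-(i : ℤ)) := by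
    intro i
    induction i with
    | zero =>
      intro _ hmem
      rw [Nat.cast_zero, neg_zero, hE.bot_eq, Submodule.mem_bot] at hmem
      -- Here `Real.log 0 = 0`, so the zero vector has growth rate 0, which still differs from the
      -- positive rate of h.
      have : D.HasGrowthRate N h 0 := by simp [HasGrowthRate, hmem, vecNorm]
      exact hlam.ne (huniq 0 this)
    | succ i ih =>
      intro hi hmem
      have h1 : h ∉ E (-((i + 1 : ℕ) : ℤ) + 1) := by
        have : (-((i + 1 : ℕ) : ℤ) + 1) = -(i : ℤ) := by push_cast; ring
        rw [this]; exact ih (by omega)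
      have h2 := huniq _ (hE.neg_growth (i + 1) (by omega) hi h hmem h1)
      -- Exponents are nonnegative, by descent from Λ (g + 1) = 0; hence a rate -Λ i cannot be
      -- positive.
      have h3 : ∀ d : ℕ, d ≤ D.genus → 0 ≤ Λ (D.genus + 1 - d) := by
        intro d
        induction d with
        | zero => intro _; rw [Nat.sub_zero, hE.exponent_last]
        | succ d ihd =>
          intro hd
          have := hE.exponent_lt (D.genus + 1 - (d + 1)) (by omega) (by omega)
          have h4 : D.genus + 1 - (d + 1) + 1 = D.genus + 1 - d := by omega
          rw [h4] at this
          exact (ihd (by omega)).trans this.le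
      have h4 := h3 (D.genus - i) (by omega)
      have h5 : D.genus + 1 - (D.genus - i) = i + 1 := by omega
      rw [h5] at h4
      linarith
  have hlast : h ∉ E ((D.genus : ℤ) + 1) := fun hmem =>
    hlam.ne (huniq 0 (hE.cs_growth h hmem (hneg _ le_rfl)))
  by_contra! hcon
  -- If h never dropped out between E_j and E_{j+1}, it would descend from E_1 all the way to
  -- E_{g+1}, already excluded.
  have : ∀ j : ℕ, j ≤ D.genus → h ∈ E ((j : ℤ) + 1) := by
    intro j
    induction j with
    | zero => intro _; rw [Nat.cast_zero, zero_add, hE.top_eq]; exact Submodule.mem_top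
    | succ j ih =>
      intro hj
      by_contra hmem
      have h1 : h ∈ E ((j + 1 : ℕ) : ℤ) := by push_cast; exact ih (by omega)
      exact hcon (j + 1) (by omega) hj h1 hmem
        (huniq _ (hE.pos_growth (j + 1) (by omega) hj h h1 hmem))
  exact hlast (this _ le_rfl)

lemma IsOseledetsFiltration.le_exponent_one {D : IETData 𝒜 n} {N : ℕ → ℕ} {Λ : ℕ → ℝ}
    {E : ℤ → Submodule ℝ (𝒜 → ℝ)} (hE : D.IsOseledetsFiltration N Λ E) {j : ℕ} (hj1 : 1 ≤ j)
    (hj : j ≤ D.genus) : Λ j ≤ Λ 1 := by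
  induction j, hj1 using Nat.le_induction with
  | base => exact le_rfl
  | succ j hj1 ih => exact (hE.exponent_lt j hj1 (by omega)).le.trans (ih (by omega))

lemma genus_eq_zero_of_subsingleton (D : IETData 𝒜 n) (hn : n = 0) : D.genus = 0 := by
  subst hn
  have : D.omegaMat = 0 := by
    ext α β
    have : D.bot α = D.bot β := Subsingleton.elim (α := Fin 1) _ _
    simp [omegaMat, this]
  rw [genus, H, this, map_zero, LinearMap.range_zero, finrank_bot]

/-! ### Birkhoff sums of step functions -/

section Sums

variable {D : IETData 𝒜 n} {N : ℕ → ℕ} {Λ : ℕ → ℝ} {h : 𝒜 → ℝ} {lam : ℝ}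

/-- A positive rate requires genus at least one, but a single interval has Ω = 0. Rauzy induction
needs at least two intervals to be meaningful. -/
lemma FDC.ne_zero (hFDC : D.FDC N Λ) (hlam : 0 < lam) (hgrowth : D.HasGrowthRate N h lam) :
    n ≠ 0 := by
  obtain ⟨-, -, E, hO, -⟩ := hFDC
  obtain ⟨j, hj1, hj, -⟩ := hO.exists_mem hlam hgrowth
  intro hn
  have := D.genus_eq_zero_of_subsingleton hn
  omega

lemma FDC.le_exponent_one (hFDC : D.FDC N Λ) (hlam : 0 < lam)
    (hgrowth : D.HasGrowthRate N h lam) : lam ≤ Λ 1 := by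
  obtain ⟨-, -, E, hO, -⟩ := hFDC
  obtain ⟨j, hj1, hj, -, -, rfl⟩ := hO.exists_mem hlam hgrowth
  exact hO.le_exponent_one hj1 hj

/-- Upper bound for all the Birkhoff sums of a step function. -/
theorem FDC.exists_birkhoffSum_le (hFDC : D.FDC N Λ) (hlen : ∀ α, 0 < D.len α)
    (hlam : 0 < lam) (hgrowth : D.HasGrowthRate N h lam) {ρ : ℝ} (hρ : lam / Λ 1 < ρ) :
    ∃ A > 0, ∀ x ∈ D.base, ∀ m : ℕ,
      |birkhoffSum D.iet (D.stepFun h) m x| ≤ A * ((m : ℝ) + 1) ^ ρ := by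
  have hn := hFDC.ne_zero hlam hgrowth
  have hΛ1 : 0 < Λ 1 := hlam.trans_le (hFDC.le_exponent_one hlam hgrowth)
  obtain ⟨hK, -, E, hO, hτ⟩ := hFDC
  obtain ⟨j, hj1, hj, hjE, -, rfl⟩ := hO.exists_mem hlam hgrowth
  -- (λ_j + τ)(1 + τ) bounds the rate of ‖Q(k)h‖, and the extra τ pays for ‖Z(k+1)‖.
  obtain ⟨τ, hτ0, hτρ⟩ : ∃ τ > 0, (Λ j + τ) * (1 + τ) + τ < ρ * Λ 1 := by
    have hc : ContinuousAt (fun τ : ℝ => (Λ j + τ) * (1 + τ) + τ) 0 := by fun_prop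
    have h0 : (Λ j + 0) * (1 + 0) + 0 < ρ * Λ 1 := by
      rw [div_lt_iff₀ hΛ1] at hρ; linarith
    have := (hc.eventually_lt_const h0).filter_mono (nhdsWithin_le_nhds (s := Ioi 0))
    obtain ⟨τ, h1, h2⟩ := (this.and self_mem_nhdsWithin).exists
    exact ⟨τ, h2, h1⟩
  obtain ⟨c, C, κ, M, r, U, hc, hC, hκ, hM, -, hU, hE⟩ := hτ τ hτ0
  obtain ⟨δ, hδ, q, hq, -, hqge⟩ := hE.exists_towers hκ hK hlen hn hM
  obtain ⟨A₁, hA₁, hgr⟩ := hE.exists_growth_le hτ0 hC hM hj1 (by omega) hlam.le hjE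
  have hlen' := fun k => hK.step_len_pos hlen hn M k
  have hv := vecNorm_nonneg h
  set σ := (Λ j + τ) * (1 + τ) + τ with hσ
  have hσ0 : 0 < σ := by positivity
  have hC0 : 0 < C := by linarith
  -- The recursion W_{k+1} = W_k + C A₁ e^{σk} preserves W_k ≤ A e^{σk} once C A₁ ≤ A (e^σ - 1); as
  -- e^σ - 1 ≥ σ, the summand C A₁ / σ suffices. The first summand covers level 0.
  set A := matNorm (D.Q M 0 0) * vecNorm h + C * A₁ / σ + 1 with hA
  have hmat : 0 ≤ matNorm (D.Q M 0 0) :=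
    (Finset.sum_nonneg fun _ _ => abs_nonneg _).trans (rowSum_le_matNorm D.lastTop)
  have hA0 : 0 < A := by positivity
  have hpart : ∀ k : ℕ, IsTower.PartialBound D (D.step M k) (q k) h (A * Real.exp (σ * k)) := by
    intro k
    induction k with
    | zero =>
      intro α x hx i hi
      refine (D.abs_birkhoffSum_stepFun_le h i x).trans ?_
      have h1 : (i : ℝ) ≤ matNorm (D.Q M 0 0) :=
        (Nat.cast_le.2 hi).trans ((hq 0).height_le_matNorm hlen (hlen' 0) α)
      have h2 : (i : ℝ) * vecNorm h ≤ matNorm (D.Q M 0 0) * vecNorm h := by gcongr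
      have h3 : 0 ≤ C * A₁ / σ := by positivity
      simp only [Nat.cast_zero, mul_zero, Real.exp_zero, mul_one]
      linarith
    | succ k ih =>
      obtain ⟨q', hq'⟩ := hK.exists_isTower_Z hlen hn hM k
      have hq'' := hq (k + 1)
      rw [Q_zero_succ D hM] at hq''
      have hZ : ∀ α, (q' α : ℝ) ≤ C * Real.exp (τ * k) := fun α =>
        (hq'.height_le_matNorm (hlen' k) (hlen' (k + 1)) α).trans (hE.norm_Z k)
      have hb := (hq k).partialBound_trans hq' hq'' hlen (hlen' k) (hlen' (k + 1)) ih hZ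
      intro α x hx i hi
      refine (hb α x hx i hi).trans ?_
      have h1 : C * Real.exp (τ * k) * vecNorm ((D.Q M 0 k).mulVec h) ≤
          C * A₁ * Real.exp (σ * k) := by
        calc _ ≤ C * Real.exp (τ * k) * (A₁ * Real.exp ((Λ j + τ) * (1 + τ) * k)) := by
              gcongr; exact hgr k
          _ = C * A₁ * (Real.exp ((Λ j + τ) * (1 + τ) * k) * Real.exp (τ * k)) := by ring
          _ = _ := by rw [← Real.exp_add, hσ]; ring_nf
      have h2 : σ + 1 ≤ Real.exp σ := Real.add_one_le_exp σ
      have h3 : C * A₁ ≤ A * σ := by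
        have : C * A₁ / σ ≤ A := by
          have : 0 ≤ matNorm (D.Q M 0 0) * vecNorm h := by positivity
          linarith
        rwa [div_le_iff₀ hσ0] at this
      have h4 : Real.exp (σ * (k + 1 : ℕ)) = Real.exp (σ * k) * Real.exp σ := by
        rw [← Real.exp_add]; push_cast; ring_nf
      rw [h4]
      have h5 : A * Real.exp (σ * k) * (σ + 1) ≤ A * Real.exp (σ * k) * Real.exp σ := by gcongr
      have h6 : C * A₁ * Real.exp (σ * k) ≤ A * σ * Real.exp (σ * k) := by gcongr
      linarith
  -- Truncating at 1 keeps the logarithm defining the level t below nonnegative.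
  set c₁ := min 1 (δ / κ * c) with hc₁
  have hc₁0 : 0 < c₁ := lt_min one_pos (by positivity)
  have hqexp : ∀ k : ℕ, 1 ≤ k → ∀ α, c₁ * Real.exp (Λ 1 * k) ≤ q k α := by
    intro k hk α
    refine le_trans ?_ (hqge k hk α)
    calc c₁ * Real.exp (Λ 1 * k) ≤ δ / κ * c * Real.exp (Λ 1 * k) := by
          gcongr; exact min_le_right _ _
      _ = δ / κ * (c * Real.exp (Λ 1 * k)) := by ring
      _ ≤ _ := by gcongr; exact hE.norm_Q_lower k
  refine ⟨3 * A * Real.exp (2 * σ) * (c₁⁻¹) ^ (σ / Λ 1), by positivity, fun x hx m => ?_⟩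
  have hm1 : (1 : ℝ) ≤ (m : ℝ) + 1 := by linarith [Nat.cast_nonneg (α := ℝ) m]
  set t := Real.log (((m : ℝ) + 1) * c₁⁻¹) / Λ 1 with ht
  have harg : 1 ≤ ((m : ℝ) + 1) * c₁⁻¹ :=
    one_le_mul_of_one_le_of_one_le hm1 ((one_le_inv₀ hc₁0).2 (min_le_left _ _))
  have ht0 : 0 ≤ t := div_nonneg (Real.log_nonneg harg) hΛ1.le
  -- At level t the lower bound c₁ e^{λ₁t} for the heights reaches m + 1. The height bound is
  -- available only from level 1 on, hence the added 1; k ≤ t + 2 costs the factor e^{2σ}.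
  set k := ⌈t⌉₊ + 1 with hk
  have hk1 : t ≤ k := by rw [hk]; push_cast; linarith [Nat.le_ceil t]
  have hk2 : (k : ℝ) ≤ t + 2 := by rw [hk]; push_cast; linarith [Nat.ceil_lt_add_one ht0]
  have hmq : ∀ α, m ≤ q k α := by
    intro α
    have h1 := hqexp k (by omega) α
    have h2 : ((m : ℝ) + 1) * c₁⁻¹ ≤ Real.exp (Λ 1 * k) := by
      rw [← Real.log_le_iff_le_exp (by linarith)]
      rw [ht, div_le_iff₀ hΛ1] at hk1
      linarith
    have h3 : c₁ * (((m : ℝ) + 1) * c₁⁻¹) ≤ c₁ * Real.exp (Λ 1 * k) := by gcongr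
    have h4 : c₁ * (((m : ℝ) + 1) * c₁⁻¹) = m + 1 := by field_simp
    have h5 : (m : ℝ) ≤ q k α := by linarith
    exact_mod_cast h5
  refine ((hq k).abs_birkhoffSum_le (hlen' k) (hpart k) hmq hx).trans ?_
  have h1 : Real.exp (σ * k) ≤ Real.exp (2 * σ) * ((((m : ℝ) + 1) * c₁⁻¹) ^ (σ / Λ 1)) := by
    rw [Real.rpow_def_of_pos (by linarith), ← Real.exp_add]
    refine Real.exp_le_exp.2 ?_
    have : Real.log (((m : ℝ) + 1) * c₁⁻¹) * (σ / Λ 1) = σ * t := by rw [ht]; ring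
    rw [this]
    nlinarith
  have h2 : ((m : ℝ) + 1) ^ (σ / Λ 1) ≤ ((m : ℝ) + 1) ^ ρ :=
    Real.rpow_le_rpow_of_exponent_le hm1 ((div_le_iff₀ hΛ1).2 hτρ.le)
  rw [Real.mul_rpow (by linarith) (by positivity)] at h1
  calc 3 * (A * Real.exp (σ * k)) ≤
      3 * (A * (Real.exp (2 * σ) * (((m : ℝ) + 1) ^ (σ / Λ 1) * c₁⁻¹ ^ (σ / Λ 1)))) := by gcongr
    _ ≤ 3 * (A * (Real.exp (2 * σ) * (((m : ℝ) + 1) ^ ρ * c₁⁻¹ ^ (σ / Λ 1)))) := by gcongr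
    _ = _ := by ring

/-- The Birkhoff sums of a step function at almost every point are not bounded by a smaller
power. -/
theorem FDC.volume_smallSums_eq_zero (hFDC : D.FDC N Λ) (hlen : ∀ α, 0 < D.len α)
    (hlam : 0 < lam) (hgrowth : D.HasGrowthRate N h lam) {θ : ℝ} (hθ0 : 0 ≤ θ)
    (hθ : θ < lam / Λ 1) : volume (⋃ C, D.smallSums h θ C) = 0 := by
  have hn := hFDC.ne_zero hlam hgrowth
  have hΛ1 : 0 < Λ 1 := hlam.trans_le (hFDC.le_exponent_one hlam hgrowth)
  obtain ⟨hK, -, E, hO, hτ⟩ := hFDC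
  obtain ⟨j, hj1, hj, hjE, hjE', rfl⟩ := hO.exists_mem hlam hgrowth
  -- The tower sums, of rate at least λ_j - τ, must outgrow the θ-th power of the heights, of rate
  -- at most λ₁(1 + τ); the other two conditions are those of `exists_growth_ge`.
  obtain ⟨τ, hτ0, hτ1, hτ2, hτ3⟩ : ∃ τ > 0, θ * Λ 1 * (1 + τ) < Λ j - τ ∧
      Λ (j + 1) + τ < Λ j - τ ∧ 0 < Λ j - τ := by
    have e1 : ∀ᶠ τ in 𝓝 (0 : ℝ), θ * Λ 1 * (1 + τ) < Λ j - τ := by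
      refine ContinuousAt.eventually_lt (by fun_prop) (by fun_prop) ?_
      rw [lt_div_iff₀ hΛ1] at hθ; linarith
    have e2 : ∀ᶠ τ in 𝓝 (0 : ℝ), Λ (j + 1) + τ < Λ j - τ := by
      refine ContinuousAt.eventually_lt (by fun_prop) (by fun_prop) ?_
      have := hO.exponent_lt j hj1 hj
      linarith
    have e3 : ∀ᶠ τ in 𝓝 (0 : ℝ), 0 < Λ j - τ := by
      refine ContinuousAt.eventually_lt (by fun_prop) (by fun_prop) ?_
      linarith
    have := (e1.and (e2.and e3)).filter_mono (nhdsWithin_le_nhds (s := Ioi 0))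
    obtain ⟨τ, ⟨h1, h2, h3⟩, h4⟩ := (this.and self_mem_nhdsWithin).exists
    exact ⟨τ, h4, h1, h2, h3⟩
  obtain ⟨c, C, κ, M, r, U, hc, hC, hκ, hM, -, hU, hE⟩ := hτ τ hτ0
  obtain ⟨δ, hδ, q, hq, hbal, hqge⟩ := hE.exists_towers hκ hK hlen hn hM
  obtain ⟨A, hA, hgr⟩ := hE.exists_growth_ge hC hM hU hj1 hj hτ2 hτ3.le hjE'
  have hlen' := fun k => hK.step_len_pos hlen hn M k
  have hκ0 : 0 < κ := by linarith
  have hC0 : 0 < C := by linarith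
  have htot := D.total_pos hlen
  have hexp : ∀ b : ℝ, 0 < b → Tendsto (fun k : ℕ => Real.exp (b * k)) atTop atTop := fun b hb =>
    Real.tendsto_exp_atTop.comp (tendsto_natCast_atTop_atTop.const_mul_atTop hb)
  refine D.volume_smallSums_eq_zero hlen hδ hκ0 ?_ h hθ0 ?_
  · intro η hη
    -- Heights grow at least like e^{λ₁k} and height times width stays below κ |I|, so the bases
    -- shrink to zero.
    obtain ⟨k, hk, hk1⟩ := (((hexp _ hΛ1).eventually_gt_atTop
      (κ * D.total / (δ / κ * c * η))).and (eventually_ge_atTop 1)).exists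
    refine ⟨_, _, _, hbal k hk1, ?_⟩
    rw [div_lt_iff₀ (by positivity)] at hk
    have h1 := (hbal k hk1).height_mul_le D.lastTop
    have h2 := hqge k hk1 D.lastTop
    have h3 := hE.norm_Q_lower k
    have hl := (D.step M k).total_pos (hlen' k)
    by_contra! hcon
    have h4 : Real.exp (Λ 1 * k) * (δ / κ * c * η) ≤ q k D.lastTop * (D.step M k).total := by
      calc Real.exp (Λ 1 * k) * (δ / κ * c * η) = δ / κ * (c * Real.exp (Λ 1 * k)) * η := by ring
        _ ≤ δ / κ * matNorm (D.Q M 0 k) * η := by gcongr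
        _ ≤ q k D.lastTop * η := by gcongr
        _ ≤ _ := by gcongr
    linarith
  · intro C₀
    have : Nonempty 𝒜 := ⟨D.lastTop⟩
    have hd : (0 : ℝ) < Fintype.card 𝒜 := by exact_mod_cast Fintype.card_pos
    obtain ⟨k, ⟨hk, hk1⟩, hk2⟩ := (((hexp (Λ j - τ - θ * Λ 1 * (1 + τ))
      (by linarith)).eventually_gt_atTop
      (2 * C₀ * (2 * C + 1) ^ θ * Fintype.card 𝒜 / A)).and (eventually_ge_atTop 1)).and hgr |>.exists
    obtain ⟨α, hα⟩ := exists_vecNorm_le ((D.Q M 0 k).mulVec h)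
    refine ⟨_, _, _, hbal k hk1, α, ?_⟩
    rw [div_lt_iff₀ hA] at hk
    have hqC : (q k α : ℝ) ≤ C * Real.exp (Λ 1 * (1 + τ) * k) :=
      ((hq k).height_le_matNorm hlen (hlen' k) α).trans (hE.norm_Q_upper k)
    have h1 : (2 * (q k α : ℝ) + 1) ^ θ ≤
        (2 * C + 1) ^ θ * Real.exp (θ * Λ 1 * (1 + τ) * k) := by
      have h2 : 1 ≤ Real.exp (Λ 1 * (1 + τ) * k) := Real.one_le_exp (by positivity)
      calc (2 * (q k α : ℝ) + 1) ^ θ ≤ ((2 * C + 1) * Real.exp (Λ 1 * (1 + τ) * k)) ^ θ := by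
            gcongr; linarith
        _ = (2 * C + 1) ^ θ * Real.exp (Λ 1 * (1 + τ) * k) ^ θ :=
            Real.mul_rpow (by positivity) (by positivity)
        _ = _ := by rw [← Real.exp_mul]; ring_nf
    have h3 : Real.exp ((Λ j - τ - θ * Λ 1 * (1 + τ)) * k) * Real.exp (θ * Λ 1 * (1 + τ) * k) =
        Real.exp ((Λ j - τ) * k) := by
      rw [← Real.exp_add]; ring_nf
    have h4 : (2 * C₀ * (2 * C + 1) ^ θ * Fintype.card 𝒜) * Real.exp (θ * Λ 1 * (1 + τ) * k) <
        A * Real.exp ((Λ j - τ) * k) := by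
      rw [← h3]
      have := mul_lt_mul_of_pos_right hk (Real.exp_pos (θ * Λ 1 * (1 + τ) * k))
      linarith
    have h5 : Fintype.card 𝒜 * (2 * C₀ * (2 * (q k α : ℝ) + 1) ^ θ) <
        Fintype.card 𝒜 * |(D.Q M 0 k).mulVec h α| := by
      calc Fintype.card 𝒜 * (2 * C₀ * (2 * (q k α : ℝ) + 1) ^ θ) ≤
            Fintype.card 𝒜 * (2 * C₀ * ((2 * C + 1) ^ θ * Real.exp (θ * Λ 1 * (1 + τ) * k))) := by
              gcongr
        _ = (2 * C₀ * (2 * C + 1) ^ θ * Fintype.card 𝒜) * Real.exp (θ * Λ 1 * (1 + τ) * k) := by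
              ring
        _ < _ := h4
        _ ≤ _ := hk2
        _ ≤ _ := hα
    exact lt_of_mul_lt_mul_left h5 hd.le

end Sums

/-! ### The roof function -/

lemma left_lt_right (D : IETData 𝒜 n) (hlen : ∀ α, 0 < D.len α) (α : 𝒜) :
    D.left α < D.right α := by
  rw [right_eq]; linarith [hlen α]

/-- On each exchanged interval g is continuous except possibly at the left end, whose value is
arbitrary and is added separately. Nothing is known about g outside the base, hence the indicator.
-/
lemma PaG.measurable_indicator {D : IETData 𝒜 n} (hlen : ∀ α, 0 < D.len α) {a : ℝ} {g : ℝ → ℝ}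
    (hg : D.PaG a g) : Measurable (D.base.indicator g) := by
  have hpiece : ∀ α, Measurable ((D.interval α).indicator g) := by
    intro α
    have h1 : Measurable ((Ioo (D.left α) (D.right α)).indicator g) := by
      classical
      have := (hg.1 α).continuousOn.measurable_piecewise (g := fun _ => (0 : ℝ))
        continuousOn_const measurableSet_Ioo
      rw [← piecewise_eq_indicator]
      exact this
    have h2 : Measurable (({D.left α} : Set ℝ).indicator fun _ => g (D.left α)) :=
      measurable_const.indicator (measurableSet_singleton _)
    have h3 : (D.interval α).indicator g = (Ioo (D.left α) (D.right α)).indicator g +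
        ({D.left α} : Set ℝ).indicator fun _ => g (D.left α) := by
      ext x
      by_cases hx : x = D.left α
      · subst hx
        simp [indicator, D.left_mem_interval hlen α]
      · by_cases hx' : x ∈ Ioo (D.left α) (D.right α)
        · have : x ∈ D.interval α := ⟨hx'.1.le, hx'.2⟩
          simp [indicator, hx, hx', this]
        · have : x ∉ D.interval α := fun h => hx' ⟨lt_of_le_of_ne h.1 (Ne.symm hx), h.2⟩
          simp [indicator, hx, hx', this]
    rw [h3]
    exact h1.add h2
  have : D.base.indicator g = fun x => ∑ α, (D.interval α).indicator g x := by
    ext x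
    by_cases hx : x ∈ D.base
    · obtain ⟨α, hα⟩ := D.exists_mem_interval hx
      rw [Finset.sum_eq_single α, indicator_of_mem hx, indicator_of_mem hα]
      · intro β _ hβ
        exact indicator_of_notMem (fun h => hβ (D.eq_of_mem_interval hlen h hα)) _
      · simp
    · rw [indicator_of_notMem hx, Finset.sum_eq_zero]
      exact fun α _ => indicator_of_notMem (fun h => hx (D.interval_subset_base hlen α h)) _
  rw [this]
  exact Finset.measurable_sum _ fun α _ => hpiece α

/-- A function on `(l, m]` whose derivative is at least `- B (x - l) ^ (-(1 + a))` is
`O((x - l) ^ (-a))` from above. -/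
lemma le_of_deriv_mul_rpow_ge {g : ℝ → ℝ} {l m r a B : ℝ} (ha : 0 < a) (hmr : m < r)
    (hg : DifferentiableOn ℝ g (Ioo l r))
    (hB : ∀ x ∈ Ioc l m, -B ≤ deriv g x * (x - l) ^ (1 + a)) {x : ℝ} (hx : x ∈ Ioc l m) :
    g x ≤ g m - B / a * (m - l) ^ (-a) + B / a * (x - l) ^ (-a) := by
  -- The subtracted term makes the derivative of u equal to g'(y) + B (y - l)^(-1-a), which is
  -- nonnegative by hypothesis; u(x) ≤ u(m) is the claim.
  set u : ℝ → ℝ := fun y => g y - B / a * (y - l) ^ (-a) with hu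
  have hd : ∀ y ∈ Ioc l m, HasDerivAt u (deriv g y + B * (y - l) ^ (-a - 1)) y := by
    intro y hy
    have h1 : HasDerivAt g (deriv g y) y :=
      (hg.differentiableAt (Ioo_mem_nhds hy.1 (hy.2.trans_lt hmr))).hasDerivAt
    have h2 : HasDerivAt (fun y : ℝ => (y - l) ^ (-a)) (1 * (-a) * (y - l) ^ (-a - 1)) y :=
      ((hasDerivAt_id y).sub_const l).rpow_const (Or.inl (sub_pos.2 hy.1).ne')
    refine (h1.sub (h2.const_mul (B / a))).congr_deriv ?_
    have : B / a * (1 * -a * (y - l) ^ (-a - 1)) = - (B / a * a) * (y - l) ^ (-a - 1) := by ring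
    rw [this, div_mul_cancel₀ _ ha.ne']
    ring
  have hnn : ∀ y ∈ Ioc l m, 0 ≤ deriv g y + B * (y - l) ^ (-a - 1) := by
    intro y hy
    have hpos : 0 < y - l := sub_pos.2 hy.1
    have h1 := hB y hy
    have h2 : (y - l) ^ (-a - 1) * (y - l) ^ (1 + a) = 1 := by
      rw [← Real.rpow_add hpos]; ring_nf; simp
    have h3 : 0 < (y - l) ^ (1 + a) := Real.rpow_pos_of_pos hpos _
    have h4 : 0 ≤ (deriv g y + B * (y - l) ^ (-a - 1)) * (y - l) ^ (1 + a) := by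
      rw [add_mul, mul_assoc, h2]; linarith
    exact nonneg_of_mul_nonneg_left h4 h3
  have hmono : MonotoneOn u (Ioc l m) := by
    refine monotoneOn_of_deriv_nonneg (convex_Ioc l m)
      (fun y hy => (hd y hy).continuousAt.continuousWithinAt) ?_ ?_
    · intro y hy
      exact (hd y (interior_subset hy)).differentiableAt.differentiableWithinAt
    · intro y hy
      rw [(hd y (interior_subset hy)).deriv]
      exact hnn y (interior_subset hy)
  have := hmono hx ⟨hx.1.trans_le hx.2, le_rfl⟩ hx.2
  simp only [hu] at this
  linarith

/-- The roof is bounded above by an integrable function on each exchanged interval. -/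
lemma PaG.exists_le {D : IETData 𝒜 n} (hlen : ∀ α, 0 < D.len α) {a : ℝ} {g : ℝ → ℝ}
    (ha : 0 < a) (hg : D.PaG a g) (α : 𝒜) :
    ∃ A B : ℝ, ∀ x ∈ Ioo (D.left α) (D.right α),
      g x ≤ A + B * (x - D.left α) ^ (-a) + B * (D.right α - x) ^ (-a) := by
  obtain ⟨hC1, ⟨B, hB⟩, -⟩ := hg
  set l := D.left α with hl
  set r := D.right α with hr
  set m := D.mid α with hm
  have hm' : m = (l + r) / 2 := rfl
  have hlr : l < r := D.left_lt_right hlen α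
  have hdiff : DifferentiableOn ℝ g (Ioo l r) := (hC1 α).differentiableOn one_ne_zero
  have hB0 : 0 ≤ B := (abs_nonneg _).trans ((hB α).1 m ⟨by linarith, le_rfl⟩)
  have hBa : 0 ≤ B / a := div_nonneg hB0 ha.le
  refine ⟨g m, B / a, fun x hx => ?_⟩
  have hp1 : 0 ≤ B / a * (x - l) ^ (-a) := mul_nonneg hBa (Real.rpow_nonneg (by linarith [hx.1]) _)
  have hp2 : 0 ≤ B / a * (r - x) ^ (-a) := mul_nonneg hBa (Real.rpow_nonneg (by linarith [hx.2]) _)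
  rcases le_total x m with h | h
  · have h1 := le_of_deriv_mul_rpow_ge (B := B) ha (by linarith) hdiff
      (fun y hy => (abs_le.1 ((hB α).1 y hy)).1) ⟨hx.1, h⟩
    have : 0 ≤ B / a * (m - l) ^ (-a) := mul_nonneg hBa (Real.rpow_nonneg (by linarith) _)
    linarith
  -- The right half is the left half reflected by y ↦ -y.
  · have hdiff' : DifferentiableOn ℝ (fun y => g (-y)) (Ioo (-r) (-l)) := by
      refine hdiff.comp differentiable_neg.differentiableOn ?_
      intro y hy
      exact ⟨by linarith [hy.2], by linarith [hy.1]⟩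
    have h1 := le_of_deriv_mul_rpow_ge (g := fun y => g (-y)) (l := -r) (m := -m) (r := -l)
      (B := B) (x := -x) ha (by linarith) hdiff' ?_ ⟨by linarith [hx.2], by linarith⟩
    · have : 0 ≤ B / a * (-m - -r) ^ (-a) := mul_nonneg hBa (Real.rpow_nonneg (by linarith) _)
      have h2 : -x - -r = r - x := by ring
      rw [h2] at h1
      simp only [neg_neg] at h1
      linarith
    · intro y hy
      have h2 := (abs_le.1 ((hB α).2 (-y) ⟨by linarith [hy.2], by linarith [hy.1]⟩)).2
      rw [deriv_comp_neg]
      have h3 : y - -r = r - -y := by ring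
      rw [h3]
      linarith

/-- The powers with exponent -a > -1 are integrable at the end points, and nonnegativity turns the
one-sided bound `PaG.exists_le` into domination. -/
lemma PaG.integrableOn {D : IETData 𝒜 n} (hlen : ∀ α, 0 < D.len α) {a : ℝ} {g : ℝ → ℝ}
    (ha : 0 < a) (ha1 : a < 1) (hg : D.PaG a g) (hgpos : ∀ x ∈ D.base, 0 ≤ g x) :
    IntegrableOn g D.base := by
  rw [D.base_eq_iUnion hlen]
  refine (integrableOn_finite_iUnion).2 fun α => ?_
  have hlr := (D.left_lt_right hlen α).le
  rw [interval, integrableOn_Ico_iff_integrableOn_Ioo]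
  obtain ⟨A, B, hAB⟩ := hg.exists_le hlen ha α
  have hi : IntegrableOn (fun x => A + B * (x - D.left α) ^ (-a) +
      B * (D.right α - x) ^ (-a)) (Ioo (D.left α) (D.right α)) := by
    rw [← integrableOn_Ioc_iff_integrableOn_Ioo, ← intervalIntegrable_iff_integrableOn_Ioc_of_le hlr]
    have h1 : IntervalIntegrable (fun x : ℝ => (x - D.left α) ^ (-a)) volume
        (D.left α) (D.right α) := by
      have := (intervalIntegral.intervalIntegrable_rpow' (a := 0) (b := D.right α - D.left α)
        (by linarith : -1 < -a)).comp_sub_right (D.left α)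
      simpa using this
    have h2 : IntervalIntegrable (fun x : ℝ => (D.right α - x) ^ (-a)) volume
        (D.left α) (D.right α) := by
      have := (intervalIntegral.intervalIntegrable_rpow' (a := 0) (b := D.right α - D.left α)
        (by linarith : -1 < -a)).comp_sub_left (D.right α)
      simpa using this.symm
    exact (intervalIntegrable_const.add (h1.const_mul B)).add (h2.const_mul B)
  refine hi.mono' ((hg.1 α).continuousOn.aestronglyMeasurable measurableSet_Ioo) ?_
  refine (ae_restrict_iff' measurableSet_Ioo).2 (Eventually.of_forall fun x hx => ?_)
  rw [Real.norm_of_nonneg (hgpos x (D.interval_subset_base hlen α ⟨hx.1.le, hx.2⟩))]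
  exact hAB x hx

/-! ### Birkhoff sums of the roof -/

/-- The Birkhoff sums of an integrable nonnegative function grow at most like `m ^ (1 + ε)` almost
everywhere. -/
lemma ae_exists_birkhoffSum_le (D : IETData 𝒜 n) (hlen : ∀ α, 0 < D.len α) {G : ℝ → ℝ}
    (hG : Measurable G) (hG0 : ∀ x, 0 ≤ G x) (hGi : Integrable G) {b : ℝ} (hb : 1 < b) :
    ∀ᵐ x, ∃ A > 0, ∀ m : ℕ, birkhoffSum D.iet G m x ≤ A * ((m : ℝ) + 1) ^ b := by
  -- Since b > 1 these weights are summable. By invariance of the measure the weighted sum of G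
  -- along the orbit has finite integral, so it is finite almost everywhere, and (m + 1)^b times it
  -- dominates the first m terms of G.
  set w : ℕ → ℝ := fun i => 1 / ((i : ℝ) + 1) ^ b with hw
  have hw0 : ∀ i, 0 < w i := fun i => by simp only [hw]; positivity
  have hws : Summable w := by
    have := (Real.summable_one_div_nat_rpow (p := b)).2 hb
    have h2 := (summable_nat_add_iff 1).2 this
    simpa [hw] using h2
  have hmeas : ∀ i, Measurable fun x => ENNReal.ofReal (w i * G (D.iet^[i] x)) := fun i =>
    ((hG.comp (D.measurable_iet.iterate i)).const_mul _).ennreal_ofReal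
  have hint : ∀ i, ∫⁻ x, ENNReal.ofReal (w i * G (D.iet^[i] x)) =
      ENNReal.ofReal (w i) * ∫⁻ x, ENNReal.ofReal (G x) := by
    intro i
    simp_rw [ENNReal.ofReal_mul (hw0 i).le]
    have hm : Measurable fun x => ENNReal.ofReal (G (D.iet^[i] x)) :=
      (hG.comp (D.measurable_iet.iterate i)).ennreal_ofReal
    rw [lintegral_const_mul _ hm]
    congr 1
    exact ((D.measurePreserving_iet hlen).iterate i).lintegral_comp hG.ennreal_ofReal
  have hfin : ∫⁻ x, ∑' i, ENNReal.ofReal (w i * G (D.iet^[i] x)) ≠ ⊤ := by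
    rw [lintegral_tsum fun i => (hmeas i).aemeasurable]
    simp_rw [hint]
    rw [ENNReal.tsum_mul_right, ← ENNReal.ofReal_tsum_of_nonneg (fun i => (hw0 i).le) hws]
    refine ENNReal.mul_ne_top ENNReal.ofReal_ne_top ?_
    have := hGi.lintegral_lt_top
    exact this.ne
  filter_upwards [ae_lt_top (Measurable.tsum hmeas) hfin] with x hx
  set S := ∑' i, ENNReal.ofReal (w i * G (D.iet^[i] x)) with hS
  refine ⟨S.toReal + 1, by positivity, fun m => ?_⟩
  have hpart : ∑ i ∈ Finset.range m, w i * G (D.iet^[i] x) ≤ S.toReal := by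
    have h1 : ∑ i ∈ Finset.range m, ENNReal.ofReal (w i * G (D.iet^[i] x)) ≤ S :=
      ENNReal.sum_le_tsum _
    rw [← ENNReal.ofReal_sum_of_nonneg fun i _ => mul_nonneg (hw0 i).le (hG0 _)] at h1
    exact (ENNReal.ofReal_le_iff_le_toReal hx.ne).1 h1
  have hm : 0 < ((m : ℝ) + 1) ^ b := by positivity
  calc birkhoffSum D.iet G m x = ∑ i ∈ Finset.range m, G (D.iet^[i] x) := rfl
    _ ≤ ∑ i ∈ Finset.range m, ((m : ℝ) + 1) ^ b * (w i * G (D.iet^[i] x)) := by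
        refine Finset.sum_le_sum fun i hi => ?_
        rw [← mul_assoc]
        refine le_mul_of_one_le_left (hG0 _) ?_
        simp only [hw, mul_one_div]
        rw [one_le_div (by positivity)]
        have : (i : ℝ) ≤ m := by exact_mod_cast (Finset.mem_range.1 hi).le
        gcongr
    _ = ((m : ℝ) + 1) ^ b * ∑ i ∈ Finset.range m, w i * G (D.iet^[i] x) := by
        rw [Finset.mul_sum]
    _ ≤ ((m : ℝ) + 1) ^ b * (S.toReal + 1) := by gcongr; linarith
    _ = _ := mul_comm _ _

/-! ### Crossings of the special flow -/

section Flow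

variable {D : IETData 𝒜 n} {g : ℝ → ℝ} {ε : ℝ}

lemma birkhoffSum_add_mul_le (hlen : ∀ α, 0 < D.len α) (hg : ∀ x ∈ D.base, ε ≤ g x) {x : ℝ}
    (hx : x ∈ D.base) (m e : ℕ) :
    birkhoffSum D.iet g m x + e * ε ≤ birkhoffSum D.iet g (m + e) x := by
  induction e with
  | zero => simp
  | succ e ih =>
    rw [← add_assoc, birkhoffSum_succ]
    have := hg _ (D.iterate_iet_mem_base hlen hx (m + e))
    push_cast
    linarith

lemma birkhoffSum_strictMono (hlen : ∀ α, 0 < D.len α) (hε : 0 < ε)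
    (hg : ∀ x ∈ D.base, ε ≤ g x) {x : ℝ} (hx : x ∈ D.base) :
    StrictMono fun m => birkhoffSum D.iet g m x :=
  strictMono_nat_of_lt_succ fun m => by
    have := birkhoffSum_add_mul_le hlen hg hx m 1
    rw [Nat.cast_one, one_mul] at this
    linarith

lemma exists_birkhoffSum_le_lt (hlen : ∀ α, 0 < D.len α) (hε : 0 < ε)
    (hg : ∀ x ∈ D.base, ε ≤ g x) {x : ℝ} (hx : x ∈ D.base) {v : ℝ} (hv : 0 ≤ v) :
    ∃ m, birkhoffSum D.iet g m x ≤ v ∧ v < birkhoffSum D.iet g (m + 1) x := by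
  classical
  have hex : ∃ m, v < birkhoffSum D.iet g m x := by
    obtain ⟨m, hm⟩ := exists_nat_gt (v / ε)
    rw [div_lt_iff₀ hε] at hm
    have := birkhoffSum_add_mul_le hlen hg hx 0 m
    rw [zero_add, birkhoffSum_zero] at this
    exact ⟨m, by linarith⟩
  obtain ⟨m, hm⟩ : ∃ m, Nat.find hex = m + 1 := by
    refine Nat.exists_eq_succ_of_ne_zero fun h0 => ?_
    have := Nat.find_spec hex
    rw [h0, birkhoffSum_zero] at this
    linarith
  refine ⟨m, not_lt.1 (Nat.find_min hex (by omega)), ?_⟩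
  rw [← hm]
  exact Nat.find_spec hex

lemma crossings_eq (hlen : ∀ α, 0 < D.len α) (hε : 0 < ε)
    (hg : ∀ x ∈ D.base, ε ≤ g x) {p : ℝ × ℝ} (hp : p.1 ∈ D.base) {t : ℝ} {m : ℕ}
    (h1 : birkhoffSum D.iet g m p.1 ≤ p.2 + t) (h2 : p.2 + t < birkhoffSum D.iet g (m + 1) p.1) :
    D.crossings g t p = m := by
  have hmono := birkhoffSum_strictMono hlen hε hg hp
  have : {i : ℕ | birkhoffSum D.iet g i p.1 ≤ p.2 + t} = Iic m := by
    ext i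
    simp only [mem_ofPred_eq, mem_Iic]
    constructor
    · intro hi
      have := hmono.lt_iff_lt.1 (hi.trans_lt h2)
      omega
    · intro hi
      exact (hmono.monotone hi).trans h1
  rw [crossings, this, csSup_Iic]

lemma crossings_spec (hlen : ∀ α, 0 < D.len α) (hε : 0 < ε)
    (hg : ∀ x ∈ D.base, ε ≤ g x) {p : ℝ × ℝ} (hp : p.1 ∈ D.base) {t : ℝ} (ht : 0 ≤ p.2 + t) :
    birkhoffSum D.iet g (D.crossings g t p) p.1 ≤ p.2 + t ∧
      p.2 + t < birkhoffSum D.iet g (D.crossings g t p + 1) p.1 := by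
  obtain ⟨m, h1, h2⟩ := exists_birkhoffSum_le_lt hlen hε hg hp ht
  rw [crossings_eq hlen hε hg hp h1 h2]
  exact ⟨h1, h2⟩

/-- The Birkhoff sum of the step function `h` up to the last crossing before time `s`. -/
def crossingSum (D : IETData 𝒜 n) (g : ℝ → ℝ) (h : 𝒜 → ℝ) (s : ℝ) (p : ℝ × ℝ) : ℝ :=
  birkhoffSum D.iet (D.stepFun h) (D.crossings g s p) p.1

/-- The increment is a Birkhoff sum started at a later base point. Its length e is at most u/ε + 1,
because each crossing after the first one costs time at least ε; the uniform bound at e then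
contributes e + 1 ≤ u/ε + 2. -/
lemma abs_crossingSum_sub_le (hlen : ∀ α, 0 < D.len α) (hε : 0 < ε)
    (hg : ∀ x ∈ D.base, ε ≤ g x) {h : 𝒜 → ℝ} {A ρ : ℝ} (hA : 0 ≤ A) (hρ : 0 ≤ ρ)
    (hS : ∀ x ∈ D.base, ∀ m : ℕ, |birkhoffSum D.iet (D.stepFun h) m x| ≤ A * ((m : ℝ) + 1) ^ ρ)
    {p : ℝ × ℝ} (hp : p ∈ D.flowSpace g) {s u : ℝ} (hs : 0 ≤ s) (hu : 0 ≤ u) :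
    |D.crossingSum g h (s + u) p - D.crossingSum g h s p| ≤ A * (u / ε + 2) ^ ρ := by
  obtain ⟨hp1, hp2, -⟩ := hp
  obtain ⟨a1, a2⟩ := crossings_spec hlen hε hg hp1 (t := s) (by linarith)
  obtain ⟨b1, b2⟩ := crossings_spec hlen hε hg hp1 (t := s + u) (by linarith)
  have hmono := birkhoffSum_strictMono hlen hε hg hp1
  rw [crossingSum, crossingSum]
  set m₁ := D.crossings g s p
  set m₂ := D.crossings g (s + u) p
  have hle : m₁ ≤ m₂ := by
    have := hmono.lt_iff_lt.1 ((a1.trans (by linarith)).trans_lt b2 :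
      birkhoffSum D.iet g m₁ p.1 < birkhoffSum D.iet g (m₂ + 1) p.1)
    omega
  obtain ⟨e, he⟩ := Nat.exists_eq_add_of_le hle
  have hediv : (e : ℝ) ≤ u / ε + 1 := by
    rcases e with _ | e
    · rw [Nat.cast_zero]; positivity
    · have h1 := birkhoffSum_add_mul_le hlen hg hp1 (m₁ + 1) e
      have h2 : m₁ + 1 + e = m₂ := by omega
      rw [h2] at h1
      have h3 : (e : ℝ) * ε ≤ u := by linarith
      rw [← le_div_iff₀ hε] at h3
      push_cast
      linarith
  rw [he, birkhoffSum_add, add_sub_cancel_left]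
  refine (hS _ (D.iterate_iet_mem_base hlen hp1 m₁) e).trans ?_
  exact mul_le_mul_of_nonneg_left (Real.rpow_le_rpow (by positivity) (by linarith) hρ) hA

lemma crossingSum_zero (hlen : ∀ α, 0 < D.len α) (hε : 0 < ε)
    (hg : ∀ x ∈ D.base, ε ≤ g x) {h : 𝒜 → ℝ} {p : ℝ × ℝ} (hp : p ∈ D.flowSpace g) :
    D.crossingSum g h 0 p = 0 := by
  obtain ⟨hp1, hp2, hp3⟩ := hp
  rw [crossingSum, crossings_eq hlen hε hg hp1 (m := 0) (by simpa using hp2) (by simpa using hp3),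
    birkhoffSum_zero]

lemma birkhoffSum_indicator (hlen : ∀ α, 0 < D.len α) {x : ℝ} (hx : x ∈ D.base) (m : ℕ) :
    birkhoffSum D.iet (D.base.indicator g) m x = birkhoffSum D.iet g m x :=
  Finset.sum_congr rfl fun i _ => indicator_of_mem (D.iterate_iet_mem_base hlen hx i) _

lemma measurableSet_flowSpace (hgm : Measurable (D.base.indicator g)) :
    MeasurableSet (D.flowSpace g) := by
  have : D.flowSpace g = {p : ℝ × ℝ | p.1 ∈ D.base} ∩ {p | 0 ≤ p.2} ∩
      {p | p.2 < D.base.indicator g p.1} := by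
    ext p
    simp only [flowSpace, mem_ofPred_eq, mem_inter_iff]
    constructor
    · rintro ⟨h1, h2, h3⟩; exact ⟨⟨h1, h2⟩, by rwa [indicator_of_mem h1]⟩
    · rintro ⟨⟨h1, h2⟩, h3⟩; exact ⟨h1, h2, by rwa [indicator_of_mem h1] at h3⟩
  rw [this]
  exact ((measurable_fst D.measurableSet_base).inter
    (measurableSet_le measurable_const measurable_snd)).inter
    (measurableSet_lt measurable_snd (hgm.comp measurable_fst))

/-- Splitting by the number m of crossings turns the condition into inequalities between Birkhoff
sums; replacing g by its indicator on the base makes these measurable. -/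
lemma measurableSet_le_crossingSum (hlen : ∀ α, 0 < D.len α) (hε : 0 < ε)
    (hg : ∀ x ∈ D.base, ε ≤ g x) (hgm : Measurable (D.base.indicator g)) (h : 𝒜 → ℝ) {s : ℝ}
    (hs : 0 ≤ s) (c : ℝ) :
    MeasurableSet {p ∈ D.flowSpace g | c ≤ |D.crossingSum g h s p|} := by
  have : {p ∈ D.flowSpace g | c ≤ |D.crossingSum g h s p|} =
      ⋃ m : ℕ, D.flowSpace g ∩ ({p | birkhoffSum D.iet (D.base.indicator g) m p.1 ≤ p.2 + s} ∩
        ({p | p.2 + s < birkhoffSum D.iet (D.base.indicator g) (m + 1) p.1} ∩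
          {p | c ≤ |birkhoffSum D.iet (D.stepFun h) m p.1|})) := by
    ext p
    simp only [mem_ofPred_eq, mem_iUnion, mem_inter_iff]
    constructor
    · rintro ⟨hp, hc⟩
      obtain ⟨h1, h2⟩ := crossings_spec hlen hε hg hp.1 (t := s) (by linarith [hp.2.1])
      refine ⟨D.crossings g s p, hp, ?_, ?_, hc⟩
      · rwa [birkhoffSum_indicator hlen hp.1]
      · rwa [birkhoffSum_indicator hlen hp.1]
    · rintro ⟨m, hp, h1, h2, hc⟩
      rw [birkhoffSum_indicator hlen hp.1] at h1 h2
      refine ⟨hp, ?_⟩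
      rwa [crossingSum, crossings_eq hlen hε hg hp.1 h1 h2]
  rw [this]
  refine MeasurableSet.iUnion fun m => (measurableSet_flowSpace hgm).inter
    (MeasurableSet.inter ?_ (MeasurableSet.inter ?_ ?_))
  · exact measurableSet_le ((D.measurable_birkhoffSum hgm m).comp measurable_fst)
      (measurable_snd.add_const s)
  · exact measurableSet_lt (measurable_snd.add_const s)
      ((D.measurable_birkhoffSum hgm (m + 1)).comp measurable_fst)
  · exact measurableSet_le measurable_const (continuous_abs.measurable.comp
      ((D.measurable_birkhoffSum (D.measurable_stepFun h) m).comp measurable_fst))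

/-! ### Birkhoff integrals -/

/-- The points over which `f` is integrable with integral `h`. -/
def GoodFiber (D : IETData 𝒜 n) (g : ℝ → ℝ) (f : ℝ × ℝ → ℝ) (h : 𝒜 → ℝ) (x : ℝ) : Prop :=
  IntervalIntegrable (fun u => f (x, u)) volume 0 (g x) ∧
    ∫ u in (0 : ℝ)..(g x), f (x, u) = D.stepFun h x

lemma flow_eq (hlen : ∀ α, 0 < D.len α) (hε : 0 < ε)
    (hg : ∀ x ∈ D.base, ε ≤ g x) {x t : ℝ} (hx : x ∈ D.base) {m : ℕ}
    (h1 : birkhoffSum D.iet g m x ≤ t) (h2 : t < birkhoffSum D.iet g (m + 1) x) :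
    D.flow g t (x, 0) = (D.iet^[m] x, t - birkhoffSum D.iet g m x) := by
  rw [flow, crossings_eq hlen hε hg (p := (x, 0)) hx (m := m) (by simpa using h1)
    (by simpa using h2), zero_add]

/-- After the m-th crossing the flow climbs the fiber over T^m x, so only a shift of time is
involved. At the full height w = g(T^m x) the end point already belongs to the next fiber, so the
integrands agree only almost everywhere. -/
lemma integral_flow_piece (hlen : ∀ α, 0 < D.len α) (hε : 0 < ε)
    (hg : ∀ x ∈ D.base, ε ≤ g x) {f : ℝ × ℝ → ℝ} {x : ℝ} (hx : x ∈ D.base) {m : ℕ}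
    (hint : IntervalIntegrable (fun u => f (D.iet^[m] x, u)) volume 0 (g (D.iet^[m] x)))
    {w : ℝ} (hw0 : 0 ≤ w) (hw : w ≤ g (D.iet^[m] x)) :
    IntervalIntegrable (fun t => f (D.flow g t (x, 0))) volume (birkhoffSum D.iet g m x)
      (birkhoffSum D.iet g m x + w) ∧
    ∫ t in (birkhoffSum D.iet g m x)..(birkhoffSum D.iet g m x + w), f (D.flow g t (x, 0)) =
      ∫ u in (0 : ℝ)..w, f (D.iet^[m] x, u) := by
  set S := birkhoffSum D.iet g m x with hS
  have hfl : ∀ t ∈ Ioo S (S + w),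
      f (D.iet^[m] x, t - S) = f (D.flow g t (x, 0)) := by
    intro t ht
    rw [flow_eq hlen hε hg hx ht.1.le]
    rw [birkhoffSum_succ]
    linarith [ht.2]
  have hint' : IntervalIntegrable (fun u => f (D.iet^[m] x, u)) volume 0 w :=
    hint.mono_set (by
      rw [uIcc_of_le hw0, uIcc_of_le (hw0.trans hw)]; exact Icc_subset_Icc_right hw)
  have hshift : IntervalIntegrable (fun t => f (D.iet^[m] x, t - S)) volume S (S + w) := by
    have := hint'.comp_sub_right S
    rwa [zero_add, add_comm w S] at this
  have hae : ∀ᵐ t, t ∈ uIoc S (S + w) → f (D.iet^[m] x, t - S) = f (D.flow g t (x, 0)) := by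
    filter_upwards [compl_mem_ae_iff.2 (measure_singleton (μ := volume) (S + w))] with t ht ht'
    rw [uIoc_of_le (by linarith)] at ht'
    exact hfl t ⟨ht'.1, lt_of_le_of_ne ht'.2 ht⟩
  refine ⟨hshift.congr_ae ((ae_restrict_iff' measurableSet_uIoc).2 hae), ?_⟩
  rw [← intervalIntegral.integral_congr_ae hae,
    intervalIntegral.integral_comp_sub_right (fun u => f (D.iet^[m] x, u)) S, sub_self,
    add_sub_cancel_left]

lemma integral_flow_birkhoffSum (hlen : ∀ α, 0 < D.len α) (hε : 0 < ε)
    (hg : ∀ x ∈ D.base, ε ≤ g x) {f : ℝ × ℝ → ℝ} {h : 𝒜 → ℝ} {x : ℝ} (hx : x ∈ D.base)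
    (hgood : ∀ i, D.GoodFiber g f h (D.iet^[i] x)) (m : ℕ) :
    IntervalIntegrable (fun t => f (D.flow g t (x, 0))) volume 0 (birkhoffSum D.iet g m x) ∧
    ∫ t in (0 : ℝ)..(birkhoffSum D.iet g m x), f (D.flow g t (x, 0)) =
      birkhoffSum D.iet (D.stepFun h) m x := by
  induction m with
  | zero => simp
  | succ m ih =>
    have hpos := hg _ (D.iterate_iet_mem_base hlen hx m)
    obtain ⟨h1, h2⟩ := integral_flow_piece hlen hε hg hx (hgood m).1 (by linarith) le_rfl
    rw [birkhoffSum_succ]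
    refine ⟨ih.1.trans h1, ?_⟩
    rw [← intervalIntegral.integral_add_adjacent_intervals ih.1 h1, ih.2, h2, (hgood m).2,
      birkhoffSum_succ]

/-- Only the part of the fiber below height K contributes, however high the roof. -/
lemma abs_integral_fiber_le {f : ℝ × ℝ → ℝ} {B K : ℝ} (hK : 0 < K)
    (hfB : ∀ p ∈ D.flowSpace g, |f p| ≤ B) (hfK : ∀ p ∈ D.flowSpace g, K ≤ p.2 → f p = 0)
    {y : ℝ} (hy : y ∈ D.base)
    (hint : IntervalIntegrable (fun u => f (y, u)) volume 0 (g y))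
    {w : ℝ} (hw0 : 0 ≤ w) (hw : w < g y) : |∫ u in (0 : ℝ)..w, f (y, u)| ≤ B * K := by
  have hmem : ∀ u, 0 ≤ u → u ≤ w → (y, u) ∈ D.flowSpace g := fun u h1 h2 =>
    ⟨hy, h1, h2.trans_lt hw⟩
  have hB0 : 0 ≤ B := (abs_nonneg _).trans (hfB _ (hmem 0 le_rfl hw0))
  have hbound : ∀ v, 0 ≤ v → v ≤ w → |∫ u in (0 : ℝ)..v, f (y, u)| ≤ B * v := by
    intro v hv hvw
    have := intervalIntegral.norm_integral_le_of_norm_le_const (a := 0) (b := v)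
      (f := fun u => f (y, u)) (C := B) (fun u hu => by
        rw [uIoc_of_le hv] at hu
        exact hfB _ (hmem u hu.1.le (hu.2.trans hvw)))
    rwa [sub_zero, abs_of_nonneg hv] at this
  rcases le_total w K with h | h
  · exact (hbound w hw0 le_rfl).trans (by gcongr)
  · have hsub : ∀ a b, 0 ≤ a → a ≤ b → b ≤ g y →
        IntervalIntegrable (fun u => f (y, u)) volume a b := fun a b ha hab hb =>
      hint.mono_set (by
        rw [uIcc_of_le hab, uIcc_of_le (by linarith)]; exact Icc_subset_Icc ha hb)
    have hzero : ∫ u in K..w, f (y, u) = 0 := by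
      rw [intervalIntegral.integral_congr (g := fun _ => (0 : ℝ)), intervalIntegral.integral_zero]
      intro u hu
      rw [uIcc_of_le h] at hu
      exact hfK _ (hmem u (by linarith [hu.1]) hu.2) hu.1
    rw [← intervalIntegral.integral_add_adjacent_intervals (b := K)
      (hsub 0 K le_rfl hK.le (by linarith)) (hsub K w hK.le h hw.le), hzero, add_zero]
    exact hbound K hK.le h

/-- Birkhoff integrals agree with the sums over the crossings up to a bounded error. -/
lemma abs_birkhoffIntegral_sub_le (hlen : ∀ α, 0 < D.len α) (hε : 0 < ε)
    (hg : ∀ x ∈ D.base, ε ≤ g x) {f : ℝ × ℝ → ℝ} {h : 𝒜 → ℝ} {B K : ℝ} (hK : 0 < K)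
    (hfB : ∀ p ∈ D.flowSpace g, |f p| ≤ B) (hfK : ∀ p ∈ D.flowSpace g, K ≤ p.2 → f p = 0)
    {p : ℝ × ℝ} (hp : p ∈ D.flowSpace g) (hgood : ∀ i, D.GoodFiber g f h (D.iet^[i] p.1))
    {s : ℝ} (hs : 0 ≤ s) :
    |D.birkhoffIntegral g f s p - D.crossingSum g h s p| ≤ 2 * (B * K) := by
  obtain ⟨x, r⟩ := p
  obtain ⟨hx, hr0, hr⟩ := hp
  simp only at hx hr0 hr hgood
  -- the integral of the flow from the bottom of the fiber
  have key : ∀ v, 0 ≤ v → ∀ m, birkhoffSum D.iet g m x ≤ v → v < birkhoffSum D.iet g (m + 1) x →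
      IntervalIntegrable (fun t => f (D.flow g t (x, 0))) volume 0 v ∧
      |(∫ t in (0 : ℝ)..v, f (D.flow g t (x, 0))) - birkhoffSum D.iet (D.stepFun h) m x| ≤
        B * K := by
    intro v hv m h1 h2
    rw [birkhoffSum_succ] at h2
    obtain ⟨i1, i2⟩ := integral_flow_birkhoffSum hlen hε hg hx hgood m
    obtain ⟨j1, j2⟩ := integral_flow_piece hlen hε hg hx (hgood m).1
      (w := v - birkhoffSum D.iet g m x) (by linarith) (by linarith)
    rw [add_sub_cancel] at j1 j2
    refine ⟨i1.trans j1, ?_⟩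
    rw [← intervalIntegral.integral_add_adjacent_intervals i1 j1, i2, j2, add_sub_cancel_left]
    exact abs_integral_fiber_le hK hfB hfK (D.iterate_iet_mem_base hlen hx m) (hgood m).1
      (by linarith) (by linarith)
  -- Starting at height r is starting at the bottom r units earlier. The integral becomes a
  -- difference of integrals up to r + s and up to r; each leaves one incomplete fiber, hence twice
  -- B K.
  have hflow : ∀ t, D.flow g t (x, r) = D.flow g (r + t) (x, 0) := by
    intro t
    simp only [flow, crossings, zero_add]
  have hint : D.birkhoffIntegral g f s (x, r) =
      ∫ t in r..(r + s), f (D.flow g t (x, 0)) := by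
    rw [birkhoffIntegral]
    simp_rw [hflow]
    rw [intervalIntegral.integral_comp_add_left (fun t => f (D.flow g t (x, 0))), add_zero]
  obtain ⟨c1, c2⟩ := crossings_spec hlen hε hg (p := (x, r)) hx (t := s)
    (by simp only; linarith)
  obtain ⟨k1, k2⟩ := key (r + s) (by linarith) _ c1 c2
  obtain ⟨l1, l2⟩ := key r hr0 0 (by simpa using hr0) (by simpa using hr)
  rw [birkhoffSum_zero, sub_zero] at l2
  rw [hint, ← intervalIntegral.integral_interval_sub_left k1 l1, crossingSum]
  have : ∀ a b c : ℝ, |a - c| ≤ B * K → |b| ≤ B * K → |a - b - c| ≤ 2 * (B * K) := by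
    intro a b c h1 h2
    have : a - b - c = (a - c) - b := by ring
    rw [this]
    exact (abs_sub _ _).trans (by linarith)
  exact this _ _ _ k2 l2

/-- Almost every section of f is measurable, and bounded, hence integrable on its fiber. The
exceptional points form a null set, whose preimages under the countably many iterates of T are null
as well. -/
lemma ae_goodFiber (hlen : ∀ α, 0 < D.len α) (hgpos : ∀ x ∈ D.base, 0 ≤ g x)
    (hgm : Measurable (D.base.indicator g)) {f : ℝ × ℝ → ℝ} {h : 𝒜 → ℝ} {B : ℝ}
    (hfmeas : AEStronglyMeasurable f (volume.restrict (D.flowSpace g)))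
    (hfB : ∀ p ∈ D.flowSpace g, |f p| ≤ B)
    (hfh : ∀ α, ∀ᵐ x ∂(volume.restrict (Ico (D.left α) (D.right α))),
      ∫ r in (0 : ℝ)..(g x), f (x, r) = h α) :
    ∀ᵐ x, x ∈ D.base → ∀ i, D.GoodFiber g f h (D.iet^[i] x) := by
  have hS := measurableSet_flowSpace hgm
  have h1 : ∀ᵐ x, AEStronglyMeasurable (fun u => (D.flowSpace g).indicator f (x, u)) volume := by
    have := (aestronglyMeasurable_indicator_iff hS).2 hfmeas
    rw [Measure.volume_eq_prod] at this
    exact this.prodMk_left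
  have h2 : ∀ᵐ x, ∀ α, x ∈ D.interval α → ∫ r in (0 : ℝ)..(g x), f (x, r) = h α :=
    ae_all_iff.2 fun α => (ae_restrict_iff' measurableSet_Ico).1 (hfh α)
  have h3 : ∀ᵐ x, x ∈ D.base → D.GoodFiber g f h x := by
    filter_upwards [h1, h2] with x hx1 hx2 hx
    obtain ⟨α, hα⟩ := D.exists_mem_interval hx
    refine ⟨?_, by rw [hx2 α hα, D.stepFun_of_mem hlen h hα]⟩
    rw [intervalIntegrable_iff_integrableOn_Ioc_of_le (hgpos x hx),
      integrableOn_Ioc_iff_integrableOn_Ioo]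
    have hmem : ∀ u ∈ Ioo 0 (g x), (x, u) ∈ D.flowSpace g := fun u hu => ⟨hx, hu.1.le, hu.2⟩
    refine IntegrableOn.of_bound measure_Ioo_lt_top ?_ B ?_
    · refine hx1.restrict.congr ((ae_restrict_iff' measurableSet_Ioo).2
        (Eventually.of_forall fun u hu => ?_))
      exact indicator_of_mem (hmem u hu) f
    · exact (ae_restrict_iff' measurableSet_Ioo).2
        (Eventually.of_forall fun u hu => hfB _ (hmem u hu))
  have h4 : ∀ᵐ x, ∀ i, D.iet^[i] x ∈ D.base → D.GoodFiber g f h (D.iet^[i] x) :=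
    ae_all_iff.2 fun i =>
      ((D.measurePreserving_iet hlen).iterate i).quasiMeasurePreserving.ae h3
  filter_upwards [h4] with x hx hxb i
  exact hx i (D.iterate_iet_mem_base hlen hxb i)

end Flow

end IETData

/-! ### Growth exponents -/

lemma ennreal_log_ofReal_rpow {s b : ℝ} (hs : 0 < s) :
    ENNReal.log (ENNReal.ofReal (s ^ b)) = ((b * Real.log s : ℝ) : EReal) := by
  rw [ENNReal.log_ofReal_of_pos (Real.rpow_pos_of_pos hs _), Real.log_rpow hs]

lemma limsup_log_div_log_eq {F : ℝ → ENNReal} {ρ : ℝ} (hρ : 0 < ρ)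
    (hup : ∀ b, ρ < b → ∀ᶠ s in atTop, F s ≤ ENNReal.ofReal (s ^ b))
    (hlow : ∀ b, 0 < b → b < ρ → ∃ᶠ s in atTop, ENNReal.ofReal (s ^ b) ≤ F s) :
    limsup (fun s : ℝ => ENNReal.log (F s) / (Real.log s : EReal)) atTop = (ρ : EReal) := by
  have hlog : ∀ s : ℝ, 1 < s → (0 : EReal) < (Real.log s : EReal) := fun s hs => by
    exact_mod_cast Real.log_pos hs
  apply le_antisymm
  · refine le_of_forall_gt_imp_ge_of_dense fun c hc => ?_
    obtain ⟨b, hb1, hb2⟩ := EReal.lt_iff_exists_real_btwn.1 hc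
    refine le_trans ?_ hb2.le
    refine limsup_le_of_le (by isBoundedDefault) ?_
    filter_upwards [hup b (by exact_mod_cast hb1), eventually_gt_atTop 1] with s hs hs1
    rw [EReal.div_le_iff_le_mul (hlog s hs1) (EReal.coe_ne_top _), ← EReal.coe_mul, mul_comm,
      ← ennreal_log_ofReal_rpow (by linarith)]
    exact ENNReal.log_monotone hs
  · refine le_of_forall_lt_imp_le_of_dense fun c hc => ?_
    have hc' : max c 0 < (ρ : EReal) := max_lt hc (by exact_mod_cast hρ)
    obtain ⟨b, hb1, hb2⟩ := EReal.lt_iff_exists_real_btwn.1 hc'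
    refine le_trans ((le_max_left c 0).trans hb1.le) ?_
    have hb0 : 0 < b := by exact_mod_cast (le_max_right c 0).trans_lt hb1
    refine le_limsup_of_frequently_le ?_ (by isBoundedDefault)
    refine ((hlow b hb0 (by exact_mod_cast hb2)).and_eventually (eventually_gt_atTop 1)).mono ?_
    rintro s ⟨hs, hs1⟩
    rw [EReal.le_div_iff_mul_le (hlog s hs1) (EReal.coe_ne_top _), ← EReal.coe_mul,
      ← ennreal_log_ofReal_rpow (by linarith)]
    exact ENNReal.log_monotone hs

lemma eventually_mul_rpow_le (A : ℝ) {b b' : ℝ} (hb : b < b') :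
    ∀ᶠ s : ℝ in atTop, A * s ^ b ≤ s ^ b' := by
  filter_upwards [(tendsto_rpow_atTop (sub_pos.2 hb)).eventually_ge_atTop A,
    eventually_gt_atTop 0] with s hs hs0
  calc A * s ^ b ≤ s ^ (b' - b) * s ^ b := by gcongr
    _ = s ^ b' := by rw [← Real.rpow_add hs0]; ring_nf

lemma eventually_affine_rpow_le {A R ε b b' : ℝ} (hA : 0 ≤ A) (hR : 0 ≤ R) (hε : 0 < ε)
    (hb0 : 0 ≤ b) (hb : b < b') :
    ∀ᶠ s : ℝ in atTop, A * (s / ε + 2) ^ b + R ≤ s ^ b' := by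
  filter_upwards [eventually_mul_rpow_le (A * (1 / ε + 2) ^ b + R) hb,
    eventually_ge_atTop 1] with s hs hs1
  refine le_trans ?_ hs
  have h1 : (s / ε + 2) ^ b ≤ (1 / ε + 2) ^ b * s ^ b := by
    rw [← Real.mul_rpow (by positivity) (by linarith)]
    refine Real.rpow_le_rpow (by positivity) ?_ hb0
    have : (1 / ε + 2) * s = s / ε + 2 * s := by ring
    linarith
  have h2 : 1 ≤ s ^ b := Real.one_le_rpow hs1 hb0
  have h3 : A * (s / ε + 2) ^ b ≤ A * ((1 / ε + 2) ^ b * s ^ b) := by gcongr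
  have h4 : R ≤ R * s ^ b := le_mul_of_one_le_right hR h2
  linarith

/-- A function of polynomially controlled oscillation that is large for arbitrarily large times is
large along the powers `j ^ κ`. -/
lemma frequently_rpow_le_of_oscillation {G : ℝ → ℝ} {A ε ρ θ θ' : ℝ} {κ : ℕ} (hA : 0 ≤ A)
    (hε : 0 < ε) (hρ : 0 ≤ ρ) (hosc : ∀ s ≥ 0, ∀ u ≥ 0, |G (s + u) - G s| ≤ A * (u / ε + 2) ^ ρ)
    (hκ : 1 ≤ κ) (hθ0 : 0 ≤ θ) (hθ : θ < θ') (hκρ : ((κ : ℝ) - 1) * ρ < κ * θ')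
    (hG : ∃ᶠ s in atTop, s ^ θ' ≤ |G s|) :
    ∃ᶠ j : ℕ in atTop, ((j : ℝ) ^ ((κ : ℝ) * θ)) ≤ |G ((j : ℝ) ^ κ)| := by
  have hκ0 : (0 : ℝ) < κ := by exact_mod_cast hκ
  set A' := A * (κ * 2 ^ κ / ε + 2) ^ ρ with hA'
  -- Both the target size and the oscillation are eventually at most half of j^(κθ').
  have hev : ∀ᶠ j : ℕ in atTop, (j : ℝ) ^ ((κ : ℝ) * θ) + A' * (j : ℝ) ^ (((κ : ℝ) - 1) * ρ) ≤
      (j : ℝ) ^ ((κ : ℝ) * θ') := by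
    have h1 := tendsto_natCast_atTop_atTop.eventually
      (eventually_mul_rpow_le 2 (mul_lt_mul_of_pos_left hθ hκ0))
    have h2 := tendsto_natCast_atTop_atTop.eventually (eventually_mul_rpow_le (2 * A') hκρ)
    filter_upwards [h1, h2] with j h1 h2
    linarith
  -- The base of the last κ-th power not exceeding s.
  set J : ℝ → ℕ := fun s => ⌊s ^ ((κ : ℝ)⁻¹)⌋₊ with hJ
  have hJt : Tendsto J atTop atTop :=
    tendsto_nat_floor_atTop.comp (tendsto_rpow_atTop (inv_pos.2 hκ0))
  refine hJt.frequently ?_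
  refine (hG.and_eventually ((hJt.eventually (hev.and (eventually_ge_atTop 1))).and
    (eventually_ge_atTop 1))).mono ?_
  rintro s ⟨hs, ⟨hjev, hj1⟩, hs1⟩
  set j := J s with hj
  have hs0 : 0 ≤ s := by linarith
  have hroot : (s ^ ((κ : ℝ)⁻¹)) ^ κ = s := Real.rpow_inv_natCast_pow hs0 (by omega)
  have hroot0 : 0 ≤ s ^ ((κ : ℝ)⁻¹) := by positivity
  have hjs : (j : ℝ) ^ κ ≤ s := by
    rw [← hroot]; exact pow_le_pow_left₀ (Nat.cast_nonneg _) (Nat.floor_le hroot0) κ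
  have hsj : s ≤ ((j : ℝ) + 1) ^ κ := by
    nth_rewrite 1 [← hroot]
    exact pow_le_pow_left₀ hroot0 (Nat.lt_floor_add_one _).le κ
  have hj1' : (1 : ℝ) ≤ j := by exact_mod_cast hj1
  obtain ⟨i, rfl⟩ : ∃ i, κ = i + 1 := ⟨κ - 1, by omega⟩
  -- Consecutive κ-th powers are O(j^(κ-1)) apart, which turns the oscillation bound into a multiple
  -- of j^((κ-1)ρ).
  have hu : s - (j : ℝ) ^ (i + 1) ≤ ((i + 1 : ℕ) : ℝ) * 2 ^ (i + 1) * (j : ℝ) ^ i := by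
    have h1 : ((j : ℝ) + 1) ^ (i + 1) - (j : ℝ) ^ (i + 1) ≤
        ((i + 1 : ℕ) : ℝ) * ((j : ℝ) + 1) ^ i := by
      have hgeom := (Commute.all ((j : ℝ) + 1) (j : ℝ)).mul_geom_sum₂ (i + 1)
      rw [add_sub_cancel_left, one_mul] at hgeom
      rw [← hgeom]
      calc _ ≤ ∑ _l ∈ Finset.range (i + 1), ((j : ℝ) + 1) ^ i := by
            refine Finset.sum_le_sum fun l hl => ?_
            have hl' : l ≤ i := Nat.lt_succ_iff.1 (Finset.mem_range.1 hl)
            calc ((j : ℝ) + 1) ^ l * (j : ℝ) ^ (i + 1 - 1 - l) ≤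
                  ((j : ℝ) + 1) ^ l * ((j : ℝ) + 1) ^ (i + 1 - 1 - l) := by
                  gcongr; linarith
              _ = ((j : ℝ) + 1) ^ i := by rw [← pow_add]; congr 1; omega
        _ = _ := by simp
    have h2 : ((j : ℝ) + 1) ^ i ≤ 2 ^ (i + 1) * (j : ℝ) ^ i := by
      calc ((j : ℝ) + 1) ^ i ≤ (2 * (j : ℝ)) ^ i := by gcongr; linarith
        _ = 2 ^ i * (j : ℝ) ^ i := mul_pow _ _ _
        _ ≤ _ := by gcongr <;> norm_num
    calc s - (j : ℝ) ^ (i + 1) ≤ ((i + 1 : ℕ) : ℝ) * ((j : ℝ) + 1) ^ i := by linarith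
      _ ≤ ((i + 1 : ℕ) : ℝ) * (2 ^ (i + 1) * (j : ℝ) ^ i) := by gcongr
      _ = _ := by ring
  have hu0 : 0 ≤ s - (j : ℝ) ^ (i + 1) := by linarith
  have hosc' := hosc ((j : ℝ) ^ (i + 1)) (by positivity) _ hu0
  rw [add_sub_cancel] at hosc'
  have hji : (1 : ℝ) ≤ (j : ℝ) ^ i := one_le_pow₀ hj1'
  have hbound : A * ((s - (j : ℝ) ^ (i + 1)) / ε + 2) ^ ρ ≤
      A' * (j : ℝ) ^ ((((i + 1 : ℕ) : ℝ) - 1) * ρ) := by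
    have h1 : (s - (j : ℝ) ^ (i + 1)) / ε + 2 ≤
        (((i + 1 : ℕ) : ℝ) * 2 ^ (i + 1) / ε + 2) * (j : ℝ) ^ i := by
      have h2 : (s - (j : ℝ) ^ (i + 1)) / ε ≤
          ((i + 1 : ℕ) : ℝ) * 2 ^ (i + 1) * (j : ℝ) ^ i / ε := by gcongr
      have h3 : (((i + 1 : ℕ) : ℝ) * 2 ^ (i + 1) / ε + 2) * (j : ℝ) ^ i =
          ((i + 1 : ℕ) : ℝ) * 2 ^ (i + 1) * (j : ℝ) ^ i / ε + 2 * (j : ℝ) ^ i := by ring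
      linarith
    have h4 : (j : ℝ) ^ ((((i + 1 : ℕ) : ℝ) - 1) * ρ) = ((j : ℝ) ^ i) ^ ρ := by
      rw [← Real.rpow_natCast, ← Real.rpow_mul (by linarith)]
      congr 2
      push_cast
      ring
    rw [h4, hA', mul_assoc, ← Real.mul_rpow (by positivity) (by positivity)]
    exact mul_le_mul_of_nonneg_left (Real.rpow_le_rpow (by positivity) h1 hρ) hA
  have hlow : (j : ℝ) ^ (((i + 1 : ℕ) : ℝ) * θ') ≤ |G s| := by
    refine le_trans ?_ hs
    rw [Real.rpow_mul (by linarith), Real.rpow_natCast]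
    exact Real.rpow_le_rpow (by positivity) hjs (by linarith)
  have htri : |G s| ≤ |G ((j : ℝ) ^ (i + 1))| + |G s - G ((j : ℝ) ^ (i + 1))| := by
    have := abs_add_le (G ((j : ℝ) ^ (i + 1))) (G s - G ((j : ℝ) ^ (i + 1)))
    rwa [add_sub_cancel] at this
  linarith

/-! ### Volume of the flow space and lower bounds pointwise and in L¹ -/

namespace IETData

variable {𝒜 : Type*} [Fintype 𝒜] [DecidableEq 𝒜] {n : ℕ} {D : IETData 𝒜 n} {g : ℝ → ℝ} {ε : ℝ}

lemma volume_flowSpace_lt_top (hgm : Measurable (D.base.indicator g))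
    (hgi : IntegrableOn g D.base) : volume (D.flowSpace g) < ⊤ := by
  rw [Measure.volume_eq_prod, Measure.prod_apply (measurableSet_flowSpace hgm)]
  have hi : Integrable (D.base.indicator g) := (integrable_indicator_iff D.measurableSet_base).2 hgi
  refine lt_of_le_of_lt (lintegral_mono fun x => ?_) hi.lintegral_lt_top
  by_cases hx : x ∈ D.base
  · rw [indicator_of_mem hx]
    have : Prod.mk x ⁻¹' D.flowSpace g ⊆ Ico 0 (g x) := fun u hu => hu.2
    refine (measure_mono this).trans ?_
    simp
  · have : Prod.mk x ⁻¹' D.flowSpace g = ∅ := by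
      ext u; simp [flowSpace, hx]
    simp [this]

lemma volume_flowSpace_pos (hlen : ∀ α, 0 < D.len α) (hε : 0 < ε)
    (hg : ∀ x ∈ D.base, ε ≤ g x) : 0 < volume (D.flowSpace g) := by
  have hsub : D.base ×ˢ Ico 0 ε ⊆ D.flowSpace g := fun p hp =>
    ⟨hp.1, hp.2.1, hp.2.2.trans_le (hg _ hp.1)⟩
  refine lt_of_lt_of_le ?_ (measure_mono hsub)
  rw [Measure.volume_eq_prod, Measure.prod_prod, volume_base, Real.volume_Ico, sub_zero]
  exact ENNReal.mul_pos (by simpa using D.total_pos hlen) (by simpa using hε)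

/-- A point with large Birkhoff sums of `h` and moderate Birkhoff sums of the roof has large
sums over the crossings for arbitrarily large times. -/
lemma frequently_rpow_add_le_crossingSum (hlen : ∀ α, 0 < D.len α) (hε : 0 < ε)
    (hg : ∀ x ∈ D.base, ε ≤ g x) {h : 𝒜 → ℝ} {p : ℝ × ℝ} (hp : p ∈ D.flowSpace g)
    {θ b c A : ℝ} (hθ : 0 ≤ θ) (hc : 0 < c) (hbc : b * c ≤ θ) (hA : 0 < A)
    (hlarge : p.1 ∉ ⋃ C, D.smallSums h θ C)
    (hroof : ∀ m : ℕ, birkhoffSum D.iet g m p.1 ≤ A * ((m : ℝ) + 1) ^ b) (R : ℝ) :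
    ∃ᶠ s in atTop, s ^ c + R ≤ |D.crossingSum g h s p| := by
  obtain ⟨hp1, hp2, hp3⟩ := hp
  have hnot : ∀ C : ℕ, ∃ m : ℕ, C * ((m : ℝ) + 1) ^ θ <
      |birkhoffSum D.iet (D.stepFun h) m p.1| := by
    intro C
    by_contra! hcon
    exact hlarge (mem_iUnion.2 ⟨C, hp1, hcon⟩)
  rw [frequently_atTop]
  intro s₀
  have hv := vecNorm_nonneg h
  set t := (|s₀| + p.2) / ε with ht
  have ht0 : 0 ≤ t := by positivity
  -- The constant pays for s^c, for R and for ‖h‖ t; the last term forces m > t by the trivial bound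
  -- m ‖h‖ for the sum, and so pushes the time beyond s₀.
  obtain ⟨m, hm⟩ := hnot ⌈A ^ c + |R| + vecNorm h * t⌉₊
  have hm1 : 1 ≤ ((m : ℝ) + 1) ^ θ :=
    Real.one_le_rpow (by linarith [Nat.cast_nonneg (α := ℝ) m]) hθ
  have hm2 : (A ^ c + |R| + vecNorm h * t) * ((m : ℝ) + 1) ^ θ <
      |birkhoffSum D.iet (D.stepFun h) m p.1| := by
    refine lt_of_le_of_lt ?_ hm
    gcongr
    exact Nat.le_ceil _
  have hAc : 0 ≤ A ^ c := by positivity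
  have hmt : t < m := by
    have h1 := D.abs_birkhoffSum_stepFun_le h m p.1
    have h2 : A ^ c + |R| + vecNorm h * t ≤
        (A ^ c + |R| + vecNorm h * t) * ((m : ℝ) + 1) ^ θ :=
      le_mul_of_one_le_right (by positivity) hm1
    have h3 : vecNorm h * t < vecNorm h * m := by linarith [abs_nonneg R]
    exact lt_of_mul_lt_mul_left h3 hv
  have hSm : |s₀| + p.2 < birkhoffSum D.iet g m p.1 := by
    have := birkhoffSum_add_mul_le hlen hg hp1 0 m
    rw [zero_add, birkhoffSum_zero, zero_add] at this
    rw [ht, div_lt_iff₀ hε] at hmt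
    linarith
  -- The moment of the m-th crossing. It is at most A (m + 1)^b, so its c-th power is at most A^c (m
  -- + 1)^θ because b c ≤ θ.
  refine ⟨birkhoffSum D.iet g m p.1 - p.2, by linarith [le_abs_self s₀], ?_⟩
  have hcr : D.crossings g (birkhoffSum D.iet g m p.1 - p.2) p = m := by
    refine crossings_eq hlen hε hg hp1 (by linarith) ?_
    rw [add_sub_cancel]
    exact birkhoffSum_strictMono hlen hε hg hp1 (Nat.lt_succ_self m)
  rw [crossingSum, hcr]
  refine le_trans ?_ hm2.le
  have hmb : (0 : ℝ) ≤ (m : ℝ) + 1 := by positivity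
  have h1 : (birkhoffSum D.iet g m p.1 - p.2) ^ c ≤ A ^ c * ((m : ℝ) + 1) ^ θ := by
    calc (birkhoffSum D.iet g m p.1 - p.2) ^ c ≤ (A * ((m : ℝ) + 1) ^ b) ^ c := by
          refine Real.rpow_le_rpow (by linarith [abs_nonneg s₀]) ?_ hc.le
          linarith [hroof m]
      _ = A ^ c * ((m : ℝ) + 1) ^ (b * c) := by
          rw [Real.mul_rpow hA.le (by positivity), ← Real.rpow_mul hmb]
      _ ≤ _ := by
          gcongr
          linarith [Nat.cast_nonneg (α := ℝ) m]
  have h2 : R ≤ |R| * ((m : ℝ) + 1) ^ θ :=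
    (le_abs_self R).trans (le_mul_of_one_le_right (abs_nonneg R) hm1)
  have h3 : 0 ≤ vecNorm h * t * ((m : ℝ) + 1) ^ θ := by positivity
  linarith

end IETData

namespace IETData

variable {𝒜 : Type*} [Fintype 𝒜] [DecidableEq 𝒜] {n : ℕ} {D : IETData 𝒜 n} {g : ℝ → ℝ} {ε : ℝ}

/-- Over almost every point of the base the sums over the crossings are large for arbitrarily large
times. -/
lemma FDC.ae_frequently_rpow_add_le_crossingSum {N : ℕ → ℕ} {Λ : ℕ → ℝ} {h : 𝒜 → ℝ} {lam : ℝ}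
    (hFDC : D.FDC N Λ) (hlen : ∀ α, 0 < D.len α) (hlam : 0 < lam)
    (hgrowth : D.HasGrowthRate N h lam) (hε : 0 < ε) (hg : ∀ x ∈ D.base, ε ≤ g x)
    (hgm : Measurable (D.base.indicator g)) (hgi : IntegrableOn g D.base) :
    ∀ᵐ p : ℝ × ℝ, p ∈ D.flowSpace g → ∀ c, 0 < c → c < lam / Λ 1 → ∀ R,
      ∃ᶠ s in atTop, s ^ c + R ≤ |D.crossingSum g h s p| := by
  -- Rational exponents keep the union of exceptional null sets countable.
  have h1 : ∀ᵐ x : ℝ, ∀ θ : ℚ, (0 : ℝ) ≤ θ → (θ : ℝ) < lam / Λ 1 →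
      x ∉ ⋃ C, D.smallSums h θ C := by
    refine ae_all_iff.2 fun θ => ?_
    by_cases hθ : (0 : ℝ) ≤ θ ∧ (θ : ℝ) < lam / Λ 1
    · filter_upwards [measure_eq_zero_iff_ae_notMem.1
        (hFDC.volume_smallSums_eq_zero hlen hlam hgrowth hθ.1 hθ.2)] with x hx _ _ using hx
    · exact Eventually.of_forall fun x h1 h2 => absurd ⟨h1, h2⟩ hθ
  have h2 : ∀ᵐ x : ℝ, ∀ b : ℚ, (1 : ℝ) < b → ∃ A > 0, ∀ m : ℕ,
      birkhoffSum D.iet (D.base.indicator g) m x ≤ A * ((m : ℝ) + 1) ^ (b : ℝ) := by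
    refine ae_all_iff.2 fun b => ?_
    by_cases hb : (1 : ℝ) < b
    · filter_upwards [D.ae_exists_birkhoffSum_le hlen hgm
        (fun x => indicator_nonneg (fun y hy => hε.le.trans (hg y hy)) x)
        ((integrable_indicator_iff D.measurableSet_base).2 hgi) hb] with x hx _ using hx
    · exact Eventually.of_forall fun x h1 => absurd h1 hb
  filter_upwards [Measure.quasiMeasurePreserving_fst.ae h1,
    Measure.quasiMeasurePreserving_fst.ae h2] with p hp1 hp2 hp c hc hcρ R
  obtain ⟨θ, hθ1, hθ2⟩ := exists_rat_btwn hcρ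
  -- Since c < θ there is room for b > 1 with b c < θ.
  obtain ⟨b, hb1, hb2⟩ := exists_rat_btwn ((one_lt_div hc).2 hθ1)
  obtain ⟨A, hA, hroof⟩ := hp2 b (by exact_mod_cast hb1)
  refine frequently_rpow_add_le_crossingSum hlen hε hg hp (hc.le.trans hθ1.le) hc
    ((lt_div_iff₀ hc).1 hb2).le hA (hp1 θ (hc.le.trans hθ1.le) hθ2) (fun m => ?_) R
  rw [← birkhoffSum_indicator hlen hp.1]
  exact hroof m

/-- If the sums over the crossings have controlled oscillation and are almost everywhere large for
arbitrarily large times, then so are the `L¹` norms of functions close to them. -/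
lemma frequently_rpow_le_lintegral (hlen : ∀ α, 0 < D.len α) (hε : 0 < ε)
    (hg : ∀ x ∈ D.base, ε ≤ g x) (hgm : Measurable (D.base.indicator g))
    (hgi : IntegrableOn g D.base) {h : 𝒜 → ℝ} {F : ℝ → ℝ × ℝ → ℝ} {R ρ : ℝ} (hρ : 0 < ρ)
    (hF : ∀ᵐ p : ℝ × ℝ, p ∈ D.flowSpace g → ∀ s, 0 ≤ s →
      |F s p - D.crossingSum g h s p| ≤ R)
    (hup : ∀ b, ρ < b → ∃ A ≥ 0, ∀ p ∈ D.flowSpace g, ∀ s ≥ 0, ∀ u ≥ 0,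
      |D.crossingSum g h (s + u) p - D.crossingSum g h s p| ≤ A * (u / ε + 2) ^ b)
    (hlow : ∀ᵐ p : ℝ × ℝ, p ∈ D.flowSpace g → ∀ c, 0 < c → c < ρ →
      ∃ᶠ s in atTop, s ^ c ≤ |D.crossingSum g h s p|)
    {c : ℝ} (hc : 0 < c) (hcρ : c < ρ) :
    ∃ᶠ s in atTop, ENNReal.ofReal (s ^ c) ≤ ∫⁻ p in D.flowSpace g, ‖F s p‖ₑ := by
  by_contra hcon
  rw [not_frequently] at hcon
  -- The parameters satisfy c < θ < θ' < ρ < b. The power κ is so large that κ(θ - c) ≥ 2, which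
  -- makes the Markov bounds summable; θ' and b are so close to ρ that (κ - 1) b < κ θ', which makes
  -- the oscillation between powers negligible.
  obtain ⟨θ, hcθ, hθρ⟩ := exists_between hcρ
  obtain ⟨κ', hκ'⟩ := exists_nat_gt (2 / (θ - c))
  set κ := κ' + 1 with hκ
  have hκ1 : 1 ≤ κ := by omega
  have hκ0 : (0 : ℝ) < κ := by positivity
  have hκ2 : 2 ≤ (κ : ℝ) * (θ - c) := by
    rw [div_lt_iff₀ (sub_pos.2 hcθ)] at hκ'
    have : (κ' : ℝ) * (θ - c) ≤ κ * (θ - c) := by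
      have := sub_pos.2 hcθ
      gcongr
      omega
    linarith
  have hθ0 : 0 < θ := hc.trans hcθ
  obtain ⟨θ', hθ'1, hθ'2⟩ : ∃ θ', max θ (((κ : ℝ) - 1) * ρ / κ) < θ' ∧ θ' < ρ := by
    refine exists_between (max_lt hθρ ?_)
    rw [div_lt_iff₀ hκ0]
    linarith
  have hκθ' : ((κ : ℝ) - 1) * ρ < κ * θ' := by
    have := (le_max_right _ _).trans_lt hθ'1
    rw [div_lt_iff₀ hκ0] at this
    linarith
  obtain ⟨b, hb1, hb2⟩ : ∃ b, ρ < b ∧ ((κ : ℝ) - 1) * b < κ * θ' := by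
    have hcont : ContinuousAt (fun b : ℝ => ((κ : ℝ) - 1) * b) ρ := by fun_prop
    have := (hcont.eventually_lt_const hκθ').filter_mono (nhdsWithin_le_nhds (s := Ioi ρ))
    obtain ⟨b, h1, h2⟩ := (this.and self_mem_nhdsWithin).exists
    exact ⟨b, h2, h1⟩
  obtain ⟨A, hA, hosc⟩ := hup b hb1
  set P : ℕ → Set (ℝ × ℝ) := fun j =>
    {p ∈ D.flowSpace g | (j : ℝ) ^ ((κ : ℝ) * θ) ≤ |D.crossingSum g h ((j : ℝ) ^ κ) p|} with hP
  have hV := (volume_flowSpace_lt_top hgm hgi).ne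
  set V := (volume (D.flowSpace g)).toReal with hVdef
  have hV0 : 0 ≤ V := ENNReal.toReal_nonneg
  set R' := max R 0 with hR'
  have hR'0 : 0 ≤ R' := le_max_right _ _
  have hFS := measurableSet_flowSpace hgm
  -- Markov's inequality along the powers
  have hmeas : ∀ᶠ j : ℕ in atTop, volume (P j) ≤ ENNReal.ofReal ((1 + R' * V) / (j : ℝ) ^ 2) := by
    have hpow : Tendsto (fun j : ℕ => (j : ℝ) ^ κ) atTop atTop :=
      (tendsto_pow_atTop (by omega)).comp tendsto_natCast_atTop_atTop
    filter_upwards [hpow.eventually hcon, eventually_ge_atTop 1] with j hj hj1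
    have hj1' : (1 : ℝ) ≤ j := by exact_mod_cast hj1
    have hj0 : (0 : ℝ) < j := by linarith
    have hPm : MeasurableSet (P j) :=
      measurableSet_le_crossingSum hlen hε hg hgm h (by positivity) _
    have hmarkov : ENNReal.ofReal ((j : ℝ) ^ ((κ : ℝ) * θ)) * volume (P j) ≤
        ENNReal.ofReal ((j : ℝ) ^ ((κ : ℝ) * c) * (1 + R' * V)) := by
      calc ENNReal.ofReal ((j : ℝ) ^ ((κ : ℝ) * θ)) * volume (P j)
          = ∫⁻ _p in P j, ENNReal.ofReal ((j : ℝ) ^ ((κ : ℝ) * θ)) := by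
            rw [setLIntegral_const]
        _ ≤ ∫⁻ p in P j, (‖F ((j : ℝ) ^ κ) p‖ₑ + ENNReal.ofReal R') := by
            refine lintegral_mono_ae ((ae_restrict_iff' hPm).2 ?_)
            filter_upwards [hF] with p hFp hp
            have h1 := hFp hp.1 ((j : ℝ) ^ κ) (by positivity)
            have h2 := hp.2
            rw [Real.enorm_eq_ofReal_abs, ← ENNReal.ofReal_add (abs_nonneg _) hR'0]
            refine ENNReal.ofReal_le_ofReal (h2.trans ?_)
            have h3 := abs_sub_abs_le_abs_sub (D.crossingSum g h ((j : ℝ) ^ κ) p)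
              (F ((j : ℝ) ^ κ) p)
            rw [abs_sub_comm] at h3
            linarith [le_max_left R 0]
        _ ≤ ∫⁻ p in D.flowSpace g, (‖F ((j : ℝ) ^ κ) p‖ₑ + ENNReal.ofReal R') :=
            lintegral_mono_set fun p hp => hp.1
        _ = (∫⁻ p in D.flowSpace g, ‖F ((j : ℝ) ^ κ) p‖ₑ) +
            ENNReal.ofReal R' * volume (D.flowSpace g) := by
            rw [lintegral_add_right _ measurable_const, setLIntegral_const]
        _ ≤ ENNReal.ofReal (((j : ℝ) ^ κ) ^ c) + ENNReal.ofReal (R' * V) := by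
            rw [ENNReal.ofReal_mul hR'0, hVdef, ENNReal.ofReal_toReal hV]
            gcongr
            exact (not_le.1 hj).le
        _ ≤ _ := by
            rw [← ENNReal.ofReal_add (by positivity) (by positivity)]
            refine ENNReal.ofReal_le_ofReal ?_
            rw [← Real.rpow_natCast, ← Real.rpow_mul hj0.le, mul_add, mul_one]
            have : 1 ≤ (j : ℝ) ^ ((κ : ℝ) * c) := Real.one_le_rpow hj1' (by positivity)
            have := le_mul_of_one_le_left (mul_nonneg hR'0 hV0) this
            linarith
    have hpos : 0 < (j : ℝ) ^ ((κ : ℝ) * θ) := by positivity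
    have hexp : (j : ℝ) ^ ((κ : ℝ) * c) * (1 + R' * V) ≤
        (j : ℝ) ^ ((κ : ℝ) * θ) * ((1 + R' * V) / (j : ℝ) ^ 2) := by
      have h1 : (j : ℝ) ^ ((κ : ℝ) * c) * (j : ℝ) ^ 2 ≤ (j : ℝ) ^ ((κ : ℝ) * θ) := by
        rw [← Real.rpow_natCast (j : ℝ) 2, ← Real.rpow_add hj0]
        exact Real.rpow_le_rpow_of_exponent_le hj1' (by push_cast; linarith)
      rw [mul_div_assoc', le_div_iff₀ (by positivity)]
      have : 0 ≤ 1 + R' * V := by positivity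
      calc _ = ((j : ℝ) ^ ((κ : ℝ) * c) * (j : ℝ) ^ 2) * (1 + R' * V) := by ring
        _ ≤ _ := by gcongr
    have h2 := hmarkov.trans (ENNReal.ofReal_le_ofReal hexp)
    rw [ENNReal.ofReal_mul hpos.le] at h2
    exact (ENNReal.mul_le_mul_iff_right (by simpa using hpos) ENNReal.ofReal_ne_top).1 h2
  obtain ⟨j₀, hj₀⟩ := eventually_atTop.1 hmeas
  have hsum : ∑' j, volume (P (j + j₀)) ≠ ⊤ := by
    have hs : Summable fun j : ℕ => (1 + R' * V) / ((j + j₀ : ℕ) : ℝ) ^ 2 := by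
      have := (Real.summable_one_div_nat_pow (p := 2)).2 one_lt_two
      have := ((summable_nat_add_iff j₀).2 this).mul_left (1 + R' * V)
      simpa [div_eq_mul_inv] using this
    refine ne_top_of_le_ne_top ?_ (ENNReal.tsum_le_tsum fun j => hj₀ (j + j₀) (by omega))
    rw [← ENNReal.ofReal_tsum_of_nonneg (fun j => by positivity) hs]
    exact ENNReal.ofReal_ne_top
  -- By Borel-Cantelli almost every point lies in only finitely many P j, whereas growth of order
  -- s^θ' and the oscillation bound put it in infinitely many. So the flow space would be null.
  have hfalse : ∀ᵐ p : ℝ × ℝ, p ∉ D.flowSpace g := by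
    filter_upwards [ae_eventually_notMem hsum, hlow] with p h1 h2 hp
    have h3 := h2 hp θ' (hθ0.trans ((le_max_left _ _).trans_lt hθ'1)) hθ'2
    have h4 := frequently_rpow_le_of_oscillation hA hε (hρ.le.trans hb1.le) (hosc p hp) hκ1
      hθ0.le ((le_max_left _ _).trans_lt hθ'1) hb2 h3
    refine h4 ?_
    obtain ⟨j₁, hj₁⟩ := eventually_atTop.1 h1
    refine eventually_atTop.2 ⟨j₁ + j₀, fun j hj hle => ?_⟩
    obtain ⟨i, rfl⟩ := Nat.exists_eq_add_of_le' (show j₀ ≤ j by omega)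
    exact hj₁ i (by omega) ⟨hp, hle⟩
  exact (volume_flowSpace_pos hlen hε hg).ne' (measure_eq_zero_iff_ae_notMem.2 hfalse)

end IETData
end

/-! ### The two growth exponents -/

/-- `log` of the size of the Birkhoff integrals is taken in `[-∞, ∞]`. -/
theorem proposition7p10 {𝒜 : Type*} [Fintype 𝒜] [DecidableEq 𝒜] {n : ℕ} (D : IETData 𝒜 n)
    (hlen : ∀ α, 0 < D.len α) (hirr : D.IsIrreducible)
    (N : ℕ → ℕ) (Λ : ℕ → ℝ) (hFDC : D.FDC N Λ)
    (a : ℝ) (ha0 : 0 < a) (ha1 : a < 1)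
    (g : ℝ → ℝ) (hg : D.PaG a g) (hgpos : ∃ ε > 0, ∀ x ∈ D.base, ε ≤ g x)
    (f : ℝ × ℝ → ℝ) (hfmeas : AEStronglyMeasurable f (volume.restrict (D.flowSpace g)))
    (hfbdd : ∃ B : ℝ, ∀ p ∈ D.flowSpace g, |f p| ≤ B)
    (hfsupp : ∃ K > 0, ∀ p ∈ D.flowSpace g, K ≤ p.2 → f p = 0)
    (h : 𝒜 → ℝ) (hH : h ∈ D.H)
    (hfh : ∀ α, ∀ᵐ x ∂(volume.restrict (Ico (D.left α) (D.right α))),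
      ∫ r in (0 : ℝ)..(g x), f (x, r) = h α)
    (lam : ℝ) (hlam : 0 < lam) (hgrowth : D.HasGrowthRate N h lam) :
    (∀ᵐ p ∂(volume.restrict (D.flowSpace g)),
      limsup (fun s : ℝ => ENNReal.log ‖D.birkhoffIntegral g f s p‖ₑ / (Real.log s : EReal)) atTop
        = ((lam / Λ 1 : ℝ) : EReal)) ∧
    limsup (fun s : ℝ =>
        ENNReal.log (∫⁻ p in D.flowSpace g, ‖D.birkhoffIntegral g f s p‖ₑ) / (Real.log s : EReal))
      atTop = ((lam / Λ 1 : ℝ) : EReal) := by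
  obtain ⟨ε, hε, hgε⟩ := hgpos
  obtain ⟨B, hB⟩ := hfbdd
  obtain ⟨K, hK, hfK⟩ := hfsupp
  have hg0 : ∀ x ∈ D.base, 0 ≤ g x := fun x hx => hε.le.trans (hgε x hx)
  have hgm := hg.measurable_indicator hlen
  have hgi := hg.integrableOn hlen ha0 ha1 hg0
  have hFS := IETData.measurableSet_flowSpace hgm
  have hρ : 0 < lam / Λ 1 := div_pos hlam (hlam.trans_le (hFDC.le_exponent_one hlam hgrowth))
  have hV := (IETData.volume_flowSpace_lt_top hgm hgi).ne
  set V := (volume (D.flowSpace g)).toReal with hVdef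
  have hV0 : 0 ≤ V := ENNReal.toReal_nonneg
  set R := |2 * (B * K)| with hR
  have hR0 : 0 ≤ R := abs_nonneg _
  have hF : ∀ᵐ p : ℝ × ℝ, p ∈ D.flowSpace g → ∀ s, 0 ≤ s →
      |D.birkhoffIntegral g f s p - D.crossingSum g h s p| ≤ R := by
    filter_upwards [Measure.quasiMeasurePreserving_fst.ae
      (IETData.ae_goodFiber hlen hg0 hgm hfmeas hB hfh)] with p hgood hp s hs
    exact (IETData.abs_birkhoffIntegral_sub_le hlen hε hgε hK hB hfK hp (hgood hp.1) hs).trans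
      (le_abs_self _)
  have hup : ∀ b, lam / Λ 1 < b → ∃ A ≥ 0, ∀ p ∈ D.flowSpace g, ∀ s ≥ 0, ∀ u ≥ 0,
      |D.crossingSum g h (s + u) p - D.crossingSum g h s p| ≤ A * (u / ε + 2) ^ b := by
    intro b hb
    obtain ⟨A, hA, hS⟩ := hFDC.exists_birkhoffSum_le hlen hlam hgrowth hb
    exact ⟨A, hA.le, fun p hp s hs u hu =>
      IETData.abs_crossingSum_sub_le hlen hε hgε hA.le (hρ.le.trans hb.le) hS hp hs hu⟩
  have hlow := hFDC.ae_frequently_rpow_add_le_crossingSum hlen hlam hgrowth hε hgε hgm hgi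
  -- The oscillation bound started at time 0, where no crossing has occurred, bounds the sum itself,
  -- uniformly over the flow space.
  have hbound : ∀ b, lam / Λ 1 < b → ∃ A ≥ 0, ∀ p ∈ D.flowSpace g,
      (∀ s, 0 ≤ s → |D.birkhoffIntegral g f s p - D.crossingSum g h s p| ≤ R) →
      ∀ s, 0 ≤ s → |D.birkhoffIntegral g f s p| ≤ A * (s / ε + 2) ^ b + R := by
    intro b hb
    obtain ⟨A, hA, hosc⟩ := hup b hb
    refine ⟨A, hA, fun p hp hFp s hs => ?_⟩
    have h1 := hosc p hp 0 le_rfl s hs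
    rw [zero_add, IETData.crossingSum_zero hlen hε hgε hp, sub_zero] at h1
    have h2 := abs_sub_abs_le_abs_sub (D.birkhoffIntegral g f s p) (D.crossingSum g h s p)
    linarith [hFp s hs]
  constructor
  · rw [ae_restrict_iff' hFS]
    filter_upwards [hF, hlow] with p hFp hlp hp
    refine limsup_log_div_log_eq hρ (fun b hb => ?_) (fun c hc hcρ => ?_)
    · obtain ⟨b', hb1, hb2⟩ := exists_between hb
      obtain ⟨A, hA, hbd⟩ := hbound b' hb1
      filter_upwards [eventually_affine_rpow_le hA hR0 hε (hρ.le.trans hb1.le) hb2,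
        eventually_ge_atTop 0] with s hs hs0
      rw [Real.enorm_eq_ofReal_abs]
      exact ENNReal.ofReal_le_ofReal ((hbd p hp (hFp hp) s hs0).trans hs)
    -- The crossing sums exceed s^c by the margin R, which absorbs the distance to the integral.
    · refine ((hlp hp c hc hcρ R).and_eventually (eventually_ge_atTop 0)).mono ?_
      rintro s ⟨hs, hs0⟩
      rw [Real.enorm_eq_ofReal_abs]
      refine ENNReal.ofReal_le_ofReal ?_
      have h1 := hFp hp s hs0
      have h2 := abs_sub_abs_le_abs_sub (D.crossingSum g h s p) (D.birkhoffIntegral g f s p)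
      rw [abs_sub_comm] at h2
      linarith
  · refine limsup_log_div_log_eq hρ (fun b hb => ?_) (fun c hc hcρ => ?_)
    · obtain ⟨b', hb1, hb2⟩ := exists_between hb
      obtain ⟨A, hA, hbd⟩ := hbound b' hb1
      filter_upwards [eventually_affine_rpow_le (A := A * V) (R := R * V) (mul_nonneg hA hV0)
        (mul_nonneg hR0 hV0) hε (hρ.le.trans hb1.le) hb2, eventually_ge_atTop 0] with s hs hs0
      have hnn : 0 ≤ A * (s / ε + 2) ^ b' + R := by positivity
      calc ∫⁻ p in D.flowSpace g, ‖D.birkhoffIntegral g f s p‖ₑ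
          ≤ ∫⁻ _p in D.flowSpace g, ENNReal.ofReal (A * (s / ε + 2) ^ b' + R) := by
            refine lintegral_mono_ae ((ae_restrict_iff' hFS).2 ?_)
            filter_upwards [hF] with p hFp hp
            rw [Real.enorm_eq_ofReal_abs]
            exact ENNReal.ofReal_le_ofReal (hbd p hp (hFp hp) s hs0)
        _ = ENNReal.ofReal ((A * (s / ε + 2) ^ b' + R) * V) := by
            rw [setLIntegral_const, ENNReal.ofReal_mul hnn, hVdef, ENNReal.ofReal_toReal hV]
        _ ≤ _ := ENNReal.ofReal_le_ofReal (by linarith)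
    · refine IETData.frequently_rpow_le_lintegral hlen hε hgε hgm hgi hρ hF hup ?_ hc hcρ
      filter_upwards [hlow] with p hp hpm c hc hcρ
      simpa using hp hpm c hc hcρ 0
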